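/- **Setting.** Fix $N_1,M,d\ge 1$, $T>0$, $\gamma_1\in[1/2,1)$, $\gamma_2\in(3/4,1)$, $\varphi=1-\gamma_2$, a data set $(x^{(i)},y^{(i)})_{i=1}^M\subset\mathbb R^d\times\mathbb R$ with empirical measure $\pi=\frac1M\sum_i\delta_{(x^{(i)},y^{(i)})}$, and $\sigma:\mathbb R\to\mathbb R$ infinitely differentiable and bounded. For parameters $\theta=(C^i,W^{2,j,i},W^{1,j})_{i\le N_2,\,j\le N_1}$ consider the network $$g_\theta(x)=\frac1{N_2^{\gamma_2}}\sum_{i=1}^{N_2}C^i\sigma(Z^{2,i}(x)),\qquad Z^{2,i}(x)=\frac1{N_1^{\gamma_1}}\sum_{j=1}^{N_1}W^{2,j,i}\sigma(W^{1,j}\cdot x).$$ It is trained by stochastic gradient descent on the loss $\frac12(y-g_\theta(x))^2$ with i.i.d. samples $(x_k,y_k)\sim\pi$: with $\alpha_C=N_2^{-(2-2\gamma_2)}$, $\alpha_{W,1}=N_1^{-(1-2\gamma_1)}N_2^{-(3-2\gamma_2)}$, $\alpha_{W,2}=N_1^{-(1-2\gamma_1)}N_2^{-(2-2\gamma_2)}$,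 $$\begin{aligned}C^i_{k+1}&=C^i_k+\tfrac{\alpha_C}{N_2^{\gamma_2}}(y_k-g_{\theta_k}(x_k))\,\sigma(Z^{2,i}_k(x_k)),\\ W^{2,j,i}_{k+1}&=W^{2,j,i}_k+\tfrac{\alpha_{W,2}}{N_1^{\gamma_1}N_2^{\gamma_2}}(y_k-g_{\theta_k}(x_k))\,C^i_k\sigma'(Z^{2,i}_k(x_k))\sigma(W^{1,j}_k\cdot x_k),\\ W^{1,j}_{k+1}&=W^{1,j}_k+\tfrac{\alpha_{W,1}}{N_1^{\gamma_1}}(y_k-g_{\theta_k}(x_k))\Big(\tfrac1{N_2^{\gamma_2}}\sum_{i=1}^{N_2}C^i_k\sigma'(Z^{2,i}_k(x_k))W^{2,j,i}_k\Big)\sigma'(W^{1,j}_k\cdot x_k)\,x_k.\end{aligned}$$ The initial parameters $C^i_0\sim\mu_C$, $W^{2,j,i}_0\sim\mu_{W^2}$, $W^{1,j}_0\sim\mu_{W^1}$ and the samples are all independent; $\mu_C,\mu_{W^2},\mu_{W^1}$ have mean zero and compact support. Put $h^{N_1,N_2}_t(x)=g_{\theta_{\lfloor N_2t\rfloor}}(x)$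 for $x\in\mathcal X=\{x^{(1)},\dots,x^{(M)}\}$, viewed as an $\mathbb R^M$-valued path. **Coefficients.** For $\theta=(c,w^2,w^1)\in\mathbb R\times\mathbb R^{N_1}\times(\mathbb R^d)^{N_1}$ let $Z(x)=N_1^{-\gamma_1}\sum_jw^{2,j}\sigma(w^{1,j}\cdot x)$ and $$B^1_{x,x'}=\sigma(Z(x'))\sigma(Z(x)),\quad B^{2,j}_{x,x'}=c^2\sigma'(Z(x'))\sigma'(Z(x))\sigma(w^{1,j}\cdot x')\sigma(w^{1,j}\cdot x),\quad B^{3,j}_x=c\,w^{2,j}\sigma'(w^{1,j}\cdot x)\sigma'(Z(x)).$$ Let $\gamma_0=\mu_C\otimes\mu_{W^2}^{\otimes N_1}\otimes\delta_{(W^{1,1}_0,\dots,W^{1,N_1}_0)}$ and let $\langle f,\gamma_0\rangle$ be the integral of $f$. All limiting objects below are functions of $W^1_0=(W^{1,j}_0)_j$ through $\gamma_0$. Define $$A_{x,x'}=\langle B^1_{x,x'},\gamma_0\rangle+\frac1{N_1}\sum_j\big[\langle B^{2,j}_{x,x'},\gamma_0\rangle+x\cdot x'\,\langle B^{3,j}_x,\gamma_0\rangle\langle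 B^{3,j}_{x'},\gamma_0\rangle\big],$$ and, for a linear functional $\ell$ on test functions, $$\mathcal D_{x,x'}(\ell)=\ell(B^1_{x,x'})+\frac1{N_1}\sum_j\ell(B^{2,j}_{x,x'})+\frac1{N_1}\sum_jx\cdot x'\big[\ell(B^{3,j}_x)\langle B^{3,j}_{x'},\gamma_0\rangle+\langle B^{3,j}_x,\gamma_0\rangle\ell(B^{3,j}_{x'})\big].$$ For a smooth test function $f(c,w^2,w^1)$ let $D^j_{x'}=c\,\sigma'(Z(x'))\sigma'(w^{1,j}\cdot x')w^{2,j}$, $F_{x'}=c\,\sigma'(Z(x'))\sum_j\sigma(w^{1,j}\cdot x')\,\partial_{w^{2,j}}f$, and $$C^{f}_{x'}=\partial_cf\,\sigma(Z(x'))+\frac1{N_1^{1-\gamma_1}}F_{x'}+\frac1{N_1^{1-\gamma_1}}\sum_j\langle D^j_{x'},\gamma_0\rangle\nabla_{w^{1,j}}f\cdot x'.$$ **Limits of lower order.** Let $h,K:[0,T]\to\mathbb R^M$ be the continuous solutions of $$h_t(x)=\int_0^t\!\!\int(y-h_s(x'))A_{x,x'}\,\pi(dx',dy)\,ds,\qquad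 K_t(x)=\int_0^t\!\!\int\big[(y-h_s(x'))\mathcal D_{x,x'}(l_s)-K_s(x')A_{x,x'}\big]\pi(dx',dy)\,ds,$$ where $$l_t(f)=\int_0^t\!\!\int(y-h_s(x'))\langle C^f_{x'},\gamma_0\rangle\,\pi(dx',dy)\,ds,$$ and set $$\begin{aligned}L_t(f)=\int_0^t\!\!\int\Big\{&(y-h_s(x'))\Big[l_s\big(\partial_cf\,\sigma(Z(x'))\big)+\tfrac1{N_1^{1-\gamma_1}}l_s(F_{x'})+\tfrac1{N_1^{1-\gamma_1}}l_s\Big(\sum_j\langle D^j_{x'},\gamma_0\rangle\nabla_{w^{1,j}}f\cdot x'\Big)\\&+\tfrac1{N_1^{1-\gamma_1}}\Big\langle\sum_jl_s(D^j_{x'})\nabla_{w^{1,j}}f\cdot x',\gamma_0\Big\rangle\Big]-K_s(x')\langle C^f_{x'},\gamma_0\rangle\Big\}\,\pi(dx',dy)\,ds.\end{aligned}$$ Let $\mathcal G=(\mathcal G(x))_{x\in\mathcal X}$ be, conditionally on $W^1_0$, a centred Gaussian vector with covariance $\langle c^2\sigma(Z(x))\sigma(Z(x')),\gamma_0\rangle$.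 Put $K^{N_1,N_2}_t=N_2^{\varphi}(h^{N_1,N_2}_t-h_t)$ and, for $\zeta\in\mathbb R$, $\Psi^{N_1,N_2}_t=N_2^{\zeta-\varphi}(K^{N_1,N_2}_t-K_t)$. **Theorem.** Suppose that either $\gamma_2<5/6$ and $\zeta\le\gamma_2-\frac12$, or $\gamma_2\ge5/6$ and $\zeta\le2-2\gamma_2$. The equations for $h$ and $K$ have solutions, and, as $N_2\to\infty$, $\Psi^{N_1,N_2}$ converges in distribution in the Skorokhod space $D_{\mathbb R^M}([0,T])$, jointly with $W^1_0$, to a continuous process $\Psi$ satisfying, for $t\in[0,T]$ and $x\in\mathcal X$: 1. If $\gamma_2<5/6$ and $\zeta\le\gamma_2-\frac12$, or $\gamma_2\ge5/6$ and $\zeta<2-2\gamma_2$, then $$\Psi_t(x)=\Psi_0(x)-\int_0^t\!\!\int\Psi_s(x')A_{x,x'}\,\pi(dx',dy)\,ds,$$ where $\Psi_0=\mathcal G$ if $\zeta=\gamma_2-\frac12$ and $\Psi_0=0$ if $\zeta<\gamma_2-\frac12$. 2. If $\gamma_2\ge5/6$ and $\zeta=2-2\gamma_2$, then $$\begin{aligned}\Psi_t(x)=\Psi_0(x)+\int_0^t\!\!\int\Big\{&-\Psi_s(x')A_{x,x'}+(y-h_s(x'))\,\mathcal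 D_{x,x'}(L_s)-K_s(x')\,\mathcal D_{x,x'}(l_s)\\&+(y-h_s(x'))\frac1{N_1}\sum_jx\cdot x'\,l_s(B^{3,j}_x)\,l_s(B^{3,j}_{x'})\Big\}\,\pi(dx',dy)\,ds,\end{aligned}$$ where $\Psi_0=\mathcal G$ if $\gamma_2=5/6$ and $\Psi_0=0$ if $\gamma_2>5/6$. -/

import Mathlib

open MeasureTheory ProbabilityTheory Filter Set
open scoped Topology

/-! ### The Skorokhod space `D_E([0,T])` -/

/-- Right-continuous paths `[0,T] → E` with left limits. -/
structure SkorokhodSpace (T : ℝ) (E : Type*) [TopologicalSpace E] where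
  path : Set.Icc (0 : ℝ) T → E
  right_continuous : ∀ t, ContinuousWithinAt path (Set.Ici t) t
  left_limit : ∀ t, ∃ l, Tendsto path (𝓝[<] t) (𝓝 l)

namespace SkorokhodSpace

/-- The open ball of radius `r` for the Skorokhod `J₁` distance
`d(z, z') = inf_τ max (sup_t |τ t - t|) (sup_t |z t - z' (τ t)|)`, where `τ` ranges over the
increasing bijections of `[0,T]`. -/
def ball {T : ℝ} {E : Type*} [PseudoMetricSpace E] (z : SkorokhodSpace T E) (r : ℝ) :
    Set (SkorokhodSpace T E) :=
  {z' | ∃ τ : Set.Icc (0 : ℝ) T ≃o Set.Icc (0 : ℝ) T, ∃ δ : ℝ, 0 ≤ δ ∧ δ < r ∧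
    ∀ t, |(τ t : ℝ) - (t : ℝ)| ≤ δ ∧ dist (z.path t) (z'.path (τ t)) ≤ δ}

/-- The Skorokhod `J₁` topology. -/
instance {T : ℝ} {E : Type*} [PseudoMetricSpace E] : TopologicalSpace (SkorokhodSpace T E) :=
  TopologicalSpace.generateFrom {U | ∃ z : SkorokhodSpace T E, ∃ r : ℝ, U = ball z r}

instance {T : ℝ} {E : Type*} [PseudoMetricSpace E] : MeasurableSpace (SkorokhodSpace T E) :=
  borel _

instance {T : ℝ} {E : Type*} [PseudoMetricSpace E] : BorelSpace (SkorokhodSpace T E) :=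
  ⟨rfl⟩

end SkorokhodSpace

/-! ### The network and its training by stochastic gradient descent -/

/-- The fixed data of the problem: activation function, scaling exponents, data set, and the laws
of the initial parameters. The first hidden layer has `N₁` units, the inputs lie in `ℝ^d`, and the
data set has `M` points. -/
structure TwoLayerNet (d N₁ M : ℕ) where
  act : ℝ → ℝ
  γ₁ : ℝ
  γ₂ : ℝ
  x : Fin M → EuclideanSpace ℝ (Fin d)
  y : Fin M → ℝ
  lawC : Measure ℝ
  lawW2 : Measure ℝ
  lawW1 : Measure (EuclideanSpace ℝ (Fin d))

/-- The points `θ = (c, w², w¹)` of `ℝ^{1+N₁(1+d)}`: the parameters that one unit of the second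
hidden layer sees. -/
abbrev UnitParam (d N₁ : ℕ) : Type :=
  ℝ × (Fin N₁ → ℝ) × (Fin N₁ → EuclideanSpace ℝ (Fin d))

/-- All the parameters `C^i`, `W^{2,j,i}`, `W^{1,j}` of the network. -/
structure NetState (d N₁ N₂ : ℕ) where
  C : Fin N₂ → ℝ
  W2 : Fin N₁ → Fin N₂ → ℝ
  W1 : Fin N₁ → EuclideanSpace ℝ (Fin d)

/-- `θ^i = (C^i, W^{2,1,i}, …, W^{2,N₁,i}, W^{1,1}, …, W^{1,N₁})`. -/
def NetState.unit {d N₁ N₂ : ℕ} (θ : NetState d N₁ N₂) (i : Fin N₂) : UnitParam d N₁ :=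
  (θ.C i, fun j => θ.W2 j i, θ.W1)

namespace TwoLayerNet

noncomputable section

variable {d N₁ M : ℕ} (S : TwoLayerNet d N₁ M)

/-- `Z^{2,N₁}(x) = N₁^{-γ₁} ∑_j w^{2,j} σ(w^{1,j} x)`. -/
def Z (x : EuclideanSpace ℝ (Fin d)) (θ : UnitParam d N₁) : ℝ :=
  1 / (N₁ : ℝ) ^ S.γ₁ * ∑ j, θ.2.1 j * S.act (inner ℝ (θ.2.2 j) x)

/-- The network output `g_θ(x) = N₂^{-γ₂} ∑_i C^i σ(Z^{2,i}(x))`. -/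
def output {N₂ : ℕ} (θ : NetState d N₁ N₂) (x : EuclideanSpace ℝ (Fin d)) : ℝ :=
  1 / (N₂ : ℝ) ^ S.γ₂ * ∑ i, θ.C i * S.act (S.Z x (θ.unit i))

/-- The learning rate of the outer weights `C^i`. -/
def rateC (N₂ : ℕ) : ℝ := 1 / (N₂ : ℝ) ^ (2 - 2 * S.γ₂)

/-- The learning rate of the first layer weights `W^{1,j}`. -/
def rateW1 (N₂ : ℕ) : ℝ :=
  1 / ((N₁ : ℝ) ^ (1 - 2 * S.γ₁) * (N₂ : ℝ) ^ (3 - 2 * S.γ₂))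

/-- The learning rate of the second layer weights `W^{2,j,i}`. -/
def rateW2 (N₂ : ℕ) : ℝ :=
  1 / ((N₁ : ℝ) ^ (1 - 2 * S.γ₁) * (N₂ : ℝ) ^ (2 - 2 * S.γ₂))

/-- One step of stochastic gradient descent with the sample `p = (x_k, y_k)`. -/
def sgdStep {N₂ : ℕ} (θ : NetState d N₁ N₂) (p : EuclideanSpace ℝ (Fin d) × ℝ) :
    NetState d N₁ N₂ where
  C i := θ.C i + S.rateC N₂ / (N₂ : ℝ) ^ S.γ₂ * (p.2 - S.output θ p.1) *
    S.act (S.Z p.1 (θ.unit i))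
  W2 j i := θ.W2 j i + S.rateW2 N₂ / ((N₁ : ℝ) ^ S.γ₁ * (N₂ : ℝ) ^ S.γ₂) *
    (p.2 - S.output θ p.1) * (θ.C i * deriv S.act (S.Z p.1 (θ.unit i)) *
      S.act (inner ℝ (θ.W1 j) p.1))
  W1 j := θ.W1 j + (S.rateW1 N₂ / (N₁ : ℝ) ^ S.γ₁ * (p.2 - S.output θ p.1) *
    (1 / (N₂ : ℝ) ^ S.γ₂ * ∑ i, θ.C i * deriv S.act (S.Z p.1 (θ.unit i)) * θ.W2 j i) *
      deriv S.act (inner ℝ (θ.W1 j) p.1)) • p.1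

/-- The parameters after `k` steps, started from `θ₀` and run with the samples `p 0, p 1, …`. -/
def sgd {N₂ : ℕ} (θ₀ : NetState d N₁ N₂) (p : ℕ → EuclideanSpace ℝ (Fin d) × ℝ) :
    ℕ → NetState d N₁ N₂
  | 0 => θ₀
  | k + 1 => S.sgdStep (sgd θ₀ p k) (p k)

/-- The time-scaled output `h^{N₁,N₂}_t(x^{(k)}) = g_{θ_{⌊N₂ t⌋}}(x^{(k)})` of the network with `N₂`
units in the second hidden layer, initialized with `c`, `w2`, `w1` and trained on `p`. -/
def outputPath (N₂ : ℕ) (c : ℕ → ℝ) (w2 : Fin N₁ → ℕ → ℝ)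
    (w1 : Fin N₁ → EuclideanSpace ℝ (Fin d)) (p : ℕ → EuclideanSpace ℝ (Fin d) × ℝ)
    (t : ℝ) (k : Fin M) : ℝ :=
  S.output (S.sgd (N₂ := N₂) ⟨fun i => c i, fun j i => w2 j i, w1⟩ p ⌊(N₂ : ℝ) * t⌋₊) (S.x k)

/-- The exponent `φ = 1 - γ₂`. -/
def φ : ℝ := 1 - S.γ₂

/-- The first order fluctuation `K^{N₁,N₂}_t = N₂^φ (h^{N₁,N₂}_t - h^{N₁}_t)`, for a given path
`h = h^{N₁}`. -/
def fluctuation₁ (N₂ : ℕ) (c : ℕ → ℝ) (w2 : Fin N₁ → ℕ → ℝ)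
    (w1 : Fin N₁ → EuclideanSpace ℝ (Fin d)) (p : ℕ → EuclideanSpace ℝ (Fin d) × ℝ)
    (h : ℝ → Fin M → ℝ) (t : ℝ) (k : Fin M) : ℝ :=
  (N₂ : ℝ) ^ S.φ * (S.outputPath N₂ c w2 w1 p t k - h t k)

/-- The second order fluctuation `Ψ^{N₁,N₂}_t = N₂^{ζ-φ} (K^{N₁,N₂}_t - K^{N₁}_t)`, for given paths
`h = h^{N₁}` and `K = K^{N₁}`. -/
def fluctuation₂ (ζ : ℝ) (N₂ : ℕ) (c : ℕ → ℝ) (w2 : Fin N₁ → ℕ → ℝ)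
    (w1 : Fin N₁ → EuclideanSpace ℝ (Fin d)) (p : ℕ → EuclideanSpace ℝ (Fin d) × ℝ)
    (h K : ℝ → Fin M → ℝ) (t : ℝ) (k : Fin M) : ℝ :=
  (N₂ : ℝ) ^ (ζ - S.φ) * (S.fluctuation₁ N₂ c w2 w1 p h t k - K t k)

/-! ### Assumptions -/

/-- The empirical measure `π = M⁻¹ ∑_i δ_{(x^{(i)}, y^{(i)})}` of the data set. -/
def dataLaw : Measure (EuclideanSpace ℝ (Fin d) × ℝ) :=
  ((M : ENNReal)⁻¹) • ∑ i, Measure.dirac (S.x i, S.y i)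

/-- The activation function is smooth and bounded, the initial parameters have compactly
supported mean-zero laws, and the initial parameters and the samples `p k` (drawn from `π`) are all
independent. -/
structure Assumptions {Ω : Type*} [MeasurableSpace Ω] (P : Measure Ω)
    (C : ℕ → Ω → ℝ) (W2 : Fin N₁ → ℕ → Ω → ℝ)
    (W1 : Fin N₁ → Ω → EuclideanSpace ℝ (Fin d))
    (p : ℕ → Ω → EuclideanSpace ℝ (Fin d) × ℝ) : Prop where
  act_smooth : ContDiff ℝ (⊤ : ℕ∞) S.act
  act_bounded : ∃ B : ℝ, ∀ r, |S.act r| ≤ B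
  compactC : ∃ K : Set ℝ, IsCompact K ∧ S.lawC Kᶜ = 0
  compactW2 : ∃ K : Set ℝ, IsCompact K ∧ S.lawW2 Kᶜ = 0
  compactW1 : ∃ K : Set (EuclideanSpace ℝ (Fin d)), IsCompact K ∧ S.lawW1 Kᶜ = 0
  meanC : ∫ c, c ∂S.lawC = 0
  meanW2 : ∫ w, w ∂S.lawW2 = 0
  meanW1 : ∫ w, w ∂S.lawW1 = 0
  measurableC : ∀ i, Measurable (C i)
  measurableW2 : ∀ j i, Measurable (W2 j i)
  measurableW1 : ∀ j, Measurable (W1 j)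
  measurable_sample : ∀ k, Measurable (p k)
  hasLawC : ∀ i, HasLaw (C i) S.lawC P
  hasLawW2 : ∀ j i, HasLaw (W2 j i) S.lawW2 P
  hasLawW1 : ∀ j, HasLaw (W1 j) S.lawW1 P
  hasLaw_sample : ∀ k, HasLaw (p k) S.dataLaw P
  independent : iIndep
    (Sum.elim (fun i : ℕ => MeasurableSpace.comap (C i) inferInstance)
      (Sum.elim (fun q : Fin N₁ × ℕ => MeasurableSpace.comap (W2 q.1 q.2) inferInstance)
        (Sum.elim (fun j : Fin N₁ => MeasurableSpace.comap (W1 j) inferInstance)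
          (fun k : ℕ => MeasurableSpace.comap (p k) inferInstance)))) P

/-! ### The coefficients of the limiting equations

Here `w` is a realization of the initial first layer weights `(W₀^{1,1}, …, W₀^{1,N₁})`. -/

/-- `γ₀^{N₁} = μ_C × μ_{W²} × ⋯ × μ_{W²} × δ_{w¹} × ⋯ × δ_{w^{N₁}}`. -/
def γ₀ (w : Fin N₁ → EuclideanSpace ℝ (Fin d)) : Measure (UnitParam d N₁) :=
  S.lawC.prod ((Measure.pi fun _ : Fin N₁ => S.lawW2).prod (Measure.dirac w))

/-- `⟨f, γ₀^{N₁}⟩`. -/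
def mean (w : Fin N₁ → EuclideanSpace ℝ (Fin d)) (f : UnitParam d N₁ → ℝ) : ℝ :=
  ∫ θ, f θ ∂(S.γ₀ w)

/-- `B^1_{x,x'}`. -/
def B1 (x x' : EuclideanSpace ℝ (Fin d)) (θ : UnitParam d N₁) : ℝ :=
  S.act (S.Z x' θ) * S.act (S.Z x θ)

/-- `B^{2,j}_{x,x'}`. -/
def B2 (j : Fin N₁) (x x' : EuclideanSpace ℝ (Fin d)) (θ : UnitParam d N₁) : ℝ :=
  θ.1 ^ 2 * deriv S.act (S.Z x' θ) * deriv S.act (S.Z x θ) *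
    S.act (inner ℝ (θ.2.2 j) x') * S.act (inner ℝ (θ.2.2 j) x)

/-- `B^{3,j}_x`. -/
def B3 (j : Fin N₁) (x : EuclideanSpace ℝ (Fin d)) (θ : UnitParam d N₁) : ℝ :=
  θ.1 * θ.2.1 j * deriv S.act (inner ℝ (θ.2.2 j) x) * deriv S.act (S.Z x θ)

/-- `A^{N₁}_{x,x'}`. -/
def A (w : Fin N₁ → EuclideanSpace ℝ (Fin d)) (x x' : EuclideanSpace ℝ (Fin d)) : ℝ :=
  S.mean w (S.B1 x x') + 1 / (N₁ : ℝ) * ∑ j, (S.mean w (S.B2 j x x') +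
    inner ℝ x x' * (S.mean w (S.B3 j x) * S.mean w (S.B3 j x')))

/-- The first order variation of `A^{N₁}_{x,x'}` when `γ₀^{N₁}` moves in the direction of the linear
functional `ℓ` on test functions. -/
def dA (w : Fin N₁ → EuclideanSpace ℝ (Fin d)) (ℓ : (UnitParam d N₁ → ℝ) → ℝ)
    (x x' : EuclideanSpace ℝ (Fin d)) : ℝ :=
  ℓ (S.B1 x x') + 1 / (N₁ : ℝ) * ∑ j, ℓ (S.B2 j x x') +
    1 / (N₁ : ℝ) * ∑ j, inner ℝ x x' *
      (ℓ (S.B3 j x) * S.mean w (S.B3 j x') + S.mean w (S.B3 j x) * ℓ (S.B3 j x'))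

/-- The quadratic term `N₁⁻¹ ∑_j (x·x') ℓ(B^{3,j}_x) ℓ(B^{3,j}_{x'})` of the same variation. -/
def ddA (ℓ : (UnitParam d N₁ → ℝ) → ℝ) (x x' : EuclideanSpace ℝ (Fin d)) : ℝ :=
  1 / (N₁ : ℝ) * ∑ j, inner ℝ x x' * (ℓ (S.B3 j x) * ℓ (S.B3 j x'))

/-- `∂_c f`. -/
def dc (f : UnitParam d N₁ → ℝ) (θ : UnitParam d N₁) : ℝ :=
  fderiv ℝ f θ (1, 0, 0)

/-- `∂_{w^{2,j}} f`. -/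
def dw2 (j : Fin N₁) (f : UnitParam d N₁ → ℝ) (θ : UnitParam d N₁) : ℝ :=
  fderiv ℝ f θ (0, Pi.single j 1, 0)

/-- `∇_{w^{1,j}} f · x`. -/
def dw1 (j : Fin N₁) (x : EuclideanSpace ℝ (Fin d)) (f : UnitParam d N₁ → ℝ)
    (θ : UnitParam d N₁) : ℝ :=
  fderiv ℝ f θ (0, 0, Pi.single j x)

/-- `c σ'(Z^{2,N₁}(x')) σ(w^1 x') · ∂_{w²} f`. -/
def gradW2 (x' : EuclideanSpace ℝ (Fin d)) (f : UnitParam d N₁ → ℝ)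
    (θ : UnitParam d N₁) : ℝ :=
  θ.1 * deriv S.act (S.Z x' θ) * ∑ j, S.act (inner ℝ (θ.2.2 j) x') * dw2 j f θ

/-- The `j`-th entry of `c σ'(Z^{2,N₁}(x')) σ'(w^1 x') w²`. -/
def D (j : Fin N₁) (x' : EuclideanSpace ℝ (Fin d)) (θ : UnitParam d N₁) : ℝ :=
  θ.1 * deriv S.act (S.Z x' θ) * deriv S.act (inner ℝ (θ.2.2 j) x') * θ.2.1 j

/-- `⟨c σ'(Z^{2,N₁}(x')) σ'(w^1 x') w², γ₀^{N₁}⟩ · ∇_{w^1} f x'`. -/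
def gradW1 (w : Fin N₁ → EuclideanSpace ℝ (Fin d)) (x' : EuclideanSpace ℝ (Fin d))
    (f : UnitParam d N₁ → ℝ) (θ : UnitParam d N₁) : ℝ :=
  ∑ j, S.mean w (S.D j x') * dw1 j x' f θ

/-- `C^{N₁,f}_{x'}`. -/
def Cf (w : Fin N₁ → EuclideanSpace ℝ (Fin d)) (x' : EuclideanSpace ℝ (Fin d))
    (f : UnitParam d N₁ → ℝ) (θ : UnitParam d N₁) : ℝ :=
  dc f θ * S.act (S.Z x' θ) + 1 / (N₁ : ℝ) ^ (1 - S.γ₁) * S.gradW2 x' f θ +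
    1 / (N₁ : ℝ) ^ (1 - S.γ₁) * S.gradW1 w x' f θ

/-! ### The limiting objects

Since `π` is the empirical measure of the data set, an integral `∫ F(x', y) π(dx', dy)` is the
average `M⁻¹ ∑_i F(x^{(i)}, y^{(i)})`. -/

/-- `h` is the first order limit `h^{N₁}` on `[0,T]`. -/
def IsLimitOutput (T : ℝ) (w : Fin N₁ → EuclideanSpace ℝ (Fin d)) (h : ℝ → Fin M → ℝ) : Prop :=
  ContinuousOn h (Set.Icc 0 T) ∧ ∀ t ∈ Set.Icc 0 T, ∀ k,
    h t k = ∫ s in (0 : ℝ)..t, 1 / (M : ℝ) * ∑ i, (S.y i - h s i) * S.A w (S.x k) (S.x i)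

/-- `l^{N₁}_t(f) = ∫₀ᵗ ∫ (y - h_s(x')) ⟨C^{N₁,f}_{x'}, γ₀^{N₁}⟩ π(dx',dy) ds`. -/
def l (w : Fin N₁ → EuclideanSpace ℝ (Fin d)) (h : ℝ → Fin M → ℝ) (t : ℝ)
    (f : UnitParam d N₁ → ℝ) : ℝ :=
  ∫ s in (0 : ℝ)..t, 1 / (M : ℝ) * ∑ i, (S.y i - h s i) * S.mean w (S.Cf w (S.x i) f)

/-- `K` is the first order fluctuation limit `K^{N₁}` on `[0,T]`, for `φ = 1 - γ₂` and
`γ₂ ∈ (3/4, 1)`. -/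
def IsLimitFluctuation₁ (T : ℝ) (w : Fin N₁ → EuclideanSpace ℝ (Fin d))
    (h K : ℝ → Fin M → ℝ) : Prop :=
  ContinuousOn K (Set.Icc 0 T) ∧ ∀ t ∈ Set.Icc 0 T, ∀ k,
    K t k = ∫ s in (0 : ℝ)..t, 1 / (M : ℝ) * ∑ i,
      ((S.y i - h s i) * S.dA w (S.l w h s) (S.x k) (S.x i) - K s i * S.A w (S.x k) (S.x i))

/-- `L^{N₁}_t(f)`, the limit of `N₂^φ (l^{N₁,N₂}_t(f) - l^{N₁}_t(f))`. -/
def L (w : Fin N₁ → EuclideanSpace ℝ (Fin d)) (h K : ℝ → Fin M → ℝ) (t : ℝ)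
    (f : UnitParam d N₁ → ℝ) : ℝ :=
  ∫ s in (0 : ℝ)..t, 1 / (M : ℝ) * ∑ i,
    ((S.y i - h s i) *
      (S.l w h s (fun θ => dc f θ * S.act (S.Z (S.x i) θ)) +
        1 / (N₁ : ℝ) ^ (1 - S.γ₁) * S.l w h s (S.gradW2 (S.x i) f) +
        1 / (N₁ : ℝ) ^ (1 - S.γ₁) * S.l w h s (S.gradW1 w (S.x i) f) +
        1 / (N₁ : ℝ) ^ (1 - S.γ₁) *
          S.mean w (fun θ => ∑ j, S.l w h s (S.D j (S.x i)) * dw1 j (S.x i) f θ)) -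
      K s i * S.mean w (S.Cf w (S.x i) f))

/-- `ψ` solves `dψ = -A^{N₁} ψ` (averaged against `π`) on `[0,T]` with initial value `ψ₀`. -/
def SolvesHomogeneous (T : ℝ) (w : Fin N₁ → EuclideanSpace ℝ (Fin d)) (ψ₀ : Fin M → ℝ)
    (ψ : ℝ → Fin M → ℝ) : Prop :=
  ContinuousOn ψ (Set.Icc 0 T) ∧ ∀ t ∈ Set.Icc 0 T, ∀ k,
    ψ t k = ψ₀ k - ∫ s in (0 : ℝ)..t, 1 / (M : ℝ) * ∑ i, ψ s i * S.A w (S.x k) (S.x i)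

/-- `ψ` solves on `[0,T]` the linear equation driven by `L^{N₁}`, `l^{N₁}` and `K^{N₁}`, with initial
value `ψ₀`. -/
def SolvesForced (T : ℝ) (w : Fin N₁ → EuclideanSpace ℝ (Fin d)) (h K : ℝ → Fin M → ℝ)
    (ψ₀ : Fin M → ℝ) (ψ : ℝ → Fin M → ℝ) : Prop :=
  ContinuousOn ψ (Set.Icc 0 T) ∧ ∀ t ∈ Set.Icc 0 T, ∀ k,
    ψ t k = ψ₀ k + ∫ s in (0 : ℝ)..t, 1 / (M : ℝ) * ∑ i,
      (-(ψ s i * S.A w (S.x k) (S.x i)) +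
        (S.y i - h s i) * S.dA w (S.L w h K s) (S.x k) (S.x i) +
        (S.y i - h s i) * S.ddA (S.l w h s) (S.x k) (S.x i) -
        K s i * S.dA w (S.l w h s) (S.x k) (S.x i))

/-- The covariance matrix `⟨c² σ(Z(x)) σ(Z(x')), γ₀^{N₁}⟩` of the Gaussian vector `𝒢^{N₁}`. -/
def cov (w : Fin N₁ → EuclideanSpace ℝ (Fin d)) : Matrix (Fin M) (Fin M) ℝ :=
  Matrix.of fun k k' => S.mean w fun θ =>
    (θ.1 * S.act (S.Z (S.x k) θ)) * (θ.1 * S.act (S.Z (S.x k') θ))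

end

end TwoLayerNet

set_option linter.unusedSectionVars false

/-! ### Elementary estimates -/

/-! The proof is a deterministic expansion, valid on an almost sure event, followed by one central
limit theorem. Write N for N₂ and put ε = N^(γ₂-1) = N^(-φ).

The units (C^i, W^{2,·,i}, W^1) are particles that interact only through empirical means. One
training step moves each of them by ε/N times smooth vector fields, weighted by residuals and
empirical means, and the output is ε⁻¹ times the empirical mean of c σ(Z). Over [0,T] a particle
moves by O(ε) only, yet the output moves by O(1). Hence the mean of a test function f expands as
m(f) + ε l(f) + ε² L(f) + O(ε³ + δ), and the output as h + ε K + ε² U + V + O(ε³ + δ). Here δ =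
N^(-1/2+s), with s > 0 small, bounds the sampling errors. V solves the homogeneous linear equation
exactly, started from the initial output, which may be as large as δ/ε. The orders are reached by
bootstrapping: an output error ε^j + δ/ε enters the means only with a factor ε, and better means
improve the equation of the outputs, which Gronwall's inequality closes (`outPath_sub_isBigO`,
`outPath_sub_second`).

The sample noise only enters the remainder. The centred data weights have partial sums O(N^(1/2+s))
almost surely, by sub-Gaussian tails and Borel–Cantelli, and summation by parts passes this on to
the slowly varying drifts (`particleMean_sub_integral`). So no martingale argument is needed.

Since Ψ = N^ζ (g - h - ε K), the term U survives with the factor N^(ζ-(2-2γ₂)), and V, which is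
linear in N^(1/2-γ₂) times a normalised sum, with the factor N^(ζ-(γ₂-1/2)). The remainder vanishes
(`Typical.fluctuation_sub`). The two critical exponents coincide at γ₂ = 5/6.

It remains to find the limit law of the normalised initial sum jointly with W^1. The first layer is
independent of the other initial parameters, so it can be frozen: the central limit theorem holds
for each fixed w, and integration over w gives joint convergence (`tendsto_joint`). The limit path
is a continuous function of w and of the Gaussian vector, and a Slutsky argument transfers the
convergence to the Skorokhod space (`tendstoInDistribution_of_uniformly_close`). -/

theorem gronwall_integral {ι : Type*} [Fintype ι] {T a c B : ℝ} (ha : 0 ≤ a) (hc : 0 ≤ c)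
    (hB0 : 0 ≤ B) {e : ℝ → ι → ℝ} {A : ι → ι → ℝ} (hA : ∀ k i, |A k i| ≤ c)
    (hB : ∀ t ∈ Icc 0 T, ∀ k, |e t k| ≤ B)
    (h : ∀ t ∈ Icc 0 T, ∀ k, |e t k + ∫ s in (0 : ℝ)..t, ∑ i, A k i * e s i| ≤ a) :
    ∀ t ∈ Icc 0 T, ∀ k, |e t k| ≤ 2 * a * Real.exp ((2 * Fintype.card ι * c + 1) * t) := by
  -- The rate is large enough that `card ι * c / lam ≤ 1 / 2`: integrating the exponential bound
  -- returns at most half of it.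
  set lam : ℝ := 2 * Fintype.card ι * c + 1 with hlam
  have hlam0 : 0 < lam := by positivity
  -- Each pass through the integral inequality halves the excess over `2 * a`, so the a priori bound
  -- `B` disappears in the limit. No regularity of `e` enters.
  have key : ∀ n : ℕ, ∀ t ∈ Icc 0 T, ∀ k,
      |e t k| ≤ (2 * a + B / 2 ^ n) * Real.exp (lam * t) := by
    intro n
    induction n with
    | zero =>
      intro t ht k
      have h1 : 1 ≤ Real.exp (lam * t) := Real.one_le_exp (mul_nonneg hlam0.le ht.1)
      calc |e t k| ≤ B := hB t ht k
        _ ≤ (2 * a + B / 2 ^ 0) * 1 := by simp; linarith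
        _ ≤ _ := by gcongr
    | succ n ih =>
      intro t ht k
      set b := 2 * a + B / 2 ^ n with hb
      have hb0 : 0 ≤ b := by positivity
      have h1 : 1 ≤ Real.exp (lam * t) := Real.one_le_exp (mul_nonneg hlam0.le ht.1)
      have hint : ‖∫ s in (0 : ℝ)..t, ∑ i, A k i * e s i‖ ≤
          ∫ s in (0 : ℝ)..t, (Fintype.card ι * c * b) * Real.exp (lam * s) := by
        refine intervalIntegral.norm_integral_le_of_norm_le ht.1 ?_
          (Continuous.intervalIntegrable (by fun_prop) _ _)
        refine Eventually.of_forall fun s hs => ?_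
        have hs' : s ∈ Icc 0 T := ⟨hs.1.le, hs.2.trans ht.2⟩
        calc ‖∑ i, A k i * e s i‖ ≤ ∑ _i : ι, c * (b * Real.exp (lam * s)) := by
              refine norm_sum_le_of_le _ fun i _ => ?_
              rw [Real.norm_eq_abs, abs_mul]
              exact mul_le_mul (hA k i) (ih s hs' i) (abs_nonneg _) hc
          _ = _ := by simp; ring
      have hcomp : ∫ s in (0 : ℝ)..t, (Fintype.card ι * c * b) * Real.exp (lam * s) ≤
          b / 2 * Real.exp (lam * t) := by
        rw [intervalIntegral.integral_const_mul,
          intervalIntegral.integral_comp_mul_left (fun x => Real.exp x) hlam0.ne', integral_exp]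
        simp only [mul_zero, Real.exp_zero, smul_eq_mul]
        have h2 : Fintype.card ι * c * lam⁻¹ ≤ 1 / 2 := by
          rw [← div_eq_mul_inv, div_le_iff₀ hlam0, hlam]; linarith
        calc _ = (Fintype.card ι * c * lam⁻¹) * (b * (Real.exp (lam * t) - 1)) := by ring
          _ ≤ 1 / 2 * (b * (Real.exp (lam * t) - 1)) := by
            gcongr
          _ ≤ _ := by nlinarith
      have h3 := h t ht k
      rw [Real.norm_eq_abs] at hint
      have h4 : |e t k| ≤ a + b / 2 * Real.exp (lam * t) := by
        calc |e t k| = |(e t k + ∫ s in (0 : ℝ)..t, ∑ i, A k i * e s i) -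
              ∫ s in (0 : ℝ)..t, ∑ i, A k i * e s i| := by rw [add_sub_cancel_right]
          _ ≤ _ := (abs_sub _ _).trans (add_le_add h3 (hint.trans hcomp))
      calc |e t k| ≤ a + b / 2 * Real.exp (lam * t) := h4
        _ ≤ a * Real.exp (lam * t) + b / 2 * Real.exp (lam * t) := by
          gcongr; nlinarith
        _ = _ := by rw [hb]; ring
  intro t ht k
  have hlim : Tendsto (fun n : ℕ => (2 * a + B / 2 ^ n) * Real.exp (lam * t)) atTop
      (𝓝 ((2 * a + 0) * Real.exp (lam * t))) := by
    refine Tendsto.mul_const _ (tendsto_const_nhds.add ?_)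
    exact tendsto_const_nhds.div_atTop (tendsto_pow_atTop_atTop_of_one_lt (by norm_num))
  rw [add_zero] at hlim
  exact ge_of_tendsto hlim (Eventually.of_forall fun n => key n t ht k)

theorem intervalIntegrable_comp_floor (u : ℕ → ℝ) (N : ℕ) (a b : ℝ) :
    IntervalIntegrable (fun s => u ⌊(N : ℝ) * s⌋₊) volume a b := by
  have hm : Measurable fun s : ℝ => u ⌊(N : ℝ) * s⌋₊ :=
    (measurable_from_nat (f := u)).comp (Nat.measurable_floor.comp (measurable_const_mul _))
  refine (intervalIntegrable_const (c := ∑ j ∈ Finset.range (⌊(N : ℝ) * max a b⌋₊ + 1), |u j|)).mono_fun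
    hm.aestronglyMeasurable ?_
  refine (ae_restrict_mem measurableSet_uIoc).mono fun s hs => ?_
  have h1 : s ≤ max a b := (uIoc_subset_uIcc hs).2
  have h2 : ⌊(N : ℝ) * s⌋₊ ∈ Finset.range (⌊(N : ℝ) * max a b⌋₊ + 1) := by
    rw [Finset.mem_range, Nat.lt_succ_iff]
    exact Nat.floor_le_floor (by gcongr)
  have h3 := Finset.single_le_sum (f := fun j => |u j|) (fun j _ => abs_nonneg _) h2
  simp only [Real.norm_eq_abs] at h3 ⊢
  exact h3.trans (le_abs_self _)

theorem integral_comp_floor_natCast_div (u : ℕ → ℝ) {N : ℕ} (hN : 0 < N) (k : ℕ) :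
    ∫ s in (0 : ℝ)..(k / N : ℝ), u ⌊(N : ℝ) * s⌋₊ = (N : ℝ)⁻¹ * ∑ j ∈ Finset.range k, u j := by
  have hN' : (0 : ℝ) < N := by exact_mod_cast hN
  have h := intervalIntegral.sum_integral_adjacent_intervals (μ := volume)
    (f := fun s => u ⌊(N : ℝ) * s⌋₊) (a := fun j : ℕ => (j / N : ℝ)) (n := k)
    (fun j _ => intervalIntegrable_comp_floor u N _ _)
  simp only [Nat.cast_zero, zero_div] at h
  rw [← h, Finset.mul_sum]
  refine Finset.sum_congr rfl fun j _ => ?_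
  have h1 : ∫ s in (j / N : ℝ)..((j + 1 : ℕ) / N : ℝ), u ⌊(N : ℝ) * s⌋₊ =
      ∫ _s in (j / N : ℝ)..((j + 1 : ℕ) / N : ℝ), u j := by
    -- The cells are closed on the left and open on the right, since at the right endpoint the floor
    -- has already jumped.
    rw [intervalIntegral.integral_of_le (by gcongr; simp),
      intervalIntegral.integral_of_le (by gcongr; simp), ← integral_Ico_eq_integral_Ioc,
      ← integral_Ico_eq_integral_Ioc]
    refine setIntegral_congr_fun measurableSet_Ico fun s hs => ?_
    have : ⌊(N : ℝ) * s⌋₊ = j := by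
      rw [Nat.floor_eq_iff]
      · have h1 := hs.1
        have h2 := hs.2
        rw [div_le_iff₀ hN'] at h1
        rw [lt_div_iff₀ hN'] at h2
        push_cast at h2
        constructor <;> linarith
      · exact mul_nonneg hN'.le ((by positivity : (0 : ℝ) ≤ j / N).trans hs.1)
    simp only [this]
  rw [h1, intervalIntegral.integral_const, smul_eq_mul]
  push_cast
  field_simp
  ring

/-- The Riemann sum is the exact integral up to `⌊N t⌋ / N`; only the last, incomplete cell of
length at most `1 / N` is left. -/
theorem abs_integral_comp_floor_sub_sum_le (u : ℕ → ℝ) {N : ℕ} (hN : 0 < N) {t B : ℝ} (ht : 0 ≤ t)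
    (hB : |u ⌊(N : ℝ) * t⌋₊| ≤ B) :
    |(∫ s in (0 : ℝ)..t, u ⌊(N : ℝ) * s⌋₊) -
      (N : ℝ)⁻¹ * ∑ j ∈ Finset.range ⌊(N : ℝ) * t⌋₊, u j| ≤ B / N := by
  have hN' : (0 : ℝ) < N := by exact_mod_cast hN
  set k := ⌊(N : ℝ) * t⌋₊ with hk
  have hk1 : (k : ℝ) ≤ N * t := Nat.floor_le (by positivity)
  have hk2 : N * t < (k : ℝ) + 1 := Nat.lt_floor_add_one _
  rw [← integral_comp_floor_natCast_div u hN,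
    intervalIntegral.integral_interval_sub_left (intervalIntegrable_comp_floor u N _ _)
      (intervalIntegrable_comp_floor u N _ _), ← Real.norm_eq_abs]
  have hkt : (k : ℝ) / N ≤ t := by rw [div_le_iff₀ hN']; linarith
  have h := intervalIntegral.norm_integral_le_of_norm_le_const (a := (k / N : ℝ)) (b := t) (C := B)
    (f := fun s => u ⌊(N : ℝ) * s⌋₊) (fun s hs => by
      rw [uIoc_of_le hkt] at hs
      have : ⌊(N : ℝ) * s⌋₊ = k := by
        apply le_antisymm
        · exact Nat.floor_le_floor (by gcongr; exact hs.2)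
        · apply Nat.le_floor
          have := hs.1
          rw [div_lt_iff₀ hN'] at this
          linarith
      rw [this]; exact hB)
  refine h.trans ?_
  have hB0 : 0 ≤ B := (abs_nonneg _).trans hB
  rw [abs_of_nonneg (by linarith), div_eq_mul_inv B]
  gcongr
  rw [sub_le_iff_le_add, ← one_div, ← add_div, le_div_iff₀ hN']
  linarith

/-- Summation by parts, as an estimate. -/
theorem abs_sum_mul_le_of_partial_sums {a x : ℕ → ℝ} {k : ℕ} {A Δ s : ℝ}
    (ha : |a k| ≤ A) (hΔ : ∀ j < k, |a (j + 1) - a j| ≤ Δ)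
    (hx : ∀ n ≤ k, |∑ j ∈ Finset.range n, x j| ≤ s) :
    |∑ j ∈ Finset.range k, a j * x j| ≤ (A + k * Δ) * s := by
  have hid : ∀ n, ∑ j ∈ Finset.range n, a j * x j = a n * ∑ j ∈ Finset.range n, x j -
      ∑ j ∈ Finset.range n, (a (j + 1) - a j) * ∑ i ∈ Finset.range (j + 1), x i := by
    intro n
    induction n with
    | zero => simp
    | succ n ih =>
      rw [Finset.sum_range_succ, ih, Finset.sum_range_succ (fun j => (a (j + 1) - a j) * _),
        Finset.sum_range_succ x]
      ring
  rw [hid k, add_mul]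
  refine (abs_sub _ _).trans (add_le_add ?_ ?_)
  · rw [abs_mul]
    exact mul_le_mul ha (hx k le_rfl) (abs_nonneg _) ((abs_nonneg _).trans ha)
  · refine (Finset.abs_sum_le_sum_abs _ _).trans ?_
    calc _ ≤ ∑ _j ∈ Finset.range k, Δ * s := by
          refine Finset.sum_le_sum fun j hj => ?_
          rw [Finset.mem_range] at hj
          rw [abs_mul]
          exact mul_le_mul (hΔ j hj) (hx _ hj) (abs_nonneg _) ((abs_nonneg _).trans (hΔ j hj))
      _ = _ := by simp; ring

/-! ### Bounds, Lipschitz and Taylor estimates on balls -/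

section Calculus

variable {E : Type*} [NormedAddCommGroup E] [ProperSpace E]

theorem exists_abs_le_closedBall {f : E → ℝ} (hf : Continuous f) (R : ℝ) :
    ∃ C, 0 ≤ C ∧ ∀ θ, ‖θ‖ ≤ R → |f θ| ≤ C := by
  obtain ⟨C, hC⟩ := (isCompact_closedBall (0 : E) R).exists_bound_of_continuousOn hf.continuousOn
  refine ⟨max C 0, le_max_right _ _, fun θ hθ => ?_⟩
  exact (hC θ (by simpa using hθ)).trans (le_max_left _ _)

theorem exists_norm_le_closedBall {F : Type*} [NormedAddCommGroup F] {f : E → F}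
    (hf : Continuous f) (R : ℝ) : ∃ C, 0 ≤ C ∧ ∀ θ, ‖θ‖ ≤ R → ‖f θ‖ ≤ C := by
  obtain ⟨C, hC⟩ := (isCompact_closedBall (0 : E) R).exists_bound_of_continuousOn hf.continuousOn
  refine ⟨max C 0, le_max_right _ _, fun θ hθ => ?_⟩
  exact (hC θ (by simpa using hθ)).trans (le_max_left _ _)

variable [NormedSpace ℝ E]

theorem exists_lipschitz_closedBall {F : Type*} [NormedAddCommGroup F] [NormedSpace ℝ F]
    {f : E → F} (hf : ContDiff ℝ 1 f) (R : ℝ) :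
    ∃ C, 0 ≤ C ∧ ∀ θ θ', ‖θ‖ ≤ R → ‖θ'‖ ≤ R → ‖f θ' - f θ‖ ≤ C * ‖θ' - θ‖ := by
  obtain ⟨C, hC0, hC⟩ := exists_norm_le_closedBall (hf.continuous_fderiv one_ne_zero) R
  refine ⟨C, hC0, fun θ θ' h h' => ?_⟩
  exact (convex_closedBall (0 : E) R).norm_image_sub_le_of_norm_fderiv_le (𝕜 := ℝ)
    (fun z _ => (hf.differentiable one_ne_zero) z) (fun z hz => hC z (by simpa using hz))
    (by simpa using h) (by simpa using h')

/-- Mean value inequality on the segment for `f - fderiv ℝ f θ`, whose derivative is controlled by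
the Lipschitz constant of `fderiv ℝ f` times `‖θ' - θ‖`. -/
theorem exists_taylor_closedBall {f : E → ℝ} (hf : ContDiff ℝ 2 f) (R : ℝ) :
    ∃ C, 0 ≤ C ∧ ∀ θ θ', ‖θ‖ ≤ R → ‖θ'‖ ≤ R →
      |f θ' - f θ - fderiv ℝ f θ (θ' - θ)| ≤ C * ‖θ' - θ‖ ^ 2 := by
  have hf1 : ContDiff ℝ 1 (fderiv ℝ f) := hf.fderiv_right (by norm_num)
  obtain ⟨C, hC0, hC⟩ := exists_lipschitz_closedBall hf1 R
  refine ⟨C, hC0, fun θ θ' h h' => ?_⟩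
  have hsub : segment ℝ θ θ' ⊆ Metric.closedBall 0 R :=
    (convex_closedBall (0 : E) R).segment_subset (by simpa using h) (by simpa using h')
  have := (convex_segment θ θ').norm_image_sub_le_of_norm_fderiv_le' (𝕜 := ℝ)
    (f := f) (φ := fderiv ℝ f θ) (C := C * ‖θ' - θ‖)
    (fun z _ => (hf.differentiable (by norm_num)) z) (fun z hz => by
      refine (hC θ z h (by simpa using hsub hz)).trans ?_
      gcongr
      obtain ⟨a, b, ha, hb, hab, rfl⟩ := hz
      have : a • θ + b • θ' - θ = b • (θ' - θ) := by
        have : a = 1 - b := by linarith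
        rw [this, smul_sub, sub_smul, one_smul]; abel
      rw [this, norm_smul, Real.norm_eq_abs, abs_of_nonneg hb]
      have : b ≤ 1 := by linarith
      exact mul_le_of_le_one_left (norm_nonneg _) this)
    (left_mem_segment ℝ θ θ') (right_mem_segment ℝ θ θ')
  rw [Real.norm_eq_abs] at this
  rw [sq, ← mul_assoc]
  exact this

end Calculus

/-! ### Stochastic gradient descent as an interacting particle system -/

/-- The mean over `N` particles. -/
noncomputable def particleMean {E : Type*} {N : ℕ} (θ : Fin N → E) (f : E → ℝ) : ℝ :=
  (N : ℝ)⁻¹ * ∑ n, f (θ n)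

section ParticleMean

variable {E : Type*} {N : ℕ}

theorem abs_particleMean_le {θ : Fin N → E} {f : E → ℝ} {B : ℝ} (hB : 0 ≤ B)
    (h : ∀ n, |f (θ n)| ≤ B) : |particleMean θ f| ≤ B := by
  rcases Nat.eq_zero_or_pos N with rfl | hN
  · simpa [particleMean] using hB
  have hN' : (0 : ℝ) < N := by exact_mod_cast hN
  rw [particleMean, abs_mul, abs_of_pos (inv_pos.2 hN'), inv_mul_le_iff₀ hN']
  refine (Finset.abs_sum_le_sum_abs _ _).trans ?_
  calc _ ≤ ∑ _n : Fin N, B := Finset.sum_le_sum fun n _ => h n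
    _ = _ := by simp

theorem abs_particleMean_sub_le {θ θ' : Fin N → E} {f : E → ℝ} {B : ℝ} (hB : 0 ≤ B)
    (h : ∀ n, |f (θ' n) - f (θ n)| ≤ B) : |particleMean θ' f - particleMean θ f| ≤ B := by
  have : particleMean θ' f - particleMean θ f =
      particleMean (fun n => (θ n, θ' n)) (fun p => f p.2 - f p.1) := by
    simp only [particleMean, Finset.sum_sub_distrib, mul_sub]
  rw [this]
  exact abs_particleMean_le hB h

end ParticleMean

/-- The data of an interacting particle system: targets `y`, vector fields `v` along which the
particles move, their mean-field coefficients `D`, and the observables `F` whose rescaled means are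
fitted to the targets. -/
structure ParticleSystem (E ι α : Type*) where
  y : ι → ℝ
  v : ι → α → E → E
  D : ι → α → E → ℝ
  F : ι → E → ℝ

namespace ParticleSystem

variable {E ι α : Type*} [NormedAddCommGroup E] [NormedSpace ℝ E] [Fintype ι] [Fintype α]

/-- The derivative of `f` along a vector field of the system. -/
noncomputable def lie (S : ParticleSystem E ι α) (i : ι) (a : α) (f : E → ℝ) (θ : E) : ℝ :=
  fderiv ℝ f θ (S.v i a θ)

/-- The rate of change of `ν f` caused by the datum `i`, with coefficients averaged under `μ`. -/
noncomputable def mix (S : ParticleSystem E ι α) (μ ν : (E → ℝ) → ℝ) (f : E → ℝ) (i : ι) : ℝ :=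
  ∑ a, μ (S.D i a) * ν (S.lie i a f)

/-- The rescaled means of the observables. -/
noncomputable def out (S : ParticleSystem E ι α) (ε : ℝ) {N : ℕ} (θ : Fin N → E) (i : ι) : ℝ :=
  ε⁻¹ * particleMean θ (S.F i)

/-- The direction of motion of the `n`-th particle, for the weights `ξ` of the data. -/
noncomputable def incr (S : ParticleSystem E ι α) (ε : ℝ) (ξ : ι → ℝ) {N : ℕ} (θ : Fin N → E)
    (n : Fin N) : E :=
  ∑ i, (ξ i * (S.y i - S.out ε θ i)) • ∑ a, particleMean θ (S.D i a) • S.v i a (θ n)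

/-- A family of trajectories, one for each number `N` of particles, with step size `ε N / N`, and
whose initial particles and data weights average out at rate `δ N`. -/
structure IsTraining (S : ParticleSystem E ι α) (T wt : ℝ) (ε δ : ℕ → ℝ) (𝒞 : Set (E → ℝ))
    (m : (E → ℝ) → ℝ) (ξ : ℕ → ι → ℝ) (θ : (N : ℕ) → ℕ → Fin N → E) : Prop where
  T_pos : 0 < T
  step : ∀ N k n, θ N (k + 1) n = θ N k n + (ε N / N) • S.incr (ε N) (ξ k) (θ N k) n
  eps_pos : ∀ᶠ N in atTop, 0 < ε N
  eps_tendsto : Tendsto ε atTop (𝓝 0)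
  delta_tendsto : Tendsto (fun N => δ N / ε N) atTop (𝓝 0)
  inv_le_delta : ∀ᶠ N : ℕ in atTop, (N : ℝ)⁻¹ ≤ δ N
  weight_mem : ∀ k i, ξ k i ∈ Icc (0 : ℝ) 1
  weight_sum : ∃ C, ∀ᶠ N : ℕ in atTop, ∀ k : ℕ, (k : ℝ) ≤ N * T → ∀ i,
    |∑ j ∈ Finset.range k, (ξ j i - wt)| ≤ C * (N * δ N)
  smooth : ∀ f ∈ 𝒞, ContDiff ℝ 2 f
  continuous_v : ∀ i a, Continuous (S.v i a)
  lie_mem : ∀ f ∈ 𝒞, ∀ i a, S.lie i a f ∈ 𝒞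
  D_mem : ∀ i a, S.D i a ∈ 𝒞
  F_mem : ∀ i, S.F i ∈ 𝒞
  init : ∀ f ∈ 𝒞, (fun N => particleMean (θ N 0) f - m f) =O[atTop] δ
  mean_F : ∀ i, m (S.F i) = 0
  bounded : ∃ R, ∀ N n, ‖θ N 0 n‖ ≤ R

variable {S : ParticleSystem E ι α} {T wt : ℝ} {ε δ : ℕ → ℝ} {𝒞 : Set (E → ℝ)}
  {m : (E → ℝ) → ℝ} {ξ : ℕ → ι → ℝ} {θ : (N : ℕ) → ℕ → Fin N → E}

theorem norm_incr_le {ε : ℝ} {ξ : ι → ℝ} {N : ℕ} {θ : Fin N → E} {n : Fin N} {X Dm V : ℝ}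
    (hX : 0 ≤ X) (hDm : 0 ≤ Dm) (hξ : ∀ i, ξ i ∈ Icc (0 : ℝ) 1)
    (hr : ∀ i, |S.y i - S.out ε θ i| ≤ X) (hD : ∀ i a n, |S.D i a (θ n)| ≤ Dm)
    (hV : ∀ i a n, ‖S.v i a (θ n)‖ ≤ V) :
    ‖S.incr ε ξ θ n‖ ≤ (Fintype.card ι * Fintype.card α * Dm * V) * X := by
  rw [incr]
  calc _ ≤ ∑ _i : ι, (1 * X) * ∑ _a : α, Dm * V := by
        refine norm_sum_le_of_le _ fun i _ => ?_
        rw [norm_smul, Real.norm_eq_abs, abs_mul]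
        have h1 : |ξ i| ≤ 1 := by rw [abs_of_nonneg (hξ i).1]; exact (hξ i).2
        refine mul_le_mul (mul_le_mul h1 (hr i) (abs_nonneg _) zero_le_one) ?_ (norm_nonneg _)
          (by positivity)
        refine norm_sum_le_of_le _ fun a _ => ?_
        rw [norm_smul, Real.norm_eq_abs]
        exact mul_le_mul (abs_particleMean_le hDm (hD i a)) (hV i a n) (norm_nonneg _) hDm
    _ = _ := by simp; ring

/-- To first order a step changes a mean by products of empirical means only. On a class of
functions stable under `lie` and containing all `D` and `F`, the means thus form a closed system. -/
theorem fderiv_incr_mean (f : E → ℝ) (ε : ℝ) (ξ : ι → ℝ) {N : ℕ} (θ : Fin N → E) :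
    (N : ℝ)⁻¹ * ∑ n, fderiv ℝ f (θ n) (S.incr ε ξ θ n) =
      ∑ i, ξ i * ((S.y i - S.out ε θ i) * S.mix (particleMean θ) (particleMean θ) f i) := by
  have h : ∀ i a, particleMean θ (S.lie i a f) =
      (N : ℝ)⁻¹ * ∑ n, fderiv ℝ f (θ n) (S.v i a (θ n)) := fun _ _ => rfl
  simp only [incr, map_sum, map_smul, smul_eq_mul, mix, h, Finset.mul_sum]
  rw [Finset.sum_comm]
  refine Finset.sum_congr rfl fun i _ => ?_
  rw [Finset.sum_comm]
  refine Finset.sum_congr rfl fun a _ => Finset.sum_congr rfl fun n _ => ?_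
  ring

namespace IsTraining

theorem eventually_eps_le_one (h : S.IsTraining T wt ε δ 𝒞 m ξ θ) : ∀ᶠ N in atTop, ε N ≤ 1 :=
  (h.eps_tendsto.eventually (gt_mem_nhds zero_lt_one)).mono fun _ h => h.le

theorem delta_pos (h : S.IsTraining T wt ε δ 𝒞 m ξ θ) : ∀ᶠ N in atTop, 0 < δ N := by
  filter_upwards [h.inv_le_delta, eventually_gt_atTop 0] with N h1 h2
  exact lt_of_lt_of_le (by positivity) h1

/-- Because `m (F i) = 0`, the initial mean of `F i` is `O(δ)`; a nonzero limit would be blown up by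
the factor `ε⁻¹`. -/
theorem tendsto_out_zero (h : S.IsTraining T wt ε δ 𝒞 m ξ θ) (i : ι) :
    Tendsto (fun N => S.out (ε N) (θ N 0) i) atTop (𝓝 0) := by
  have h1 := h.init _ (h.F_mem i)
  simp only [h.mean_F, sub_zero] at h1
  have h2 : (fun N => S.out (ε N) (θ N 0) i) =O[atTop] fun N => δ N / ε N := by
    simp only [out, div_eq_inv_mul]
    exact (Asymptotics.isBigO_refl _ _).mul h1
  exact h2.trans_tendsto h.delta_tendsto

variable [ProperSpace E]

/-- The particles stay close to their initial positions, and the observables stay bounded. -/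
theorem exists_bound (h : S.IsTraining T wt ε δ 𝒞 m ξ θ) :
    ∃ R C, 0 ≤ C ∧ ∀ᶠ N : ℕ in atTop, ∀ k : ℕ, (k : ℝ) ≤ N * T →
      (∀ i, |S.out (ε N) (θ N k) i| ≤ C) ∧ ∀ n, ‖θ N k n‖ ≤ R ∧
        ‖S.incr (ε N) (ξ k) (θ N k) n‖ ≤ C ∧ ‖θ N k n - θ N 0 n‖ ≤ C * ε N := by
  obtain ⟨R, hR⟩ := h.bounded
  choose V hV0 hV using fun q : ι × α => exists_norm_le_closedBall (h.continuous_v q.1 q.2) (R + 1)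
  choose Dm hD0 hD using fun q : ι × α =>
    exists_abs_le_closedBall (h.smooth _ (h.D_mem q.1 q.2)).continuous (R + 1)
  choose Lf hL0 hL using fun i : ι =>
    exists_lipschitz_closedBall ((h.smooth _ (h.F_mem i)).of_le (by norm_num)) (R + 1)
  set Vm := ∑ q, V q
  set Dmm := ∑ q, Dm q
  set Lm := ∑ i, Lf i
  set Y := ∑ i, |S.y i|
  have hVm : ∀ i a x, ‖x‖ ≤ R + 1 → ‖S.v i a x‖ ≤ Vm := fun i a x hx =>
    (hV (i, a) x hx).trans (Finset.single_le_sum (f := V) (fun q _ => hV0 q) (Finset.mem_univ (i, a)))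
  have hDm : ∀ i a x, ‖x‖ ≤ R + 1 → |S.D i a x| ≤ Dmm := fun i a x hx =>
    (hD (i, a) x hx).trans (Finset.single_le_sum (f := Dm) (fun q _ => hD0 q) (Finset.mem_univ (i, a)))
  have hLm : ∀ i, Lf i ≤ Lm := fun i =>
    Finset.single_le_sum (f := Lf) (fun q _ => hL0 q) (Finset.mem_univ i)
  have hY : ∀ i, |S.y i| ≤ Y := fun i =>
    Finset.single_le_sum (f := fun i => |S.y i|) (fun q _ => abs_nonneg _) (Finset.mem_univ i)
  have hVm0 : 0 ≤ Vm := Finset.sum_nonneg fun q _ => hV0 q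
  have hDm0 : 0 ≤ Dmm := Finset.sum_nonneg fun q _ => hD0 q
  have hLm0 : 0 ≤ Lm := Finset.sum_nonneg fun q _ => hL0 q
  have hY0 : 0 ≤ Y := Finset.sum_nonneg fun q _ => abs_nonneg _
  -- `b` bounds the speed of a particle per unit of residual, and `c` is the resulting growth rate
  -- of the outputs: the `ε / N` of a step cancels the `ε⁻¹` in `out`. All constants are taken on
  -- the ball of radius `R + 1`, one unit beyond the initial particles.
  set b : ℝ := Fintype.card ι * Fintype.card α * Dmm * Vm
  have hb0 : 0 ≤ b := by positivity
  set c := Lm * b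
  have hc0 : 0 ≤ c := by positivity
  set X := (Y + 1) * Real.exp (c * T)
  have hX0 : 0 ≤ X := by positivity
  have hT := h.T_pos
  refine ⟨R + 1, X + b * X + T * (b * X), by positivity, ?_⟩
  -- The left side is the total displacement over `N T` steps; for large `N` the particles cannot
  -- leave the enlarged ball.
  have ev1 : ∀ᶠ N in atTop, T * (b * X) * ε N ≤ 1 := by
    have : Tendsto (fun N => T * (b * X) * ε N) atTop (𝓝 (T * (b * X) * 0)) :=
      h.eps_tendsto.const_mul _
    rw [mul_zero] at this
    exact (this.eventually (gt_mem_nhds zero_lt_one)).mono fun _ h => h.le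
  have ev2 : ∀ᶠ N in atTop, ∀ i, |S.out (ε N) (θ N 0) i| ≤ 1 := by
    rw [eventually_all]
    intro i
    have := (h.tendsto_out_zero i).abs
    rw [abs_zero] at this
    exact (this.eventually (gt_mem_nhds zero_lt_one)).mono fun _ h => h.le
  filter_upwards [ev1, ev2, h.eps_pos, eventually_gt_atTop 0] with N h1 h2 hε hN
  have hN' : (0 : ℝ) < N := by exact_mod_cast hN
  have hexp : ∀ k : ℕ, (k : ℝ) ≤ N * T → (Y + 1) * Real.exp (c * (k / N)) ≤ X := by
    intro k hk
    refine mul_le_mul_of_nonneg_left (Real.exp_le_exp.2 ?_) (by positivity)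
    refine mul_le_mul_of_nonneg_left ?_ hc0
    rw [div_le_iff₀ hN']; linarith
  have hdisp : ∀ k : ℕ, (k : ℝ) ≤ N * T → k * (ε N / N * (b * X)) ≤ T * (b * X) * ε N := by
    intro k hk
    have : (k : ℝ) / N ≤ T := by rw [div_le_iff₀ hN']; linarith
    calc k * (ε N / N * (b * X)) = (k / N) * ((b * X) * ε N) := by field_simp
      _ ≤ T * ((b * X) * ε N) := by gcongr
      _ = _ := by ring
  have hinc : ∀ k : ℕ, (k : ℝ) ≤ N * T → (∀ i, Y + |S.out (ε N) (θ N k) i| ≤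
      (Y + 1) * Real.exp (c * (k / N))) → (∀ n, ‖θ N k n‖ ≤ R + 1) →
      ∀ n, ‖S.incr (ε N) (ξ k) (θ N k) n‖ ≤ b * ((Y + 1) * Real.exp (c * (k / N))) := by
    intro k hk ho hθ n
    refine norm_incr_le (by positivity) hDm0 (h.weight_mem k) (fun i => ?_)
      (fun i a n => hDm i a _ (hθ n)) (fun i a n => hVm i a _ (hθ n))
    exact (abs_sub _ _).trans (le_trans (by gcongr; exact hY i) (ho i))
  -- A discrete Gronwall argument. Both claims share one induction: the growth bound for the outputs
  -- requires particles in the ball, and the displacement bound requires controlled outputs.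
  have main : ∀ k : ℕ, (k : ℝ) ≤ N * T →
      (∀ i, Y + |S.out (ε N) (θ N k) i| ≤ (Y + 1) * Real.exp (c * (k / N))) ∧
      ∀ n, ‖θ N k n - θ N 0 n‖ ≤ k * (ε N / N * (b * X)) := by
    intro k
    induction k with
    | zero =>
      intro _
      refine ⟨fun i => ?_, fun n => by simp⟩
      simpa using h2 i
    | succ k ih =>
      intro hk
      have hk' : (k : ℝ) ≤ N * T := by push_cast at hk; linarith
      obtain ⟨ho, hd⟩ := ih hk'
      have hnorm : ∀ k : ℕ, (k : ℝ) ≤ N * T →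
          (∀ n, ‖θ N k n - θ N 0 n‖ ≤ k * (ε N / N * (b * X))) → ∀ n, ‖θ N k n‖ ≤ R + 1 := by
        intro k hk hd n
        calc ‖θ N k n‖ = ‖θ N 0 n + (θ N k n - θ N 0 n)‖ := by rw [add_sub_cancel]
          _ ≤ R + 1 := (norm_add_le _ _).trans
            (add_le_add (hR N n) (((hd n).trans (hdisp k hk)).trans h1))
      have hi := hinc k hk' ho (hnorm k hk' hd)
      have hstep : ∀ n, ‖θ N (k + 1) n - θ N k n‖ ≤
          ε N / N * (b * ((Y + 1) * Real.exp (c * (k / N)))) := by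
        intro n
        rw [h.step, add_sub_cancel_left, norm_smul, Real.norm_eq_abs,
          abs_of_nonneg (by positivity)]
        gcongr
        exact hi n
      have hd' : ∀ n, ‖θ N (k + 1) n - θ N 0 n‖ ≤ (k + 1 : ℕ) * (ε N / N * (b * X)) := by
        intro n
        calc _ = ‖(θ N (k + 1) n - θ N k n) + (θ N k n - θ N 0 n)‖ := by congr 1; abel
          _ ≤ ε N / N * (b * X) + k * (ε N / N * (b * X)) := by
            refine (norm_add_le _ _).trans (add_le_add ((hstep n).trans ?_) (hd n))
            gcongr
            exact hexp k hk'
          _ = _ := by push_cast; ring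
      refine ⟨fun i => ?_, hd'⟩
      have hout : |S.out (ε N) (θ N (k + 1)) i - S.out (ε N) (θ N k) i| ≤
          c / N * ((Y + 1) * Real.exp (c * (k / N))) := by
        rw [out, out, ← mul_sub, abs_mul, abs_of_pos (inv_pos.2 hε)]
        have := abs_particleMean_sub_le (θ := θ N k) (θ' := θ N (k + 1)) (f := S.F i)
          (B := Lm * (ε N / N * (b * ((Y + 1) * Real.exp (c * (k / N)))))) (by positivity)
          (fun n => by
            refine (hL i _ _ (hnorm k hk' hd n) (hnorm (k + 1) hk hd' n)).trans ?_
            exact mul_le_mul (hLm i) (hstep n) (norm_nonneg _) hLm0)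
        calc _ ≤ (ε N)⁻¹ * (Lm * (ε N / N * (b * ((Y + 1) * Real.exp (c * (k / N)))))) := by
              gcongr
          _ = _ := by
            simp only [c]; field_simp
      calc Y + |S.out (ε N) (θ N (k + 1)) i|
          = Y + |S.out (ε N) (θ N k) i + (S.out (ε N) (θ N (k + 1)) i - S.out (ε N) (θ N k) i)| := by
            rw [add_sub_cancel]
        _ ≤ (Y + |S.out (ε N) (θ N k) i|) + c / N * ((Y + 1) * Real.exp (c * (k / N))) := by
            rw [add_assoc]; gcongr; exact (abs_add_le _ _).trans (by gcongr)
        _ ≤ (Y + 1) * Real.exp (c * (k / N)) + c / N * ((Y + 1) * Real.exp (c * (k / N))) := by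
            gcongr; exact ho i
        _ = (Y + 1) * (Real.exp (c * (k / N)) * (c / N + 1)) := by ring
        _ ≤ (Y + 1) * (Real.exp (c * (k / N)) * Real.exp (c / N)) := by
            gcongr; exact Real.add_one_le_exp _
        _ = _ := by rw [← Real.exp_add]; push_cast; congr 2; ring
  intro k hk
  obtain ⟨ho, hd⟩ := main k hk
  have hθ : ∀ n, ‖θ N k n‖ ≤ R + 1 := by
    intro n
    calc ‖θ N k n‖ = ‖θ N 0 n + (θ N k n - θ N 0 n)‖ := by rw [add_sub_cancel]
      _ ≤ R + 1 := (norm_add_le _ _).trans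
        (add_le_add (hR N n) (((hd n).trans (hdisp k hk)).trans h1))
  have hbX : 0 ≤ b * X := by positivity
  have hTbX : 0 ≤ T * (b * X) := by positivity
  refine ⟨fun i => ?_, fun n => ⟨hθ n, ?_, ?_⟩⟩
  · have := (ho i).trans (hexp k hk); linarith
  · have := (hinc k hk ho hθ n).trans (mul_le_mul_of_nonneg_left (hexp k hk) hb0); linarith
  · refine ((hd n).trans (hdisp k hk)).trans ?_
    gcongr
    linarith

end IsTraining

end ParticleSystem

/-- A family of sequences that, for large `N`, are bounded with increments `O(1 / N)` up to the
index `N T`. -/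
def SlowlyVarying (T : ℝ) (u : ℕ → ℕ → ℝ) : Prop :=
  ∃ B, 0 ≤ B ∧ ∀ᶠ N : ℕ in atTop, (∀ k : ℕ, (k : ℝ) ≤ N * T → |u N k| ≤ B) ∧
    ∀ k : ℕ, ((k + 1 : ℕ) : ℝ) ≤ N * T → |u N (k + 1) - u N k| ≤ B / N

namespace SlowlyVarying

variable {T : ℝ} {u w : ℕ → ℕ → ℝ}

theorem mul (hu : SlowlyVarying T u) (hw : SlowlyVarying T w) :
    SlowlyVarying T fun N k => u N k * w N k := by
  obtain ⟨B, hB, h⟩ := hu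
  obtain ⟨B', hB', h'⟩ := hw
  refine ⟨2 * (B * B'), by positivity, ?_⟩
  filter_upwards [h, h'] with N h h'
  refine ⟨fun k hk => ?_, fun k hk => ?_⟩
  · rw [abs_mul]
    calc _ ≤ B * B' := mul_le_mul (h.1 k hk) (h'.1 k hk) (abs_nonneg _) hB
      _ ≤ _ := by nlinarith [mul_nonneg hB hB']
  · have hk' : (k : ℝ) ≤ N * T := by push_cast at hk; linarith
    calc _ = |(u N (k + 1) - u N k) * w N (k + 1) + u N k * (w N (k + 1) - w N k)| := by
          congr 1; ring
      _ ≤ B / N * B' + B * (B' / N) := by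
          refine (abs_add_le _ _).trans (add_le_add ?_ ?_)
          · rw [abs_mul]
            exact mul_le_mul (h.2 k hk) (h'.1 _ hk) (abs_nonneg _) (by positivity)
          · rw [abs_mul]
            exact mul_le_mul (h.1 k hk') (h'.2 _ hk) (abs_nonneg _) (by positivity)
      _ = _ := by ring

theorem const_sub (c : ℝ) (hu : SlowlyVarying T u) : SlowlyVarying T fun N k => c - u N k := by
  obtain ⟨B, hB, h⟩ := hu
  refine ⟨|c| + B, by positivity, ?_⟩
  filter_upwards [h] with N h
  refine ⟨fun k hk => (abs_sub _ _).trans (by gcongr; exact h.1 k hk), fun k hk => ?_⟩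
  rw [sub_sub_sub_cancel_left, abs_sub_comm]
  refine (h.2 k hk).trans ?_
  gcongr
  linarith [abs_nonneg c]

theorem sum {κ : Type*} {s : Finset κ} {u : κ → ℕ → ℕ → ℝ} (hu : ∀ i, SlowlyVarying T (u i)) :
    SlowlyVarying T fun N k => ∑ i ∈ s, u i N k := by
  choose B hB h using hu
  refine ⟨∑ i ∈ s, B i, Finset.sum_nonneg fun i _ => hB i, ?_⟩
  filter_upwards [(s.eventually_all (l := atTop)).2 fun i _ => h i] with N h
  refine ⟨fun k hk => ?_, fun k hk => ?_⟩
  · exact (Finset.abs_sum_le_sum_abs _ _).trans (Finset.sum_le_sum fun i hi => (h i hi).1 k hk)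
  · rw [← Finset.sum_sub_distrib, Finset.sum_div]
    exact (Finset.abs_sum_le_sum_abs _ _).trans (Finset.sum_le_sum fun i hi => (h i hi).2 k hk)

end SlowlyVarying

/-! ### Slow variation of the trajectories and averaging of the sample noise -/

namespace ParticleSystem.IsTraining

variable {E ι α : Type*} [NormedAddCommGroup E] [NormedSpace ℝ E] [Fintype ι] [Fintype α]
  {S : ParticleSystem E ι α} {T wt : ℝ} {ε δ : ℕ → ℝ} {𝒞 : Set (E → ℝ)}
  {m : (E → ℝ) → ℝ} {ξ : ℕ → ι → ℝ} {θ : (N : ℕ) → ℕ → Fin N → E} [ProperSpace E]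

theorem exists_particleMean_bound (h : S.IsTraining T wt ε δ 𝒞 m ξ θ) {f : E → ℝ} (hf : f ∈ 𝒞) :
    ∃ B, 0 ≤ B ∧ ∀ᶠ N : ℕ in atTop, (∀ k : ℕ, (k : ℝ) ≤ N * T →
      |particleMean (θ N k) f| ≤ B ∧
      |particleMean (θ N k) f - particleMean (θ N 0) f| ≤ B * ε N) ∧
      ∀ k : ℕ, ((k + 1 : ℕ) : ℝ) ≤ N * T →
        |particleMean (θ N (k + 1)) f - particleMean (θ N k) f| ≤ B * (ε N / N) := by
  obtain ⟨R, C, hC, hev⟩ := h.exists_bound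
  obtain ⟨B, hB0, hB⟩ := exists_abs_le_closedBall (h.smooth f hf).continuous R
  obtain ⟨L, hL0, hL⟩ := exists_lipschitz_closedBall ((h.smooth f hf).of_le (by norm_num)) R
  refine ⟨B + L * C, by positivity, ?_⟩
  filter_upwards [hev, h.eps_pos] with N hN hε
  have hT := h.T_pos
  have h0 : ((0 : ℕ) : ℝ) ≤ N * T := by push_cast; positivity
  refine ⟨fun k hk => ⟨?_, ?_⟩, fun k hk => ?_⟩
  · refine abs_particleMean_le (by positivity) fun n => (hB _ ((hN k hk).2 n).1).trans ?_
    have : 0 ≤ L * C := by positivity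
    linarith
  · refine abs_particleMean_sub_le (by positivity) fun n => ?_
    refine (hL _ _ ((hN 0 h0).2 n).1 ((hN k hk).2 n).1).trans ?_
    calc _ ≤ L * (C * ε N) := by gcongr; exact ((hN k hk).2 n).2.2
      _ ≤ _ := by nlinarith [mul_nonneg hB0 hε.le]
  · have hk' : (k : ℝ) ≤ N * T := by push_cast at hk; linarith
    refine abs_particleMean_sub_le (by positivity) fun n => ?_
    refine (hL _ _ ((hN k hk').2 n).1 ((hN _ hk).2 n).1).trans ?_
    rw [h.step, add_sub_cancel_left, norm_smul, Real.norm_eq_abs, abs_of_nonneg (by positivity)]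
    calc _ ≤ L * (ε N / N * C) := by gcongr; exact ((hN k hk').2 n).2.1
      _ = L * C * (ε N / N) := by ring
      _ ≤ _ := by gcongr; linarith

theorem slowlyVarying_particleMean (h : S.IsTraining T wt ε δ 𝒞 m ξ θ) {f : E → ℝ} (hf : f ∈ 𝒞) :
    SlowlyVarying T fun N k => particleMean (θ N k) f := by
  obtain ⟨B, hB0, hB⟩ := h.exists_particleMean_bound hf
  refine ⟨B, hB0, ?_⟩
  filter_upwards [hB, h.eventually_eps_le_one] with N hN hε
  refine ⟨fun k hk => (hN.1 k hk).1, fun k hk => (hN.2 k hk).trans ?_⟩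
  rw [div_eq_mul_inv, div_eq_mul_inv]
  have : (0 : ℝ) ≤ (N : ℝ)⁻¹ := by positivity
  nlinarith [mul_nonneg hB0 this]

/-- The increments of a mean are `O(ε / N)`, so division by `ε` still leaves `O(1 / N)`. -/
theorem slowlyVarying_out (h : S.IsTraining T wt ε δ 𝒞 m ξ θ) (i : ι) :
    SlowlyVarying T fun N k => S.out (ε N) (θ N k) i := by
  obtain ⟨R, C, hC, hev⟩ := h.exists_bound
  obtain ⟨B, hB0, hB⟩ := h.exists_particleMean_bound (h.F_mem i)
  refine ⟨B + C, by positivity, ?_⟩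
  filter_upwards [hB, hev, h.eps_pos] with N hN hN' hε
  refine ⟨fun k hk => ((hN' k hk).1 i).trans (by linarith), fun k hk => ?_⟩
  rw [out, out, ← mul_sub, abs_mul, abs_of_pos (inv_pos.2 hε)]
  calc _ ≤ (ε N)⁻¹ * (B * (ε N / N)) := by gcongr; exact hN.2 k hk
    _ = B / N := by field_simp
    _ ≤ _ := by gcongr; linarith

theorem slowlyVarying_drift (h : S.IsTraining T wt ε δ 𝒞 m ξ θ) {f : E → ℝ} (hf : f ∈ 𝒞) (i : ι) :
    SlowlyVarying T fun N k => (S.y i - S.out (ε N) (θ N k) i) *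
      S.mix (particleMean (θ N k)) (particleMean (θ N k)) f i := by
  refine ((h.slowlyVarying_out i).const_sub _).mul (SlowlyVarying.sum fun a => ?_)
  exact (h.slowlyVarying_particleMean (h.D_mem i a)).mul
    (h.slowlyVarying_particleMean (h.lie_mem f hf i a))

/-- The averaged rate of change of the mean of `f`. -/
noncomputable def drift (S : ParticleSystem E ι α) (wt ε : ℝ) {N : ℕ} (θ : Fin N → E)
    (f : E → ℝ) : ℝ :=
  wt * ∑ i, (S.y i - S.out ε θ i) * S.mix (particleMean θ) (particleMean θ) f i

/-- There are three errors: the Taylor remainders, `N T` terms of order `(ε / N) ^ 2`; the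
replacement of the data weights by their average; and the incomplete cell of the Riemann sum. Each
is `O(ε δ)`, so that after division by `ε` the outputs still have error `δ`. -/
theorem particleMean_sub_integral (h : S.IsTraining T wt ε δ 𝒞 m ξ θ) {f : E → ℝ} (hf : f ∈ 𝒞) :
    ∃ C, ∀ᶠ N : ℕ in atTop, ∀ t ∈ Icc 0 T,
      |particleMean (θ N ⌊(N : ℝ) * t⌋₊) f - particleMean (θ N 0) f -
        ε N * ∫ s in (0 : ℝ)..t, drift S wt (ε N) (θ N ⌊(N : ℝ) * s⌋₊) f| ≤ C * (ε N * δ N) := by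
  obtain ⟨R, C, hC, hev⟩ := h.exists_bound
  obtain ⟨Cf, hCf0, hCf⟩ := exists_taylor_closedBall (h.smooth f hf) R
  choose B hB0 hB using fun i => h.slowlyVarying_drift hf i
  obtain ⟨Cw, hCw⟩ := h.weight_sum
  have hT := h.T_pos
  set Bs := ∑ i, B i
  have hBs0 : 0 ≤ Bs := Finset.sum_nonneg fun i _ => hB0 i
  refine ⟨Cf * C ^ 2 * T + Bs * (1 + T) * |Cw| + |wt| * Bs, ?_⟩
  filter_upwards [hev, hCw, h.eps_pos, h.eventually_eps_le_one, h.inv_le_delta, h.delta_pos,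
    eventually_gt_atTop 0, eventually_all.2 hB] with N hN hw hε hε1 hδ hδ0 hN0 hB t ht
  have hN' : (0 : ℝ) < N := by exact_mod_cast hN0
  set k := ⌊(N : ℝ) * t⌋₊ with hk
  have hk1 : (k : ℝ) ≤ N * t := Nat.floor_le (mul_nonneg hN'.le ht.1)
  have hkT : (k : ℝ) ≤ N * T := hk1.trans (by gcongr; exact ht.2)
  set Φ : ℕ → ι → ℝ := fun j i => (S.y i - S.out (ε N) (θ N j) i) *
    S.mix (particleMean (θ N j)) (particleMean (θ N j)) f i with hΦ
  have hj : ∀ j < k, ((j + 1 : ℕ) : ℝ) ≤ N * T := fun j hj =>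
    le_trans (by exact_mod_cast hj) hkT
  have hj' : ∀ j < k, (j : ℝ) ≤ N * T := fun j hj => le_trans (by exact_mod_cast hj.le) hkT
  have hone : ∀ j < k, |particleMean (θ N (j + 1)) f - particleMean (θ N j) f -
      ε N / N * ∑ i, ξ j i * Φ j i| ≤ Cf * (ε N / N * C) ^ 2 := by
    intro j hjk
    rw [← fderiv_incr_mean]
    have : particleMean (θ N (j + 1)) f - particleMean (θ N j) f -
        ε N / N * ((N : ℝ)⁻¹ * ∑ n, fderiv ℝ f (θ N j n) (S.incr (ε N) (ξ j) (θ N j) n)) =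
        particleMean (fun n => (θ N j n, θ N (j + 1) n))
          (fun p => f p.2 - f p.1 - fderiv ℝ f p.1 (p.2 - p.1)) := by
      simp only [particleMean, Finset.sum_sub_distrib, h.step, add_sub_cancel_left, map_smul,
        smul_eq_mul, ← Finset.mul_sum]
      ring
    rw [this]
    refine abs_particleMean_le (by positivity) fun n => ?_
    refine (hCf _ _ ((hN j (hj' j hjk)).2 n).1 ((hN _ (hj j hjk)).2 n).1).trans ?_
    rw [h.step, add_sub_cancel_left, norm_smul, Real.norm_eq_abs, abs_of_nonneg (by positivity)]
    gcongr
    exact ((hN j (hj' j hjk)).2 n).2.1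
  have hsum : |particleMean (θ N k) f - particleMean (θ N 0) f -
      ε N / N * ∑ j ∈ Finset.range k, ∑ i, ξ j i * Φ j i| ≤ k * (Cf * (ε N / N * C) ^ 2) := by
    have : particleMean (θ N k) f - particleMean (θ N 0) f -
        ε N / N * ∑ j ∈ Finset.range k, ∑ i, ξ j i * Φ j i =
        ∑ j ∈ Finset.range k, (particleMean (θ N (j + 1)) f - particleMean (θ N j) f -
          ε N / N * ∑ i, ξ j i * Φ j i) := by
      rw [Finset.sum_sub_distrib, Finset.sum_range_sub (fun j => particleMean (θ N j) f),
        Finset.mul_sum]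
    rw [this]
    refine (Finset.abs_sum_le_sum_abs _ _).trans ?_
    calc _ ≤ ∑ _j ∈ Finset.range k, Cf * (ε N / N * C) ^ 2 :=
          Finset.sum_le_sum fun j hj => hone j (Finset.mem_range.1 hj)
      _ = _ := by simp
  have hs0 : 0 ≤ |Cw| * (N * δ N) := by positivity
  -- The partial sums of `ξ j i - wt` are `O(N δ)`. Summation by parts multiplies this by the size
  -- and the total variation of `Φ`, both bounded, since there are at most `N T` increments of order
  -- `1 / N`.
  have hnoise : |∑ j ∈ Finset.range k, ∑ i, ξ j i * Φ j i -
      ∑ j ∈ Finset.range k, wt * ∑ i, Φ j i| ≤ Bs * (1 + T) * (|Cw| * (N * δ N)) := by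
    have : ∑ j ∈ Finset.range k, ∑ i, ξ j i * Φ j i - ∑ j ∈ Finset.range k, wt * ∑ i, Φ j i =
        ∑ i, ∑ j ∈ Finset.range k, Φ j i * (ξ j i - wt) := by
      rw [Finset.sum_comm (s := Finset.univ), ← Finset.sum_sub_distrib]
      refine Finset.sum_congr rfl fun j _ => ?_
      rw [Finset.mul_sum, ← Finset.sum_sub_distrib]
      exact Finset.sum_congr rfl fun i _ => by ring
    rw [this, Finset.sum_mul, Finset.sum_mul]
    refine (Finset.abs_sum_le_sum_abs _ _).trans (Finset.sum_le_sum fun i _ => ?_)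
    have := abs_sum_mul_le_of_partial_sums (a := fun j => Φ j i) (x := fun j => ξ j i - wt)
      (k := k) (A := B i) (Δ := B i / N) (s := |Cw| * (N * δ N)) ((hB i).1 k hkT)
      (fun j hjk => (hB i).2 j (hj j hjk)) (fun n hn => by
        refine (hw n (le_trans (by exact_mod_cast hn) hkT) i).trans ?_
        gcongr
        exact le_abs_self _)
    refine this.trans ?_
    gcongr
    have h1 : (k : ℝ) * (B i / N) ≤ T * B i := by
      rw [mul_div_assoc', div_le_iff₀ hN']
      nlinarith [hB0 i]
    linarith
  have hriem := abs_integral_comp_floor_sub_sum_le (fun j => wt * ∑ i, Φ j i) hN0 ht.1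
    (B := |wt| * Bs) (by
      rw [abs_mul]
      refine mul_le_mul_of_nonneg_left ?_ (abs_nonneg _)
      exact (Finset.abs_sum_le_sum_abs _ _).trans (Finset.sum_le_sum fun i _ => (hB i).1 k hkT))
  rw [← hk] at hriem
  change |(∫ s in (0 : ℝ)..t, drift S wt (ε N) (θ N ⌊(N : ℝ) * s⌋₊) f) - _| ≤ _ at hriem
  set I := ∫ s in (0 : ℝ)..t, drift S wt (ε N) (θ N ⌊(N : ℝ) * s⌋₊) f
  set P := ∑ j ∈ Finset.range k, ∑ i, ξ j i * Φ j i
  set P' := ∑ j ∈ Finset.range k, wt * ∑ i, Φ j i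
  set d := particleMean (θ N k) f - particleMean (θ N 0) f
  have hd : d - ε N * I = (d - ε N / N * P) + ε N / N * (P - P') - ε N * (I - (N : ℝ)⁻¹ * P') := by
    ring
  rw [hd]
  have e1 : (k : ℝ) * (Cf * (ε N / N * C) ^ 2) ≤ Cf * C ^ 2 * T * (ε N * δ N) := by
    calc _ = (k / N) * (Cf * C ^ 2) * ε N * ε N * (N : ℝ)⁻¹ := by field_simp
      _ ≤ T * (Cf * C ^ 2) * ε N * 1 * δ N := by
        gcongr
        rw [div_le_iff₀ hN']; linarith
      _ = _ := by ring
  have e2 : |ε N / N * (P - P')| ≤ Bs * (1 + T) * |Cw| * (ε N * δ N) := by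
    rw [abs_mul, abs_of_nonneg (by positivity)]
    calc _ ≤ ε N / N * (Bs * (1 + T) * (|Cw| * (N * δ N))) := by gcongr
      _ = _ := by field_simp
  have e3 : |ε N * (I - (N : ℝ)⁻¹ * P')| ≤ |wt| * Bs * (ε N * δ N) := by
    rw [abs_mul, abs_of_pos hε]
    calc _ ≤ ε N * (|wt| * Bs / N) := by gcongr
      _ = |wt| * Bs * (ε N * (N : ℝ)⁻¹) := by ring
      _ ≤ _ := by gcongr
  calc _ ≤ |d - ε N / N * P| + |ε N / N * (P - P')| + |ε N * (I - (N : ℝ)⁻¹ * P')| :=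
        (abs_sub _ _).trans (by gcongr; exact abs_add_le _ _)
    _ ≤ Cf * C ^ 2 * T * (ε N * δ N) + Bs * (1 + T) * |Cw| * (ε N * δ N) +
        |wt| * Bs * (ε N * δ N) := by gcongr; exact hsum.trans e1
    _ = _ := by ring

end ParticleSystem.IsTraining

/-! ### Asymptotic estimates that are uniform in time -/

/-- Along this filter, `=O` is meant for large `N`, uniformly in `t ∈ [0,T]`. -/
abbrev uniformlyOn (T : ℝ) : Filter (ℕ × ℝ) := atTop ×ˢ 𝓟 (Icc 0 T)

section UniformlyOn

open Asymptotics

variable {T : ℝ} {X : ℕ × ℝ → ℝ} {a b : ℕ → ℝ}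

theorem isBigO_uniformlyOn_iff : (X =O[uniformlyOn T] fun q => a q.1) ↔
    ∃ C, ∀ᶠ N in atTop, ∀ t ∈ Icc 0 T, |X (N, t)| ≤ C * |a N| := by
  simp only [isBigO_iff, uniformlyOn, eventually_prod_principal_iff, Real.norm_eq_abs]

theorem isBigO_uniformlyOn_of_le {C : ℝ} (h : ∀ᶠ N in atTop, ∀ t ∈ Icc 0 T,
    |X (N, t)| ≤ C * a N) : X =O[uniformlyOn T] fun q => a q.1 := by
  refine isBigO_uniformlyOn_iff.2 ⟨|C|, h.mono fun N h t ht => (h t ht).trans ?_⟩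
  rw [← abs_mul]
  exact le_abs_self _

theorem isBigO_scale {C : ℝ} (h : ∀ᶠ N in atTop, 0 ≤ a N ∧ a N ≤ C * b N) :
    (fun q : ℕ × ℝ => a q.1) =O[uniformlyOn T] fun q => b q.1 :=
  isBigO_uniformlyOn_of_le (h.mono fun N h t _ => by
    rw [abs_of_nonneg h.1]; exact h.2)

theorem isBigO_one_of_continuous {c : ℝ → ℝ} (hc : Continuous c) :
    (fun q : ℕ × ℝ => c q.2) =O[uniformlyOn T] fun _ => (1 : ℝ) := by
  obtain ⟨C, hC⟩ := (isCompact_Icc (a := (0 : ℝ)) (b := T)).exists_bound_of_continuousOn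
    hc.continuousOn
  exact isBigO_uniformlyOn_of_le (a := fun _ => 1) (C := C)
    (Eventually.of_forall fun N t ht => by simpa using hC t ht)

theorem isBigO_integral (h : X =O[uniformlyOn T] fun q => a q.1) :
    (fun q => ∫ s in (0 : ℝ)..q.2, X (q.1, s)) =O[uniformlyOn T] fun q => a q.1 := by
  obtain ⟨C, hC⟩ := isBigO_uniformlyOn_iff.1 h
  refine isBigO_uniformlyOn_iff.2 ⟨|C| * |T|, hC.mono fun N hN t ht => ?_⟩
  have := intervalIntegral.norm_integral_le_of_norm_le_const (a := 0) (b := t)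
    (C := |C| * |a N|) (f := fun s => X (N, s)) (fun s hs => by
      rw [uIoc_of_le ht.1] at hs
      refine (hN s ⟨hs.1.le, hs.2.trans ht.2⟩).trans ?_
      gcongr
      exact le_abs_self _)
  rw [Real.norm_eq_abs, sub_zero, abs_of_nonneg ht.1] at this
  refine this.trans ?_
  rw [mul_right_comm]
  gcongr
  exact ht.2.trans (le_abs_self _)

/-- The a priori bound may depend on `N`, because the constant of `gronwall_integral` does not
involve it. -/
theorem isBigO_gronwall {ι : Type*} [Fintype ι] {w : ι → ℕ × ℝ → ℝ} (A : ι → ι → ℝ)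
    (hb : ∀ᶠ N in atTop, ∃ B, ∀ t ∈ Icc 0 T, ∀ k, |w k (N, t)| ≤ B)
    (h : ∀ k, (fun q => w k q + ∫ s in (0 : ℝ)..q.2, ∑ i, A k i * w i (q.1, s))
      =O[uniformlyOn T] fun q => a q.1) (k : ι) : w k =O[uniformlyOn T] fun q => a q.1 := by
  choose C hC using fun k => isBigO_uniformlyOn_iff.1 (h k)
  set c := ∑ k, ∑ i, |A k i|
  have hc0 : 0 ≤ c := Finset.sum_nonneg fun _ _ => Finset.sum_nonneg fun _ _ => abs_nonneg _
  have hc : ∀ k i, |A k i| ≤ c := fun k i =>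
    (Finset.single_le_sum (f := fun i => |A k i|) (fun _ _ => abs_nonneg _)
      (Finset.mem_univ i)).trans (Finset.single_le_sum (f := fun k => ∑ i, |A k i|)
        (fun _ _ => Finset.sum_nonneg fun _ _ => abs_nonneg _) (Finset.mem_univ k))
  set C' := ∑ k, |C k|
  have hC' : ∀ k, C k ≤ C' := fun k => (le_abs_self _).trans
    (Finset.single_le_sum (f := fun k => |C k|) (fun _ _ => abs_nonneg _) (Finset.mem_univ k))
  have hC0 : 0 ≤ C' := Finset.sum_nonneg fun _ _ => abs_nonneg _
  refine isBigO_uniformlyOn_iff.2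
    ⟨2 * C' * Real.exp ((2 * Fintype.card ι * c + 1) * T), ?_⟩
  filter_upwards [hb, eventually_all.2 hC] with N ⟨B, hB⟩ hN t ht
  have hg := gronwall_integral (T := T) (a := C' * |a N|) (c := c) (B := |B|) (by positivity) hc0
    (abs_nonneg _) (e := fun t k => w k (N, t)) hc
    (fun t ht k => (hB t ht k).trans (le_abs_self _))
    (fun t ht k => (hN k t ht).trans (by gcongr; exact hC' k)) t ht k
  refine hg.trans ?_
  calc _ = 2 * C' * Real.exp ((2 * Fintype.card ι * c + 1) * t) * |a N| := by ring
    _ ≤ _ := by gcongr; exact ht.2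

end UniformlyOn

/-! ### The limiting functionals of first, second and third order -/

namespace ParticleSystem

variable {E ι α : Type*} [NormedAddCommGroup E] [NormedSpace ℝ E] [Fintype ι] [Fintype α]
  (S : ParticleSystem E ι α) (wt : ℝ) (m : (E → ℝ) → ℝ)

/-- The first order variation of the mean of `f` along the limit `h` of the outputs. -/
noncomputable def lin (h : ℝ → ι → ℝ) (t : ℝ) (f : E → ℝ) : ℝ :=
  ∫ s in (0 : ℝ)..t, wt * ∑ i, (S.y i - h s i) * S.mix m m f i

/-- The second order variation of the mean of `f`. -/
noncomputable def quad (h K : ℝ → ι → ℝ) (t : ℝ) (f : E → ℝ) : ℝ :=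
  ∫ s in (0 : ℝ)..t, wt * ∑ i, ((S.y i - h s i) *
    (S.mix m (S.lin wt m h s) f i + S.mix (S.lin wt m h s) m f i) - K s i * S.mix m m f i)

/-- The third order forcing of the observable `f`. -/
noncomputable def forcing (h K : ℝ → ι → ℝ) (t : ℝ) (f : E → ℝ) (i : ι) : ℝ :=
  (S.y i - h t i) * (S.mix m (S.quad wt m h K t) f i + S.mix (S.quad wt m h K t) m f i +
    S.mix (S.lin wt m h t) (S.lin wt m h t) f i) -
  K t i * (S.mix m (S.lin wt m h t) f i + S.mix (S.lin wt m h t) m f i)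

theorem continuous_mix {X : Type*} [TopologicalSpace X] {μ ν : X → (E → ℝ) → ℝ}
    (hμ : ∀ f, Continuous fun x => μ x f) (hν : ∀ f, Continuous fun x => ν x f) (f : E → ℝ) (i : ι) :
    Continuous fun x => S.mix (μ x) (ν x) f i :=
  continuous_finsetSum _ fun _ _ => (hμ _).mul (hν _)

variable {h K : ℝ → ι → ℝ}

theorem continuous_lin (hh : Continuous h) (f : E → ℝ) : Continuous fun t => S.lin wt m h t f := by
  refine intervalIntegral.continuous_primitive (fun a b => Continuous.intervalIntegrable ?_ a b) 0
  fun_prop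

theorem continuous_quad (hh : Continuous h) (hK : Continuous K) (f : E → ℝ) :
    Continuous fun t => S.quad wt m h K t f := by
  refine intervalIntegral.continuous_primitive (fun a b => Continuous.intervalIntegrable ?_ a b) 0
  have h1 := S.continuous_mix (μ := fun _ => m) (ν := S.lin wt m h) (fun _ => continuous_const)
    (S.continuous_lin wt m hh)
  have h2 := S.continuous_mix (ν := fun _ => m) (μ := S.lin wt m h) (S.continuous_lin wt m hh)
    (fun _ => continuous_const)
  fun_prop

theorem continuous_forcing (hh : Continuous h) (hK : Continuous K) (f : E → ℝ) (i : ι) :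
    Continuous fun t => S.forcing wt m h K t f i := by
  have h1 := S.continuous_mix (μ := fun _ => m) (ν := S.lin wt m h) (fun _ => continuous_const)
    (S.continuous_lin wt m hh)
  have h2 := S.continuous_mix (ν := fun _ => m) (μ := S.lin wt m h) (S.continuous_lin wt m hh)
    (fun _ => continuous_const)
  have h3 := S.continuous_mix (μ := fun _ => m) (ν := S.quad wt m h K) (fun _ => continuous_const)
    (S.continuous_quad wt m hh hK)
  have h4 := S.continuous_mix (ν := fun _ => m) (μ := S.quad wt m h K)
    (S.continuous_quad wt m hh hK) (fun _ => continuous_const)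
  have h5 := S.continuous_mix (ν := S.lin wt m h) (μ := S.lin wt m h)
    (S.continuous_lin wt m hh) (S.continuous_lin wt m hh)
  exact ((continuous_const.sub ((continuous_apply i).comp hh)).mul
    (((h3 f i).add (h4 f i)).add (h5 f i))).sub
      (((continuous_apply i).comp hK).mul ((h1 f i).add (h2 f i)))

end ParticleSystem

/-! ### Integral equations for means and outputs, uniformly in time -/

namespace ParticleSystem.IsTraining

open Asymptotics

variable {E ι α : Type*} [NormedAddCommGroup E] [NormedSpace ℝ E] [Fintype ι] [Fintype α]
  {S : ParticleSystem E ι α} {T wt : ℝ} {ε δ : ℕ → ℝ} {𝒞 : Set (E → ℝ)}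
  {m : (E → ℝ) → ℝ} {ξ : ℕ → ι → ℝ} {θ : (N : ℕ) → ℕ → Fin N → E} [ProperSpace E]

/-- The mean of `f` as a function of `(N, t)`. -/
noncomputable def meanPath (θ : (N : ℕ) → ℕ → Fin N → E) (q : ℕ × ℝ) (f : E → ℝ) : ℝ :=
  particleMean (θ q.1 ⌊(q.1 : ℝ) * q.2⌋₊) f

/-- The output as a function of `(N, t)`. -/
noncomputable def outPath (S : ParticleSystem E ι α) (ε : ℕ → ℝ) (θ : (N : ℕ) → ℕ → Fin N → E)
    (i : ι) (q : ℕ × ℝ) : ℝ :=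
  S.out (ε q.1) (θ q.1 ⌊(q.1 : ℝ) * q.2⌋₊) i

/-- The averaged rate of change of the mean of `f` as a function of `(N, t)`. -/
noncomputable def driftPath (S : ParticleSystem E ι α) (wt : ℝ) (ε : ℕ → ℝ)
    (θ : (N : ℕ) → ℕ → Fin N → E) (f : E → ℝ) (q : ℕ × ℝ) : ℝ :=
  wt * ∑ i, (S.y i - outPath S ε θ i q) * S.mix (meanPath θ q) (meanPath θ q) f i

theorem floor_le {N : ℕ} {t : ℝ} (ht : t ∈ Icc 0 T) : (⌊(N : ℝ) * t⌋₊ : ℝ) ≤ N * T :=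
  (Nat.floor_le (mul_nonneg N.cast_nonneg ht.1)).trans (by gcongr; exact ht.2)

theorem outPath_isBigO_one (tr : S.IsTraining T wt ε δ 𝒞 m ξ θ) (i : ι) :
    outPath S ε θ i =O[uniformlyOn T] fun _ => (1 : ℝ) := by
  obtain ⟨B, -, hB⟩ := tr.slowlyVarying_out i
  exact isBigO_uniformlyOn_of_le (a := fun _ => 1) (C := B) (hB.mono fun N hN t ht => by
    rw [mul_one]; exact hN.1 _ (floor_le ht))

theorem meanPath_isBigO_one (tr : S.IsTraining T wt ε δ 𝒞 m ξ θ) {f : E → ℝ} (hf : f ∈ 𝒞) :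
    (fun q => meanPath θ q f) =O[uniformlyOn T] fun _ => (1 : ℝ) := by
  obtain ⟨B, -, hB⟩ := tr.slowlyVarying_particleMean hf
  exact isBigO_uniformlyOn_of_le (a := fun _ => 1) (C := B) (hB.mono fun N hN t ht => by
    rw [mul_one]; exact hN.1 _ (floor_le ht))

theorem intervalIntegrable_outPath (i : ι) (N : ℕ) (a b : ℝ) :
    IntervalIntegrable (fun s => outPath S ε θ i (N, s)) volume a b :=
  intervalIntegrable_comp_floor (fun k => S.out (ε N) (θ N k) i) N a b

theorem intervalIntegrable_driftPath (f : E → ℝ) (N : ℕ) (a b : ℝ) :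
    IntervalIntegrable (fun s => driftPath S wt ε θ f (N, s)) volume a b :=
  intervalIntegrable_comp_floor (fun k => drift S wt (ε N) (θ N k) f) N a b

theorem init_isBigO (tr : S.IsTraining T wt ε δ 𝒞 m ξ θ) {f : E → ℝ} (hf : f ∈ 𝒞) :
    (fun q : ℕ × ℝ => particleMean (θ q.1 0) f - m f) =O[uniformlyOn T] fun q => δ q.1 :=
  (tr.init f hf).comp_tendsto tendsto_fst

theorem out_init_isBigO (tr : S.IsTraining T wt ε δ 𝒞 m ξ θ) (i : ι) :
    (fun q : ℕ × ℝ => S.out (ε q.1) (θ q.1 0) i) =O[uniformlyOn T] fun q => δ q.1 / ε q.1 := by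
  have h1 := tr.init_isBigO (tr.F_mem i)
  simp only [tr.mean_F, sub_zero] at h1
  simp only [out, div_eq_inv_mul]
  exact (isBigO_refl _ _).mul h1

theorem meanPath_sub_integral (tr : S.IsTraining T wt ε δ 𝒞 m ξ θ) {f : E → ℝ} (hf : f ∈ 𝒞) :
    (fun q => meanPath θ q f - m f - ε q.1 * ∫ s in (0 : ℝ)..q.2, driftPath S wt ε θ f (q.1, s))
      =O[uniformlyOn T] fun q => δ q.1 := by
  obtain ⟨C, hC⟩ := tr.particleMean_sub_integral hf
  have h1 : (fun q : ℕ × ℝ => meanPath θ q f - particleMean (θ q.1 0) f -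
      ε q.1 * ∫ s in (0 : ℝ)..q.2, driftPath S wt ε θ f (q.1, s))
      =O[uniformlyOn T] fun q => ε q.1 * δ q.1 :=
    isBigO_uniformlyOn_of_le (a := fun N => ε N * δ N) hC
  have h2 : (fun q : ℕ × ℝ => ε q.1 * δ q.1) =O[uniformlyOn T] fun q => δ q.1 := by
    refine isBigO_scale (a := fun N => ε N * δ N) (C := 1) ?_
    filter_upwards [tr.eps_pos, tr.delta_pos, tr.eventually_eps_le_one] with N h1 h2 h3
    exact ⟨by positivity, by nlinarith⟩
  refine ((h1.trans h2).add (tr.init_isBigO hf)).congr_left fun q => ?_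
  ring

/-- The error `ε δ` of the means is divided by `ε`. The initial output is subtracted exactly, not
estimated: it is only known to be `O(δ / ε)`, which would spoil the bound. -/
theorem outPath_sub_integral (tr : S.IsTraining T wt ε δ 𝒞 m ξ θ) (i : ι) :
    (fun q => outPath S ε θ i q - S.out (ε q.1) (θ q.1 0) i -
      ∫ s in (0 : ℝ)..q.2, driftPath S wt ε θ (S.F i) (q.1, s))
      =O[uniformlyOn T] fun q => δ q.1 := by
  obtain ⟨C, hC⟩ := tr.particleMean_sub_integral (tr.F_mem i)
  refine isBigO_uniformlyOn_of_le (C := C) ?_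
  filter_upwards [hC, tr.eps_pos] with N hN hε t ht
  have h1 : outPath S ε θ i (N, t) - S.out (ε N) (θ N 0) i -
      ∫ s in (0 : ℝ)..t, driftPath S wt ε θ (S.F i) (N, s) =
      (ε N)⁻¹ * (particleMean (θ N ⌊(N : ℝ) * t⌋₊) (S.F i) - particleMean (θ N 0) (S.F i) -
        ε N * ∫ s in (0 : ℝ)..t, drift S wt (ε N) (θ N ⌊(N : ℝ) * s⌋₊) (S.F i)) := by
    rw [mul_sub, mul_sub, inv_mul_cancel_left₀ hε.ne']
    rfl
  rw [h1, abs_mul, abs_of_pos (inv_pos.2 hε)]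
  calc _ ≤ (ε N)⁻¹ * (C * (ε N * δ N)) := by gcongr; exact hN t ht
    _ = _ := by field_simp

theorem isBigO_sum_wt {κ : Type*} {s : Finset κ} {X : κ → ℕ × ℝ → ℝ} {a : ℕ → ℝ} (c : ℝ)
    (hX : ∀ i, X i =O[uniformlyOn T] fun q => a q.1) :
    (fun q => c * ∑ i ∈ s, X i q) =O[uniformlyOn T] fun q => a q.1 :=
  (IsBigO.fun_sum fun i _ => hX i).const_mul_left c

/-- If `p` approximates the means of all functions of `𝒞`, then it approximates the mixed terms. -/
theorem mix_sub_mix (tr : S.IsTraining T wt ε δ 𝒞 m ξ θ) {p : ℕ × ℝ → (E → ℝ) → ℝ} {a : ℕ → ℝ}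
    (hp1 : ∀ f ∈ 𝒞, (fun q => p q f) =O[uniformlyOn T] fun _ => (1 : ℝ))
    (hp : ∀ f ∈ 𝒞, (fun q => meanPath θ q f - p q f) =O[uniformlyOn T] fun q => a q.1)
    {f : E → ℝ} (hf : f ∈ 𝒞) (i : ι) :
    (fun q => S.mix (meanPath θ q) (meanPath θ q) f i - S.mix (p q) (p q) f i)
      =O[uniformlyOn T] fun q => a q.1 := by
  have h1 : ∀ b, (fun q => meanPath θ q (S.D i b) * meanPath θ q (S.lie i b f) -
      p q (S.D i b) * p q (S.lie i b f)) =O[uniformlyOn T] fun q => a q.1 := by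
    intro b
    have e1 := (hp _ (tr.D_mem i b)).mul (tr.meanPath_isBigO_one (tr.lie_mem f hf i b))
    have e2 := (hp1 _ (tr.D_mem i b)).mul (hp _ (tr.lie_mem f hf i b))
    simp only [mul_one, one_mul] at e1 e2
    exact (e1.add e2).congr_left fun q => by ring
  refine (IsBigO.fun_sum (s := Finset.univ) fun b _ => h1 b).congr_left fun q => ?_
  simp only [mix, Finset.sum_sub_distrib]

theorem isBigO_mix {p p' : ℕ × ℝ → (E → ℝ) → ℝ}
    (hp : ∀ f, (fun q => p q f) =O[uniformlyOn T] fun _ => (1 : ℝ))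
    (hp' : ∀ f, (fun q => p' q f) =O[uniformlyOn T] fun _ => (1 : ℝ)) (f : E → ℝ) (i : ι) :
    (fun q => S.mix (p q) (p' q) f i) =O[uniformlyOn T] fun _ => (1 : ℝ) := by
  refine IsBigO.fun_sum fun b _ => ?_
  simpa using (hp (S.D i b)).mul (hp' (S.lie i b f))

/-- The approximation of the outputs by functions `P` that solve an approximate equation. -/
theorem outPath_sub_isBigO (tr : S.IsTraining T wt ε δ 𝒞 m ξ θ) {P R : ι → ℕ × ℝ → ℝ}
    {a : ℕ → ℝ} {b : ι → ℕ → ℝ} (hδ : (fun q : ℕ × ℝ => δ q.1) =O[uniformlyOn T] fun q => a q.1)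
    (hP : ∀ k N, Continuous fun t => P k (N, t)) (hR : ∀ k N, Continuous fun t => R k (N, t))
    (hPR : ∀ k N, ∀ t ∈ Icc 0 T, P k (N, t) = b k N + ∫ s in (0 : ℝ)..t, R k (N, s))
    (hb : ∀ k, (fun q : ℕ × ℝ => S.out (ε q.1) (θ q.1 0) k - b k q.1)
      =O[uniformlyOn T] fun q => a q.1)
    (hd : ∀ k, (fun q => driftPath S wt ε θ (S.F k) q - R k q +
      wt * ∑ i, (outPath S ε θ i q - P i q) * S.mix m m (S.F k) i)
        =O[uniformlyOn T] fun q => a q.1) (k : ι) :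
    (fun q => outPath S ε θ k q - P k q) =O[uniformlyOn T] fun q => a q.1 := by
  -- The feedback of the outputs on themselves, linearised at the initial law, goes to the left-hand
  -- side as the matrix `wt * mix m m (F k) i`; the rest is the remainder bounded in `hd`.
  refine isBigO_gronwall (w := fun k q => outPath S ε θ k q - P k q)
    (fun k i => wt * S.mix m m (S.F k) i) ?_ (fun k => ?_) k
  · choose B hB hev using tr.slowlyVarying_out
    filter_upwards [eventually_all.2 hev] with N hN
    choose B' hB' using fun k => (isCompact_Icc (a := (0 : ℝ)) (b := T)).exists_bound_of_continuousOn
      (hP k N).continuousOn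
    refine ⟨∑ k, (|B k| + |B' k|), fun t ht k => ?_⟩
    refine le_trans ?_ (Finset.single_le_sum (f := fun k => |B k| + |B' k|)
      (fun _ _ => by positivity) (Finset.mem_univ k))
    refine (abs_sub _ _).trans (add_le_add ?_ ((hB' k t ht).trans (le_abs_self _)))
    exact ((hN k).1 _ (floor_le ht)).trans (le_abs_self _)
  · have e1 := (tr.outPath_sub_integral k).trans hδ
    have e2 := isBigO_integral (hd k)
    refine ((e1.add (hb k)).add e2).congr' ?_ EventuallyEq.rfl
    rw [EventuallyEq, uniformlyOn, eventually_prod_principal_iff]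
    refine Eventually.of_forall fun N t ht => ?_
    dsimp only
    have hw : ∀ i, IntervalIntegrable (fun s => (outPath S ε θ i (N, s) - P i (N, s)) *
        S.mix m m (S.F k) i) volume 0 t := fun i =>
      ((intervalIntegrable_outPath i N 0 t).sub ((hP i N).intervalIntegrable 0 t)).mul_const _
    have hR' := (hR k N).intervalIntegrable (μ := volume) 0 t
    have hD := intervalIntegrable_driftPath (S := S) (wt := wt) (ε := ε) (θ := θ) (S.F k) N 0 t
    have hs : IntervalIntegrable (fun s => wt * ∑ i, (outPath S ε θ i (N, s) - P i (N, s)) *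
        S.mix m m (S.F k) i) volume 0 t :=
      (IntervalIntegrable.sum Finset.univ fun i _ => hw i).congr (by
        intro s _; simp) |>.const_mul wt
    rw [intervalIntegral.integral_add (hD.sub hR') hs, intervalIntegral.integral_sub hD hR',
      hPR k N t ht]
    have hcong : ∀ s, wt * ∑ i, (outPath S ε θ i (N, s) - P i (N, s)) * S.mix m m (S.F k) i =
        ∑ i, wt * S.mix m m (S.F k) i * (outPath S ε θ i (N, s) - P i (N, s)) := by
      intro s
      rw [Finset.mul_sum]
      exact Finset.sum_congr rfl fun i _ => by ring
    simp only [hcong]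
    ring

end ParticleSystem.IsTraining

/-! ### Expansion in powers of `ε` by bootstrapping -/

namespace ParticleSystem.IsTraining

open Asymptotics

variable {E ι α : Type*} [NormedAddCommGroup E] [NormedSpace ℝ E] [Fintype ι] [Fintype α]
  {S : ParticleSystem E ι α} {T wt : ℝ} {ε δ : ℕ → ℝ} {𝒞 : Set (E → ℝ)}
  {m : (E → ℝ) → ℝ} {ξ : ℕ → ι → ℝ} {θ : (N : ℕ) → ℕ → Fin N → E} [ProperSpace E]

/-- Products of quantities on the scales `ε ^ j` and `δ / ε` with ones on the scale `ε + δ`. -/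
theorem isBigO_mul_scale (tr : S.IsTraining T wt ε δ 𝒞 m ξ θ) (j : ℕ) {X Y : ℕ × ℝ → ℝ}
    (hX : X =O[uniformlyOn T] fun q => ε q.1 ^ j + δ q.1 / ε q.1)
    (hY : Y =O[uniformlyOn T] fun q => ε q.1 + δ q.1) :
    (fun q => X q * Y q) =O[uniformlyOn T] fun q => ε q.1 ^ (j + 1) + δ q.1 := by
  refine (hX.mul hY).trans (isBigO_scale (a := fun N => (ε N ^ j + δ N / ε N) * (ε N + δ N))
    (b := fun N => ε N ^ (j + 1) + δ N) (C := 2) ?_)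
  filter_upwards [tr.eps_pos, tr.delta_pos,
    tr.delta_tendsto.eventually (gt_mem_nhds zero_lt_one)] with N h1 h2 h3
  refine ⟨by positivity, ?_⟩
  have h4 : δ N ≤ ε N := by rw [div_lt_one h1] at h3; exact h3.le
  calc _ ≤ (ε N ^ j + δ N / ε N) * (ε N + ε N) := by gcongr
    _ = 2 * (ε N ^ (j + 1) + δ N / ε N * ε N) := by ring
    _ = _ := by rw [div_mul_cancel₀ _ h1.ne']

/-- Here the loss in the outputs is recovered: the integrated drift of a mean carries a factor `ε`,
which turns `δ / ε` into `δ` and gains one order. -/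
theorem isBigO_eps_mul_scale (tr : S.IsTraining T wt ε δ 𝒞 m ξ θ) (j : ℕ) {X : ℕ × ℝ → ℝ}
    (hX : X =O[uniformlyOn T] fun q => ε q.1 ^ j + δ q.1 / ε q.1) :
    (fun q => ε q.1 * X q) =O[uniformlyOn T] fun q => ε q.1 ^ (j + 1) + δ q.1 := by
  refine ((isBigO_refl (fun q : ℕ × ℝ => ε q.1) _).mul hX).trans
    (isBigO_scale (a := fun N => ε N * (ε N ^ j + δ N / ε N))
      (b := fun N => ε N ^ (j + 1) + δ N) (C := 1) ?_)
  filter_upwards [tr.eps_pos, tr.delta_pos] with N h1 h2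
  refine ⟨by positivity, le_of_eq ?_⟩
  field_simp
  ring

theorem isBigO_scale_of_le (tr : S.IsTraining T wt ε δ 𝒞 m ξ θ) (j : ℕ) :
    (fun q : ℕ × ℝ => ε q.1 ^ j + δ q.1) =O[uniformlyOn T] fun q => ε q.1 ^ j + δ q.1 / ε q.1 := by
  refine isBigO_scale (a := fun N => ε N ^ j + δ N) (b := fun N => ε N ^ j + δ N / ε N) (C := 1) ?_
  filter_upwards [tr.eps_pos, tr.delta_pos, tr.eventually_eps_le_one] with N h1 h2 h3
  refine ⟨by positivity, ?_⟩
  rw [one_mul]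
  gcongr
  rw [le_div_iff₀ h1]
  nlinarith

theorem isBigO_eps_pow (tr : S.IsTraining T wt ε δ 𝒞 m ξ θ) (j l : ℕ) (hl : j ≤ l) :
    (fun q : ℕ × ℝ => ε q.1 ^ l) =O[uniformlyOn T] fun q => ε q.1 ^ j + δ q.1 := by
  refine isBigO_scale (a := fun N => ε N ^ l) (b := fun N => ε N ^ j + δ N) (C := 1) ?_
  filter_upwards [tr.eps_pos, tr.delta_pos, tr.eventually_eps_le_one] with N h1 h2 h3
  refine ⟨by positivity, ?_⟩
  have := pow_le_pow_of_le_one h1.le h3 hl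
  linarith

theorem isBigO_delta (tr : S.IsTraining T wt ε δ 𝒞 m ξ θ) (j : ℕ) :
    (fun q : ℕ × ℝ => δ q.1) =O[uniformlyOn T] fun q => ε q.1 ^ j + δ q.1 := by
  refine isBigO_scale (a := δ) (b := fun N => ε N ^ j + δ N) (C := 1) ?_
  filter_upwards [tr.eps_pos, tr.delta_pos] with N h1 h2
  exact ⟨h2.le, by rw [one_mul, le_add_iff_nonneg_left]; positivity⟩

theorem isBigO_delta_div (tr : S.IsTraining T wt ε δ 𝒞 m ξ θ) (j : ℕ) :
    (fun q : ℕ × ℝ => δ q.1 / ε q.1) =O[uniformlyOn T] fun q => ε q.1 ^ j + δ q.1 / ε q.1 := by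
  refine isBigO_scale (a := fun N => δ N / ε N) (b := fun N => ε N ^ j + δ N / ε N) (C := 1) ?_
  filter_upwards [tr.eps_pos, tr.delta_pos] with N h1 h2
  exact ⟨by positivity, by rw [one_mul, le_add_iff_nonneg_left]; positivity⟩

theorem isBigO_const_mul_bounded {X : ℕ × ℝ → ℝ} {b c : ℕ × ℝ → ℝ}
    (hX : X =O[uniformlyOn T] fun _ => (1 : ℝ)) (hb : b =O[uniformlyOn T] c) :
    (fun q => X q * b q) =O[uniformlyOn T] c := by
  simpa using hX.mul hb

variable {h K U : ℝ → ι → ℝ} {V : ℕ → ℝ → ι → ℝ}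

/-- Start of the bootstrap: the particles move by `O(ε)` in total, and the initial mean is off by
`O(δ)`. -/
theorem meanPath_sub_mean (tr : S.IsTraining T wt ε δ 𝒞 m ξ θ) {f : E → ℝ} (hf : f ∈ 𝒞) :
    (fun q => meanPath θ q f - m f) =O[uniformlyOn T] fun q => ε q.1 ^ 1 + δ q.1 := by
  obtain ⟨B, hB0, hB⟩ := tr.exists_particleMean_bound hf
  have h1 : (fun q => meanPath θ q f - particleMean (θ q.1 0) f) =O[uniformlyOn T]
      fun q => ε q.1 ^ 1 := by
    refine isBigO_uniformlyOn_of_le (a := fun N => ε N ^ 1) (C := B) (hB.mono fun N hN t ht => ?_)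
    rw [pow_one]
    exact (hN.1 _ (floor_le ht)).2
  refine ((h1.trans (tr.isBigO_eps_pow 1 1 le_rfl)).add
    ((tr.init_isBigO hf).trans (tr.isBigO_delta 1))).congr_left fun q => ?_
  ring

theorem mix_sub_mix_mean (tr : S.IsTraining T wt ε δ 𝒞 m ξ θ) {f : E → ℝ} (hf : f ∈ 𝒞) (i : ι) :
    (fun q => S.mix (meanPath θ q) (meanPath θ q) f i - S.mix m m f i) =O[uniformlyOn T]
      fun q => ε q.1 ^ 1 + δ q.1 :=
  tr.mix_sub_mix (p := fun _ => m) (a := fun N => ε N ^ 1 + δ N)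
    (fun _ _ => isBigO_const_const _ one_ne_zero _)
    (fun _ hf => tr.meanPath_sub_mean hf) hf i

/-- At this stage the initial output counts as an error, hence `b = 0` and the term `δ / ε`. Only
`outPath_sub_second` resolves it. -/
theorem outPath_sub_limit (tr : S.IsTraining T wt ε δ 𝒞 m ξ θ) (hh : Continuous h)
    (hh_eq : ∀ t ∈ Icc 0 T, ∀ k, h t k = S.lin wt m h t (S.F k)) (k : ι) :
    (fun q => outPath S ε θ k q - h q.2 k) =O[uniformlyOn T]
      fun q => ε q.1 ^ 1 + δ q.1 / ε q.1 := by
  refine tr.outPath_sub_isBigO (P := fun k q => h q.2 k)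
    (R := fun k q => wt * ∑ i, (S.y i - h q.2 i) * S.mix m m (S.F k) i)
    (a := fun N => ε N ^ 1 + δ N / ε N) (b := fun _ _ => 0)
    ((tr.isBigO_delta 1).trans (tr.isBigO_scale_of_le 1))
    (fun k N => (continuous_apply k).comp hh) (fun k N => by fun_prop)
    (fun k N t ht => by rw [zero_add]; exact hh_eq t ht k) (fun k => ?_) (fun k => ?_) k
  · simpa using (tr.out_init_isBigO k).trans (tr.isBigO_delta_div 1)
  · have h1 : ∀ i, (fun q => (S.y i - outPath S ε θ i q) *
        (S.mix (meanPath θ q) (meanPath θ q) (S.F k) i - S.mix m m (S.F k) i))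
        =O[uniformlyOn T] fun q => ε q.1 ^ 1 + δ q.1 / ε q.1 := fun i =>
      isBigO_const_mul_bounded ((isBigO_const_const _ one_ne_zero _).sub (tr.outPath_isBigO_one i))
        ((tr.mix_sub_mix_mean (tr.F_mem k) i).trans (tr.isBigO_scale_of_le 1))
    refine (isBigO_sum_wt (a := fun N => ε N ^ 1 + δ N / ε N) (s := Finset.univ) wt h1).congr_left
      fun q => ?_
    simp only [driftPath, Finset.mul_sum, ← Finset.sum_add_distrib, ← Finset.sum_sub_distrib]
    exact Finset.sum_congr rfl fun i _ => by ring

/-- By `outPath_sub_limit` the drift is known up to `ε + δ / ε`; the factor `ε` before its integral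
makes this `ε ^ 2 + δ`. -/
theorem meanPath_sub_lin (tr : S.IsTraining T wt ε δ 𝒞 m ξ θ) (hh : Continuous h)
    (hh_eq : ∀ t ∈ Icc 0 T, ∀ k, h t k = S.lin wt m h t (S.F k)) {f : E → ℝ} (hf : f ∈ 𝒞) :
    (fun q => meanPath θ q f - (m f + ε q.1 * S.lin wt m h q.2 f)) =O[uniformlyOn T]
      fun q => ε q.1 ^ 2 + δ q.1 := by
  have h1 : ∀ i, (fun q => (S.y i - outPath S ε θ i q) *
      (S.mix (meanPath θ q) (meanPath θ q) f i - S.mix m m f i) -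
      (outPath S ε θ i q - h q.2 i) * S.mix m m f i)
      =O[uniformlyOn T] fun q => ε q.1 ^ 1 + δ q.1 / ε q.1 := fun i => by
    refine IsBigO.sub (isBigO_const_mul_bounded
      ((isBigO_const_const _ one_ne_zero _).sub (tr.outPath_isBigO_one i))
      ((tr.mix_sub_mix_mean hf i).trans (tr.isBigO_scale_of_le 1))) ?_
    simp only [mul_comm _ (S.mix m m f i)]
    exact (tr.outPath_sub_limit hh hh_eq i).const_mul_left _
  have h2 : (fun q => driftPath S wt ε θ f q - wt * ∑ i, (S.y i - h q.2 i) * S.mix m m f i)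
      =O[uniformlyOn T] fun q => ε q.1 ^ 1 + δ q.1 / ε q.1 := by
    refine (isBigO_sum_wt (a := fun N => ε N ^ 1 + δ N / ε N) (s := Finset.univ) wt h1).congr_left
      fun q => ?_
    simp only [driftPath, Finset.mul_sum, ← Finset.sum_sub_distrib]
    exact Finset.sum_congr rfl fun i _ => by ring
  have h3 := tr.isBigO_eps_mul_scale 1
    (isBigO_integral (a := fun N => ε N ^ 1 + δ N / ε N) h2)
  refine (((tr.meanPath_sub_integral hf).trans (tr.isBigO_delta 2)).add h3).congr_left fun q => ?_
  rw [intervalIntegral.integral_sub (intervalIntegrable_driftPath f _ _ _)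
    (Continuous.intervalIntegrable (by fun_prop) _ _)]
  rw [lin]
  ring

theorem mix_add (S : ParticleSystem E ι α) (μ ν μ' ν' : (E → ℝ) → ℝ) (c : ℝ) (f : E → ℝ) (i : ι) :
    S.mix (fun g => μ g + c * μ' g) (fun g => ν g + c * ν' g) f i =
      S.mix μ ν f i + c * (S.mix μ ν' f i + S.mix μ' ν f i) + c ^ 2 * S.mix μ' ν' f i := by
  simp only [mix, Finset.mul_sum, ← Finset.sum_add_distrib]
  exact Finset.sum_congr rfl fun a _ => by ring

theorem mix_add_left (S : ParticleSystem E ι α) (μ ν μ' : (E → ℝ) → ℝ) (c : ℝ) (f : E → ℝ) (i : ι) :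
    S.mix (fun g => μ g + c * μ' g) ν f i = S.mix μ ν f i + c * S.mix μ' ν f i := by
  simp only [mix, Finset.mul_sum, ← Finset.sum_add_distrib]
  exact Finset.sum_congr rfl fun a _ => by ring

theorem mix_add_right (S : ParticleSystem E ι α) (μ ν ν' : (E → ℝ) → ℝ) (c : ℝ) (f : E → ℝ) (i : ι) :
    S.mix μ (fun g => ν g + c * ν' g) f i = S.mix μ ν f i + c * S.mix μ ν' f i := by
  simp only [mix, Finset.mul_sum, ← Finset.sum_add_distrib]
  exact Finset.sum_congr rfl fun a _ => by ring

theorem lin_isBigO_one (hh : Continuous h) (f : E → ℝ) :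
    (fun q : ℕ × ℝ => S.lin wt m h q.2 f) =O[uniformlyOn T] fun _ => (1 : ℝ) :=
  isBigO_one_of_continuous (S.continuous_lin wt m hh f)

theorem quad_isBigO_one (hh : Continuous h) (hK : Continuous K) (f : E → ℝ) :
    (fun q : ℕ × ℝ => S.quad wt m h K q.2 f) =O[uniformlyOn T] fun _ => (1 : ℝ) :=
  isBigO_one_of_continuous (S.continuous_quad wt m hh hK f)

theorem eps_isBigO_one (tr : S.IsTraining T wt ε δ 𝒞 m ξ θ) :
    (fun q : ℕ × ℝ => ε q.1) =O[uniformlyOn T] fun _ => (1 : ℝ) := by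
  refine isBigO_scale (a := ε) (b := fun _ => 1) (C := 1) ?_
  filter_upwards [tr.eps_pos, tr.eventually_eps_le_one] with N h1 h2
  exact ⟨h1.le, by simpa using h2⟩

/-- The first order variation of the mixed term. -/
noncomputable def mixLin (S : ParticleSystem E ι α) (wt : ℝ) (m : (E → ℝ) → ℝ) (h : ℝ → ι → ℝ)
    (t : ℝ) (f : E → ℝ) (i : ι) : ℝ :=
  S.mix m (S.lin wt m h t) f i + S.mix (S.lin wt m h t) m f i

theorem mix_sub_mix_lin (tr : S.IsTraining T wt ε δ 𝒞 m ξ θ) (hh : Continuous h)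
    (hh_eq : ∀ t ∈ Icc 0 T, ∀ k, h t k = S.lin wt m h t (S.F k)) {f : E → ℝ} (hf : f ∈ 𝒞)
    (i : ι) :
    (fun q => S.mix (meanPath θ q) (meanPath θ q) f i -
      (S.mix m m f i + ε q.1 * mixLin S wt m h q.2 f i)) =O[uniformlyOn T]
      fun q => ε q.1 ^ 2 + δ q.1 := by
  have hl := lin_isBigO_one (S := S) (wt := wt) (m := m) (T := T) hh
  have h1 := tr.mix_sub_mix (p := fun q g => m g + ε q.1 * S.lin wt m h q.2 g)
    (a := fun N => ε N ^ 2 + δ N)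
    (fun g _ => (isBigO_const_const _ one_ne_zero _).add
      (by simpa using tr.eps_isBigO_one.mul (hl g)))
    (fun _ hf => tr.meanPath_sub_lin hh hh_eq hf) hf i
  have h2 : (fun q : ℕ × ℝ => S.mix (S.lin wt m h q.2) (S.lin wt m h q.2) f i * ε q.1 ^ 2)
      =O[uniformlyOn T] fun q => ε q.1 ^ 2 + δ q.1 :=
    isBigO_const_mul_bounded (isBigO_mix hl hl f i) (tr.isBigO_eps_pow 2 2 le_rfl)
  refine (h1.add h2).congr_left fun q => ?_
  rw [mix_add, mixLin]
  ring

/-- The drift is correct up to `ε ^ 2 + δ`, because output error and first order error of `mix`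
appear as a product. The larger `δ / ε` comes only from the neglected initial output. -/
theorem outPath_sub_first (tr : S.IsTraining T wt ε δ 𝒞 m ξ θ) (hh : Continuous h)
    (hK : Continuous K) (hh_eq : ∀ t ∈ Icc 0 T, ∀ k, h t k = S.lin wt m h t (S.F k))
    (hK_eq : ∀ t ∈ Icc 0 T, ∀ k, K t k = S.quad wt m h K t (S.F k)) (k : ι) :
    (fun q => outPath S ε θ k q - (h q.2 k + ε q.1 * K q.2 k)) =O[uniformlyOn T]
      fun q => ε q.1 ^ 2 + δ q.1 / ε q.1 := by
  have hcm : ∀ f i, Continuous fun t => mixLin S wt m h t f i := fun f i =>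
    (S.continuous_mix (μ := fun _ => m) (fun _ => continuous_const) (S.continuous_lin wt m hh) f i).add
      (S.continuous_mix (ν := fun _ => m) (S.continuous_lin wt m hh) (fun _ => continuous_const) f i)
  have hR1 : ∀ k, Continuous fun s => wt * ∑ i, (S.y i - h s i) * S.mix m m (S.F k) i :=
    fun k => by fun_prop
  have hR2 : ∀ k, Continuous fun s => wt * ∑ i, ((S.y i - h s i) * mixLin S wt m h s (S.F k) i -
      K s i * S.mix m m (S.F k) i) := fun k => by
    have := hcm (S.F k)
    fun_prop
  refine tr.outPath_sub_isBigO (P := fun k q => h q.2 k + ε q.1 * K q.2 k)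
    (R := fun k q => wt * ∑ i, (S.y i - h q.2 i) * S.mix m m (S.F k) i +
      ε q.1 * (wt * ∑ i, ((S.y i - h q.2 i) * mixLin S wt m h q.2 (S.F k) i -
      K q.2 i * S.mix m m (S.F k) i)))
    (a := fun N => ε N ^ 2 + δ N / ε N) (b := fun _ _ => 0)
    ((tr.isBigO_delta 2).trans (tr.isBigO_scale_of_le 2))
    (fun k N => by fun_prop)
    (fun k N => (hR1 k).fun_add ((hR2 k).const_mul (ε N)))
    (fun k N t ht => ?_) (fun k => ?_) (fun k => ?_) k
  · dsimp only
    rw [intervalIntegral.integral_add ((hR1 k).intervalIntegrable _ _)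
      (((hR2 k).const_mul _).intervalIntegrable _ _), intervalIntegral.integral_const_mul (ε N),
      zero_add, hh_eq t ht k, hK_eq t ht k]
    rfl
  · simpa using (tr.out_init_isBigO k).trans (tr.isBigO_delta_div 2)
  · have h1 : ∀ i, (fun q => (S.y i - h q.2 i) *
        (S.mix (meanPath θ q) (meanPath θ q) (S.F k) i -
          (S.mix m m (S.F k) i + ε q.1 * mixLin S wt m h q.2 (S.F k) i)) -
        (outPath S ε θ i q - h q.2 i) *
        (S.mix (meanPath θ q) (meanPath θ q) (S.F k) i - S.mix m m (S.F k) i))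
        =O[uniformlyOn T] fun q => ε q.1 ^ 2 + δ q.1 / ε q.1 := fun i => by
      refine (IsBigO.sub ?_ ?_).trans (tr.isBigO_scale_of_le 2)
      · exact isBigO_const_mul_bounded (isBigO_one_of_continuous (c := fun t => S.y i - h t i)
          (by fun_prop)) (tr.mix_sub_mix_lin hh hh_eq (tr.F_mem k) i)
      · exact tr.isBigO_mul_scale 1 (tr.outPath_sub_limit hh hh_eq i)
          (by simpa using tr.mix_sub_mix_mean (tr.F_mem k) i)
    refine (isBigO_sum_wt (a := fun N => ε N ^ 2 + δ N / ε N) (s := Finset.univ) wt h1).congr_left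
      fun q => ?_
    simp only [driftPath, Finset.mul_sum, ← Finset.sum_add_distrib, ← Finset.sum_sub_distrib]
    exact Finset.sum_congr rfl fun i _ => by ring

/-- The mechanism of `meanPath_sub_lin` one order higher, with `outPath_sub_first` as input. -/
theorem meanPath_sub_quad (tr : S.IsTraining T wt ε δ 𝒞 m ξ θ) (hh : Continuous h)
    (hK : Continuous K) (hh_eq : ∀ t ∈ Icc 0 T, ∀ k, h t k = S.lin wt m h t (S.F k))
    (hK_eq : ∀ t ∈ Icc 0 T, ∀ k, K t k = S.quad wt m h K t (S.F k)) {f : E → ℝ} (hf : f ∈ 𝒞) :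
    (fun q => meanPath θ q f - (m f + ε q.1 * S.lin wt m h q.2 f +
      ε q.1 ^ 2 * S.quad wt m h K q.2 f)) =O[uniformlyOn T] fun q => ε q.1 ^ 3 + δ q.1 := by
  have hcm : ∀ i, Continuous fun t => mixLin S wt m h t f i := fun i =>
    (S.continuous_mix (μ := fun _ => m) (fun _ => continuous_const) (S.continuous_lin wt m hh) f i).add
      (S.continuous_mix (ν := fun _ => m) (S.continuous_lin wt m hh) (fun _ => continuous_const) f i)
  have hR1 : Continuous fun s => wt * ∑ i, (S.y i - h s i) * S.mix m m f i := by fun_prop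
  have hR2 : Continuous fun s => wt * ∑ i, ((S.y i - h s i) * mixLin S wt m h s f i -
      K s i * S.mix m m f i) := by fun_prop
  have h1 : ∀ i, (fun q => (S.y i - h q.2 i) *
      (S.mix (meanPath θ q) (meanPath θ q) f i -
        (S.mix m m f i + ε q.1 * mixLin S wt m h q.2 f i)) -
      (outPath S ε θ i q - h q.2 i) *
      (S.mix (meanPath θ q) (meanPath θ q) f i - S.mix m m f i) -
      S.mix m m f i * (outPath S ε θ i q - (h q.2 i + ε q.1 * K q.2 i)))
      =O[uniformlyOn T] fun q => ε q.1 ^ 2 + δ q.1 / ε q.1 := fun i => by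
    refine IsBigO.sub ((IsBigO.sub ?_ ?_).trans (tr.isBigO_scale_of_le 2)) ?_
    · exact isBigO_const_mul_bounded (isBigO_one_of_continuous (c := fun t => S.y i - h t i)
        (by fun_prop)) (tr.mix_sub_mix_lin hh hh_eq hf i)
    · exact tr.isBigO_mul_scale 1 (tr.outPath_sub_limit hh hh_eq i)
        (by simpa using tr.mix_sub_mix_mean hf i)
    · exact (tr.outPath_sub_first hh hK hh_eq hK_eq i).const_mul_left _
  have h2 : (fun q => driftPath S wt ε θ f q - (wt * ∑ i, (S.y i - h q.2 i) * S.mix m m f i +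
      ε q.1 * (wt * ∑ i, ((S.y i - h q.2 i) * mixLin S wt m h q.2 f i - K q.2 i * S.mix m m f i))))
      =O[uniformlyOn T] fun q => ε q.1 ^ 2 + δ q.1 / ε q.1 := by
    refine (isBigO_sum_wt (a := fun N => ε N ^ 2 + δ N / ε N) (s := Finset.univ) wt h1).congr_left
      fun q => ?_
    simp only [driftPath, Finset.mul_sum, ← Finset.sum_add_distrib, ← Finset.sum_sub_distrib]
    exact Finset.sum_congr rfl fun i _ => by ring
  have h3 := tr.isBigO_eps_mul_scale 2
    (isBigO_integral (a := fun N => ε N ^ 2 + δ N / ε N) h2)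
  refine (((tr.meanPath_sub_integral hf).trans (tr.isBigO_delta 3)).add h3).congr_left fun q => ?_
  have i1 := hR1.intervalIntegrable (μ := volume) 0 q.2
  have i2 := (hR2.const_mul (ε q.1)).intervalIntegrable (μ := volume) 0 q.2
  have hI := intervalIntegral.integral_sub
    (intervalIntegrable_driftPath (S := S) (wt := wt) (ε := ε) (θ := θ) f q.1 0 q.2) (i1.add i2)
  rw [hI, intervalIntegral.integral_add i1 i2, intervalIntegral.integral_const_mul (ε q.1)]
  change _ - ε q.1 * _ + ε q.1 * (_ - (S.lin wt m h q.2 f + ε q.1 * S.quad wt m h K q.2 f)) = _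
  ring

/-- The second order variation of the mixed term. -/
noncomputable def mixQuad (S : ParticleSystem E ι α) (wt : ℝ) (m : (E → ℝ) → ℝ) (h K : ℝ → ι → ℝ)
    (t : ℝ) (f : E → ℝ) (i : ι) : ℝ :=
  S.mix m (S.quad wt m h K t) f i + S.mix (S.quad wt m h K t) m f i +
    S.mix (S.lin wt m h t) (S.lin wt m h t) f i

theorem mix_sub_mix_quad (tr : S.IsTraining T wt ε δ 𝒞 m ξ θ) (hh : Continuous h)
    (hK : Continuous K) (hh_eq : ∀ t ∈ Icc 0 T, ∀ k, h t k = S.lin wt m h t (S.F k))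
    (hK_eq : ∀ t ∈ Icc 0 T, ∀ k, K t k = S.quad wt m h K t (S.F k)) {f : E → ℝ} (hf : f ∈ 𝒞)
    (i : ι) :
    (fun q => S.mix (meanPath θ q) (meanPath θ q) f i - (S.mix m m f i +
      ε q.1 * mixLin S wt m h q.2 f i + ε q.1 ^ 2 * mixQuad S wt m h K q.2 f i))
      =O[uniformlyOn T] fun q => ε q.1 ^ 3 + δ q.1 := by
  have hl := lin_isBigO_one (S := S) (wt := wt) (m := m) (T := T) hh
  have hq := quad_isBigO_one (S := S) (wt := wt) (m := m) (T := T) hh hK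
  have he2 : (fun q : ℕ × ℝ => ε q.1 ^ 2) =O[uniformlyOn T] fun _ => (1 : ℝ) := by
    simpa using tr.eps_isBigO_one.pow 2
  have h1 := tr.mix_sub_mix (p := fun q g => m g + ε q.1 * S.lin wt m h q.2 g +
      ε q.1 ^ 2 * S.quad wt m h K q.2 g) (a := fun N => ε N ^ 3 + δ N)
    (fun g _ => ((isBigO_const_const _ one_ne_zero _).add
      (by simpa using tr.eps_isBigO_one.mul (hl g))).add (by simpa using he2.mul (hq g)))
    (fun _ hf => tr.meanPath_sub_quad hh hK hh_eq hK_eq hf) hf i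
  -- Multiplying out the quadratic `mix` leaves cross terms of order `ε ^ 3` here and `ε ^ 4` below,
  -- which are discarded.
  have h2 : (fun q : ℕ × ℝ => (S.mix (S.lin wt m h q.2) (S.quad wt m h K q.2) f i +
      S.mix (S.quad wt m h K q.2) (S.lin wt m h q.2) f i) * ε q.1 ^ 3)
      =O[uniformlyOn T] fun q => ε q.1 ^ 3 + δ q.1 :=
    isBigO_const_mul_bounded ((isBigO_mix hl hq f i).add (isBigO_mix hq hl f i))
      (tr.isBigO_eps_pow 3 3 le_rfl)
  have h3 : (fun q : ℕ × ℝ => S.mix (S.quad wt m h K q.2) (S.quad wt m h K q.2) f i * ε q.1 ^ 4)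
      =O[uniformlyOn T] fun q => ε q.1 ^ 3 + δ q.1 :=
    isBigO_const_mul_bounded (isBigO_mix hq hq f i) (tr.isBigO_eps_pow 3 4 (by norm_num))
  refine ((h1.add h2).add h3).congr_left fun q => ?_
  rw [mix_add, mix_add, mix_add_left, mix_add_right, mixLin, mixQuad]
  ring

/-- The third order expansion of the outputs. -/
theorem outPath_sub_second (tr : S.IsTraining T wt ε δ 𝒞 m ξ θ) (hh : Continuous h)
    (hK : Continuous K) (hU : Continuous U) (hV : ∀ N, Continuous (V N))
    (hh_eq : ∀ t ∈ Icc 0 T, ∀ k, h t k = S.lin wt m h t (S.F k))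
    (hK_eq : ∀ t ∈ Icc 0 T, ∀ k, K t k = S.quad wt m h K t (S.F k))
    (hU_eq : ∀ t ∈ Icc 0 T, ∀ k, U t k = ∫ s in (0 : ℝ)..t, wt * ∑ i,
      (S.forcing wt m h K s (S.F k) i - U s i * S.mix m m (S.F k) i))
    (hV_eq : ∀ N, ∀ t ∈ Icc 0 T, ∀ k, V N t k = S.out (ε N) (θ N 0) k -
      ∫ s in (0 : ℝ)..t, wt * ∑ i, V N s i * S.mix m m (S.F k) i) (k : ι) :
    (fun q => outPath S ε θ k q - (h q.2 k + ε q.1 * K q.2 k + ε q.1 ^ 2 * U q.2 k + V q.1 q.2 k))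
      =O[uniformlyOn T] fun q => ε q.1 ^ 3 + δ q.1 := by
  have hcm : ∀ f i, Continuous fun t => mixLin S wt m h t f i := fun f i =>
    (S.continuous_mix (μ := fun _ => m) (fun _ => continuous_const) (S.continuous_lin wt m hh) f i).add
      (S.continuous_mix (ν := fun _ => m) (S.continuous_lin wt m hh) (fun _ => continuous_const) f i)
  have hcf := S.continuous_forcing wt m hh hK
  have hR1 : ∀ k, Continuous fun s => wt * ∑ i, (S.y i - h s i) * S.mix m m (S.F k) i :=
    fun k => by fun_prop
  have hR2 : ∀ k, Continuous fun s => wt * ∑ i, ((S.y i - h s i) * mixLin S wt m h s (S.F k) i -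
      K s i * S.mix m m (S.F k) i) := fun k => by
    have := hcm (S.F k)
    fun_prop
  have hR3 : ∀ k, Continuous fun s => wt * ∑ i, (S.forcing wt m h K s (S.F k) i -
      U s i * S.mix m m (S.F k) i) := fun k => by
    have := hcf (S.F k)
    fun_prop
  have hR4 : ∀ k N, Continuous fun s => wt * ∑ i, V N s i * S.mix m m (S.F k) i := fun k N => by
    have := hV N
    fun_prop
  -- Now `b` is the exact initial output, carried along by `V`, so nothing of order `δ / ε` remains
  -- in the initial condition.
  refine tr.outPath_sub_isBigO
    (P := fun k q => h q.2 k + ε q.1 * K q.2 k + ε q.1 ^ 2 * U q.2 k + V q.1 q.2 k)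
    (R := fun k q => wt * ∑ i, (S.y i - h q.2 i) * S.mix m m (S.F k) i +
      ε q.1 * (wt * ∑ i, ((S.y i - h q.2 i) * mixLin S wt m h q.2 (S.F k) i -
      K q.2 i * S.mix m m (S.F k) i)) + ε q.1 ^ 2 * (wt * ∑ i, (S.forcing wt m h K q.2 (S.F k) i -
      U q.2 i * S.mix m m (S.F k) i)) - wt * ∑ i, V q.1 q.2 i * S.mix m m (S.F k) i)
    (a := fun N => ε N ^ 3 + δ N) (b := fun k N => S.out (ε N) (θ N 0) k)
    (tr.isBigO_delta 3)
    (fun k N => by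
      have := hV N
      dsimp only
      fun_prop)
    (fun k N => (((hR1 k).fun_add ((hR2 k).const_mul (ε N))).fun_add
      ((hR3 k).const_mul (ε N ^ 2))).fun_sub (hR4 k N))
    (fun k N t ht => ?_) (fun k => ?_) (fun k => ?_) k
  · have i1 := (hR1 k).intervalIntegrable (μ := volume) 0 t
    have i2 := ((hR2 k).const_mul (ε N)).intervalIntegrable (μ := volume) 0 t
    have i3 := ((hR3 k).const_mul (ε N ^ 2)).intervalIntegrable (μ := volume) 0 t
    have i4 := (hR4 k N).intervalIntegrable (μ := volume) 0 t
    dsimp only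
    rw [intervalIntegral.integral_sub ((i1.add i2).add i3) i4,
      intervalIntegral.integral_add (i1.add i2) i3, intervalIntegral.integral_add i1 i2,
      intervalIntegral.integral_const_mul (ε N), intervalIntegral.integral_const_mul (ε N ^ 2),
      hh_eq t ht k, hK_eq t ht k, hU_eq t ht k, hV_eq N t ht k]
    change S.lin wt m h t (S.F k) + ε N * S.quad wt m h K t (S.F k) + _ + _ = _ + (S.lin wt m h t (S.F k) +
      ε N * S.quad wt m h K t (S.F k) + _ - _)
    ring
  · simpa using isBigO_zero _ _
  -- Three remainders: `y - h` times the third order error of `mix`; `ε K` times its second order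
  -- error; and the output error, which contains `V`, times its first order error. In the last
  -- product `δ / ε` meets `ε + δ`.
  · have h1 : ∀ i, (fun q => (S.y i - h q.2 i) *
        (S.mix (meanPath θ q) (meanPath θ q) (S.F k) i - (S.mix m m (S.F k) i +
          ε q.1 * mixLin S wt m h q.2 (S.F k) i + ε q.1 ^ 2 * mixQuad S wt m h K q.2 (S.F k) i)) -
        K q.2 i * (ε q.1 * (S.mix (meanPath θ q) (meanPath θ q) (S.F k) i -
          (S.mix m m (S.F k) i + ε q.1 * mixLin S wt m h q.2 (S.F k) i))) -
        (outPath S ε θ i q - (h q.2 i + ε q.1 * K q.2 i)) *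
        (S.mix (meanPath θ q) (meanPath θ q) (S.F k) i - S.mix m m (S.F k) i))
        =O[uniformlyOn T] fun q => ε q.1 ^ 3 + δ q.1 := fun i => by
      refine IsBigO.sub (IsBigO.sub ?_ ?_) ?_
      · exact isBigO_const_mul_bounded (isBigO_one_of_continuous (c := fun t => S.y i - h t i)
          (by fun_prop)) (tr.mix_sub_mix_quad hh hK hh_eq hK_eq (tr.F_mem k) i)
      · refine isBigO_const_mul_bounded (isBigO_one_of_continuous (c := fun t => K t i)
          (by fun_prop)) (tr.isBigO_eps_mul_scale 2 ?_)
        exact (tr.mix_sub_mix_lin hh hh_eq (tr.F_mem k) i).trans (tr.isBigO_scale_of_le 2)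
      · exact tr.isBigO_mul_scale 2 (tr.outPath_sub_first hh hK hh_eq hK_eq i)
          (by simpa using tr.mix_sub_mix_mean (tr.F_mem k) i)
    refine (isBigO_sum_wt (a := fun N => ε N ^ 3 + δ N) (s := Finset.univ) wt h1).congr_left
      fun q => ?_
    simp only [driftPath, Finset.mul_sum, ← Finset.sum_add_distrib, ← Finset.sum_sub_distrib]
    refine Finset.sum_congr rfl fun i _ => ?_
    simp only [forcing, mixQuad, mixLin]
    ring

end ParticleSystem.IsTraining

section SmoothCoefficients

open scoped ContDiff

/-! ### Linear differential equations with constant coefficients -/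

section LinearODE

variable {V : Type*} [NormedAddCommGroup V] [NormedSpace ℝ V] [CompleteSpace V]

/-- The solution `ψ` of `ψ' = F - A ψ` with initial value `ψ₀`. -/
noncomputable def linearODE (A : V →L[ℝ] V) (ψ₀ : V) (F : ℝ → V) (t : ℝ) : V :=
  NormedSpace.exp (t • -A) (ψ₀ + ∫ s in (0 : ℝ)..t, NormedSpace.exp (s • A) (F s))

theorem continuous_exp_smul {X : Type*} [TopologicalSpace X] {A : X → V →L[ℝ] V} {t : X → ℝ}
    (hA : Continuous A) (ht : Continuous t) : Continuous fun x => NormedSpace.exp (t x • A x) := by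
  let : NormedAlgebra ℚ (V →L[ℝ] V) := NormedAlgebra.restrictScalars ℚ ℝ _
  exact NormedSpace.exp_continuous.comp (ht.smul hA)

theorem exp_smul_neg_apply_exp_smul (A : V →L[ℝ] V) (t : ℝ) (x : V) :
    NormedSpace.exp (t • -A) (NormedSpace.exp (t • A) x) = x := by
  let : NormedAlgebra ℚ (V →L[ℝ] V) := NormedAlgebra.restrictScalars ℚ ℝ _
  have hc : Commute (t • -A) (t • A) := by
    rw [smul_neg]; exact (Commute.refl _).neg_left
  have := NormedSpace.exp_add_of_commute hc
  rw [smul_neg, neg_add_cancel, NormedSpace.exp_zero] at this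
  rw [smul_neg, ← mul_apply_eq_comp, ← this]
  rfl

/-- Variation of constants gives the solution in closed form, hence jointly continuous in time and
parameters. This makes the limit path a continuous function of the first layer and of the Gaussian
vector. -/
theorem continuous_linearODE {X : Type*} [TopologicalSpace X] {A : X → V →L[ℝ] V} {ψ₀ : X → V}
    {F : X → ℝ → V} (hA : Continuous A) (hψ₀ : Continuous ψ₀)
    (hF : Continuous (Function.uncurry F)) :
    Continuous fun q : X × ℝ => linearODE (A q.1) (ψ₀ q.1) (F q.1) q.2 := by
  refine (continuous_exp_smul (hA.comp continuous_fst).neg continuous_snd).clm_apply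
    ((hψ₀.comp continuous_fst).add ?_)
  refine intervalIntegral.continuous_parametric_intervalIntegral_of_continuous
    (f := fun (q : X × ℝ) s => NormedSpace.exp (s • A q.1) (F q.1 s)) ?_ continuous_snd
  refine (continuous_exp_smul ((hA.comp continuous_fst).comp continuous_fst)
    continuous_snd).clm_apply ?_
  exact hF.comp (continuous_fst.fst.prodMk continuous_snd)

theorem hasDerivAt_linearODE (A : V →L[ℝ] V) (ψ₀ : V) {F : ℝ → V} (hF : Continuous F) (t : ℝ) :
    HasDerivAt (linearODE A ψ₀ F) (F t - A (linearODE A ψ₀ F t)) t := by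
  have h1 := hasDerivAt_exp_smul_const (-A) t
  have hc : Continuous fun s : ℝ => NormedSpace.exp (s • A) (F s) :=
    (continuous_exp_smul continuous_const continuous_id).clm_apply hF
  have h2 : HasDerivAt (fun t => ψ₀ + ∫ s in (0 : ℝ)..t, NormedSpace.exp (s • A) (F s))
      (NormedSpace.exp (t • A) (F t)) t :=
    (intervalIntegral.integral_hasDerivAt_right (hc.intervalIntegrable _ _)
      (hc.stronglyMeasurableAtFilter _ _) hc.continuousAt).const_add ψ₀
  refine (h1.clm_apply h2).congr_deriv ?_
  rw [exp_smul_neg_apply_exp_smul, add_comm, sub_eq_add_neg]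
  congr 1
  have hcomm : NormedSpace.exp (t • -A) * -A = -A * NormedSpace.exp (t • -A) := by
    let : NormedAlgebra ℚ (V →L[ℝ] V) := NormedAlgebra.restrictScalars ℚ ℝ _
    exact (((Commute.refl (-A)).smul_left t).exp_left).eq
  rw [hcomm]
  rfl

theorem linearODE_eq_integral (A : V →L[ℝ] V) (ψ₀ : V) {F : ℝ → V} (hF : Continuous F) (t : ℝ) :
    linearODE A ψ₀ F t = ψ₀ + ∫ s in (0 : ℝ)..t, (F s - A (linearODE A ψ₀ F s)) := by
  have hc : Continuous (linearODE A ψ₀ F) :=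
    continuous_iff_continuousAt.2 fun t => (hasDerivAt_linearODE A ψ₀ hF t).continuousAt
  have h := intervalIntegral.integral_eq_sub_of_hasDerivAt (a := 0) (b := t)
    (fun s _ => hasDerivAt_linearODE A ψ₀ hF s)
    ((hF.sub (A.continuous.comp hc)).intervalIntegrable _ _)
  rw [h]
  simp [linearODE]

/-- Superposition: the initial value and the source can be scaled independently, as they are by
different powers of N₂ in the expansion. -/
theorem linearODE_smul_add (A : V →L[ℝ] V) (a b : ℝ) (ψ₀ : V) (F : ℝ → V) (t : ℝ) :
    linearODE A (a • ψ₀) (fun s => b • F s) t =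
      a • linearODE A ψ₀ (fun _ => 0) t + b • linearODE A 0 F t := by
  simp only [linearODE, map_smul, intervalIntegral.integral_smul, map_add, map_zero,
    intervalIntegral.integral_zero, add_zero, zero_add]

end LinearODE

/-! ### Functionals that are linear on smooth functions -/

/-- Linearity on the space of smooth functions. -/
structure SmoothLinear {E : Type*} [NormedAddCommGroup E] [NormedSpace ℝ E]
    (ℓ : (E → ℝ) → ℝ) : Prop where
  map_add : ∀ f g, ContDiff ℝ ∞ f → ContDiff ℝ ∞ g → ℓ (fun θ => f θ + g θ) = ℓ f + ℓ g
  map_mul : ∀ (c : ℝ) f, ContDiff ℝ ∞ f → ℓ (fun θ => c * f θ) = c * ℓ f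

namespace SmoothLinear

variable {E : Type*} [NormedAddCommGroup E] [NormedSpace ℝ E] {ℓ : (E → ℝ) → ℝ}

theorem map_zero (h : SmoothLinear ℓ) : ℓ (fun _ => 0) = 0 := by
  simpa using h.map_mul 0 (fun _ => 0) contDiff_const

theorem map_sum (h : SmoothLinear ℓ) {κ : Type*} (s : Finset κ) {f : κ → E → ℝ}
    (hf : ∀ i, ContDiff ℝ ∞ (f i)) : ℓ (fun θ => ∑ i ∈ s, f i θ) = ∑ i ∈ s, ℓ (f i) := by
  classical
  induction s using Finset.induction_on with
  | empty => simpa using h.map_zero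
  | insert a s ha ih =>
    simp only [Finset.sum_insert ha]
    rw [h.map_add _ _ (hf a) (ContDiff.sum fun i _ => hf i), ih]

end SmoothLinear

/-! ### Linearity and continuous dependence of the limiting functionals -/

namespace ParticleSystem

variable {E ι α : Type*} [NormedAddCommGroup E] [NormedSpace ℝ E] [Fintype ι] [Fintype α]
  {S : ParticleSystem E ι α}

theorem contDiff_lie (hv : ∀ i a, ContDiff ℝ ∞ (S.v i a)) {f : E → ℝ} (hf : ContDiff ℝ ∞ f)
    (i : ι) (a : α) : ContDiff ℝ ∞ (S.lie i a f) :=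
  (hf.fderiv_right (m := ∞) (by simp)).clm_apply (hv i a)

theorem lie_add {f g : E → ℝ} (hf : ContDiff ℝ ∞ f) (hg : ContDiff ℝ ∞ g) (i : ι) (a : α) :
    S.lie i a (fun θ => f θ + g θ) = fun θ => S.lie i a f θ + S.lie i a g θ := by
  funext θ
  simp only [lie]
  rw [fderiv_fun_add ((hf.differentiable (by simp)) θ) ((hg.differentiable (by simp)) θ)]
  rfl

theorem lie_mul {f : E → ℝ} (hf : ContDiff ℝ ∞ f) (c : ℝ) (i : ι) (a : α) :
    S.lie i a (fun θ => c * f θ) = fun θ => c * S.lie i a f θ := by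
  funext θ
  simp only [lie]
  rw [fderiv_const_mul ((hf.differentiable (by simp)) θ)]
  rfl

theorem lie_const (c : ℝ) (i : ι) (a : α) : S.lie i a (fun _ => c) = fun _ => 0 := by
  funext θ
  simp [lie]

variable {μ ν : (E → ℝ) → ℝ}

theorem mix_smoothLinear (hv : ∀ i a, ContDiff ℝ ∞ (S.v i a)) (hν : SmoothLinear ν) (i : ι) :
    SmoothLinear fun f => S.mix μ ν f i where
  map_add f g hf hg := by
    simp only [mix, ← Finset.sum_add_distrib]
    refine Finset.sum_congr rfl fun a _ => ?_
    rw [lie_add hf hg, hν.map_add _ _ (contDiff_lie hv hf i a) (contDiff_lie hv hg i a), mul_add]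
  map_mul c f hf := by
    simp only [mix, Finset.mul_sum]
    refine Finset.sum_congr rfl fun a _ => ?_
    rw [lie_mul hf, hν.map_mul _ _ (contDiff_lie hv hf i a), mul_left_comm]

theorem smoothLinear_sum_integral {κ : Type*} [Fintype κ] {c : κ → ℝ → ℝ}
    {ℓ : κ → ℝ → (E → ℝ) → ℝ} (hc : ∀ i, Continuous (c i)) (hℓ : ∀ i s, SmoothLinear (ℓ i s))
    (hcont : ∀ i f, Continuous fun s => ℓ i s f) (wt t : ℝ) :
    SmoothLinear fun f => ∫ s in (0 : ℝ)..t, wt * ∑ i, c i s * ℓ i s f where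
  map_add f g hf hg := by
    rw [← intervalIntegral.integral_add (Continuous.intervalIntegrable (by fun_prop) _ _)
      (Continuous.intervalIntegrable (by fun_prop) _ _)]
    refine intervalIntegral.integral_congr fun s _ => ?_
    simp only [(hℓ _ s).map_add f g hf hg, mul_add, Finset.sum_add_distrib]
  map_mul k f hf := by
    rw [← intervalIntegral.integral_const_mul]
    refine intervalIntegral.integral_congr fun s _ => ?_
    simp only [(hℓ _ s).map_mul k f hf, Finset.mul_sum]
    exact Finset.sum_congr rfl fun i _ => by ring

variable {m : (E → ℝ) → ℝ} {h K : ℝ → ι → ℝ} (wt : ℝ)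

theorem lin_smoothLinear (hv : ∀ i a, ContDiff ℝ ∞ (S.v i a)) (hm : SmoothLinear m)
    (hh : Continuous h) (t : ℝ) : SmoothLinear (S.lin wt m h t) :=
  smoothLinear_sum_integral (c := fun i s => S.y i - h s i) (ℓ := fun i _ f => S.mix m m f i)
    (fun i => by fun_prop) (fun i _ => mix_smoothLinear hv hm i) (fun _ _ => continuous_const) wt t

theorem quad_smoothLinear (hv : ∀ i a, ContDiff ℝ ∞ (S.v i a)) (hm : SmoothLinear m)
    (hh : Continuous h) (hK : Continuous K) (t : ℝ) : SmoothLinear (S.quad wt m h K t) := by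
  -- Each datum contributes three terms; indexing them by `Fin 3` puts the integrand in the form of
  -- a single sum of linear functionals.
  have h1 := smoothLinear_sum_integral (κ := ι × Fin 3) (wt := wt) (t := t)
    (c := fun i s => ![S.y i.1 - h s i.1, S.y i.1 - h s i.1, - K s i.1] i.2)
    (ℓ := fun i s f => ![S.mix m (S.lin wt m h s) f i.1, S.mix (S.lin wt m h s) m f i.1,
      S.mix m m f i.1] i.2) ?_ ?_ ?_
  · convert h1 using 2 with f
    refine intervalIntegral.integral_congr fun s _ => ?_
    rw [Fintype.sum_prod_type]
    congr 1
    refine Finset.sum_congr rfl fun i _ => ?_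
    simp [Fin.sum_univ_three]
    ring
  · rintro ⟨i, j⟩
    fin_cases j <;> simp <;> fun_prop
  · rintro ⟨i, j⟩ s
    fin_cases j
    · exact mix_smoothLinear hv (lin_smoothLinear wt hv hm hh s) i
    · exact mix_smoothLinear hv hm i
    · exact mix_smoothLinear hv hm i
  · rintro ⟨i, j⟩ f
    fin_cases j
    · exact S.continuous_mix (μ := fun _ => m) (fun _ => continuous_const)
        (S.continuous_lin wt m hh) f i
    · exact S.continuous_mix (ν := fun _ => m) (S.continuous_lin wt m hh)
        (fun _ => continuous_const) f i
    · exact continuous_const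

/-- Conservation of mass: the fields annihilate constants. As the field that moves a unit's own
weights has coefficient 1, that coefficient does not vary at any order. -/
theorem lin_const (hm : SmoothLinear m) (c t : ℝ) : S.lin wt m h t (fun _ => c) = 0 := by
  simp [lin, mix, lie_const, hm.map_zero]

theorem quad_const (hm : SmoothLinear m) (c t : ℝ) : S.quad wt m h K t (fun _ => c) = 0 := by
  have h0 : ∀ s, S.lin wt m h s (fun _ => 0) = 0 := lin_const wt hm 0
  simp [quad, mix, lie_const, hm.map_zero, h0]

section Parametric

variable {X : Type*} [TopologicalSpace X] {M : X → (E → ℝ) → ℝ} {H κ : X → ℝ → ι → ℝ}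
  {μ ν : X → (E → ℝ) → ℝ}

theorem continuous_mix_of_smooth (hD : ∀ i a, ContDiff ℝ ∞ (S.D i a))
    (hv : ∀ i a, ContDiff ℝ ∞ (S.v i a))
    (hμ : ∀ f, ContDiff ℝ ∞ f → Continuous fun x => μ x f)
    (hν : ∀ f, ContDiff ℝ ∞ f → Continuous fun x => ν x f) {f : E → ℝ} (hf : ContDiff ℝ ∞ f)
    (i : ι) : Continuous fun x => S.mix (μ x) (ν x) f i :=
  continuous_finsetSum _ fun a _ => (hμ _ (hD i a)).mul (hν _ (contDiff_lie hv hf i a))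

theorem continuous_lin_param (hD : ∀ i a, ContDiff ℝ ∞ (S.D i a))
    (hv : ∀ i a, ContDiff ℝ ∞ (S.v i a))
    (hM : ∀ f, ContDiff ℝ ∞ f → Continuous fun x => M x f)
    (hH : Continuous fun q : X × ℝ => H q.1 q.2) {f : E → ℝ} (hf : ContDiff ℝ ∞ f) :
    Continuous fun q : X × ℝ => S.lin wt (M q.1) (H q.1) q.2 f := by
  refine intervalIntegral.continuous_parametric_intervalIntegral_of_continuous
    (f := fun (q : X × ℝ) s => wt * ∑ i, (S.y i - H q.1 s i) * S.mix (M q.1) (M q.1) f i) ?_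
    continuous_snd
  have h1 := fun i => (continuous_mix_of_smooth hD hv hM hM hf i).comp
    (continuous_fst.fst : Continuous fun q : (X × ℝ) × ℝ => q.1.1)
  have h2 : Continuous fun q : (X × ℝ) × ℝ => H q.1.1 q.2 :=
    hH.comp (continuous_fst.fst.prodMk continuous_snd)
  exact continuous_const.mul (continuous_finsetSum _ fun i _ =>
    (continuous_const.sub ((continuous_apply i).comp h2)).mul (h1 i))

theorem continuous_quad_param (hD : ∀ i a, ContDiff ℝ ∞ (S.D i a))
    (hv : ∀ i a, ContDiff ℝ ∞ (S.v i a))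
    (hM : ∀ f, ContDiff ℝ ∞ f → Continuous fun x => M x f)
    (hH : Continuous fun q : X × ℝ => H q.1 q.2) (hκ : Continuous fun q : X × ℝ => κ q.1 q.2)
    {f : E → ℝ} (hf : ContDiff ℝ ∞ f) :
    Continuous fun q : X × ℝ => S.quad wt (M q.1) (H q.1) (κ q.1) q.2 f := by
  refine intervalIntegral.continuous_parametric_intervalIntegral_of_continuous
    (f := fun (q : X × ℝ) s => wt * ∑ i, ((S.y i - H q.1 s i) *
      (S.mix (M q.1) (S.lin wt (M q.1) (H q.1) s) f i +
        S.mix (S.lin wt (M q.1) (H q.1) s) (M q.1) f i) -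
      κ q.1 s i * S.mix (M q.1) (M q.1) f i)) ?_ continuous_snd
  have hp : Continuous fun q : (X × ℝ) × ℝ => (q.1.1, q.2) :=
    continuous_fst.fst.prodMk continuous_snd
  have h0 : ∀ f, ContDiff ℝ ∞ f → Continuous fun q : (X × ℝ) × ℝ => M q.1.1 f :=
    fun f hf => (hM f hf).comp continuous_fst.fst
  have hl : ∀ f, ContDiff ℝ ∞ f →
      Continuous fun q : (X × ℝ) × ℝ => S.lin wt (M q.1.1) (H q.1.1) q.2 f :=
    fun f hf => (continuous_lin_param wt hD hv hM hH hf).comp hp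
  have h2 : Continuous fun q : (X × ℝ) × ℝ => H q.1.1 q.2 := hH.comp hp
  have h3 : Continuous fun q : (X × ℝ) × ℝ => κ q.1.1 q.2 := hκ.comp hp
  exact continuous_const.mul (continuous_finsetSum _ fun i _ =>
    ((continuous_const.sub ((continuous_apply i).comp h2)).mul
      ((continuous_mix_of_smooth hD hv h0 hl hf i).add
        (continuous_mix_of_smooth hD hv hl h0 hf i))).sub
      (((continuous_apply i).comp h3).mul (continuous_mix_of_smooth hD hv h0 h0 hf i)))

theorem continuous_forcing_param (hD : ∀ i a, ContDiff ℝ ∞ (S.D i a))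
    (hv : ∀ i a, ContDiff ℝ ∞ (S.v i a))
    (hM : ∀ f, ContDiff ℝ ∞ f → Continuous fun x => M x f)
    (hH : Continuous fun q : X × ℝ => H q.1 q.2) (hκ : Continuous fun q : X × ℝ => κ q.1 q.2)
    {f : E → ℝ} (hf : ContDiff ℝ ∞ f) (i : ι) :
    Continuous fun q : X × ℝ => S.forcing wt (M q.1) (H q.1) (κ q.1) q.2 f i := by
  have h0 : ∀ f, ContDiff ℝ ∞ f → Continuous fun q : X × ℝ => M q.1 f :=
    fun f hf => (hM f hf).comp continuous_fst
  have hl := fun f hf => continuous_lin_param (S := S) (f := f) wt hD hv hM hH hf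
  have hq := fun f hf => continuous_quad_param (S := S) (f := f) wt hD hv hM hH hκ hf
  exact ((continuous_const.sub ((continuous_apply i).comp hH)).mul
    (((continuous_mix_of_smooth hD hv h0 hq hf i).add
      (continuous_mix_of_smooth hD hv hq h0 hf i)).add
      (continuous_mix_of_smooth hD hv hl hl hf i))).sub
    (((continuous_apply i).comp hκ).mul ((continuous_mix_of_smooth hD hv h0 hl hf i).add
      (continuous_mix_of_smooth hD hv hl h0 hf i)))

end Parametric

end ParticleSystem

/-! ### The network as a particle system -/

namespace TwoLayerNet

variable {d N₁ M : ℕ} (S : TwoLayerNet d N₁ M)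

/-- The units of the second hidden layer as interacting particles. -/
noncomputable def system : ParticleSystem (UnitParam d N₁) (Fin M) (Option (Fin N₁)) where
  y := S.y
  -- The index `none` moves a unit's own weights (c, w²) with constant coefficient; `some j` moves
  -- the shared weight w^{1,j}, with the mean of D^j over all units as coefficient.
  v i a θ := a.elim
    (S.act (S.Z (S.x i) θ), fun j => 1 / (N₁ : ℝ) ^ (1 - S.γ₁) *
      (θ.1 * deriv S.act (S.Z (S.x i) θ) * S.act (inner ℝ (θ.2.2 j) (S.x i))), 0)
    (fun j => (0, 0, Pi.single j ((1 / (N₁ : ℝ) ^ (1 - S.γ₁)) • S.x i)))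
  D i a := a.elim (fun _ => 1) (fun j => S.D j (S.x i))
  F k θ := θ.1 * S.act (S.Z (S.x k) θ)

/-- The assumptions on the activation function and on the laws of the initial parameters. -/
structure Regular : Prop where
  act_smooth : ContDiff ℝ ∞ S.act
  probC : IsProbabilityMeasure S.lawC
  probW2 : IsProbabilityMeasure S.lawW2
  compactC : ∃ K : Set ℝ, IsCompact K ∧ S.lawC Kᶜ = 0
  compactW2 : ∃ K : Set ℝ, IsCompact K ∧ S.lawW2 Kᶜ = 0
  meanC : ∫ c, c ∂S.lawC = 0

variable {S}

theorem contDiff_deriv_act (hS : ContDiff ℝ ∞ S.act) : ContDiff ℝ ∞ (deriv S.act) :=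
  (contDiff_infty_iff_deriv.1 hS).2

theorem contDiff_Z (hS : ContDiff ℝ ∞ S.act) (x : EuclideanSpace ℝ (Fin d)) :
    ContDiff ℝ ∞ (S.Z x) := by
  unfold Z
  refine contDiff_const.mul (ContDiff.sum fun j _ => ContDiff.mul (by fun_prop) ?_)
  exact hS.comp (ContDiff.inner ℝ (by fun_prop) contDiff_const)

theorem contDiff_act_inner (hS : ContDiff ℝ ∞ S.act) (j : Fin N₁) (x : EuclideanSpace ℝ (Fin d)) :
    ContDiff ℝ ∞ fun θ : UnitParam d N₁ => S.act (inner ℝ (θ.2.2 j) x) :=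
  hS.comp (ContDiff.inner ℝ (by fun_prop) contDiff_const)

theorem contDiff_deriv_act_inner (hS : ContDiff ℝ ∞ S.act) (j : Fin N₁)
    (x : EuclideanSpace ℝ (Fin d)) :
    ContDiff ℝ ∞ fun θ : UnitParam d N₁ => deriv S.act (inner ℝ (θ.2.2 j) x) :=
  (contDiff_deriv_act hS).comp (ContDiff.inner ℝ (by fun_prop) contDiff_const)

theorem contDiff_act_Z (hS : ContDiff ℝ ∞ S.act) (x : EuclideanSpace ℝ (Fin d)) :
    ContDiff ℝ ∞ fun θ => S.act (S.Z x θ) := hS.comp (contDiff_Z hS x)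

theorem contDiff_deriv_act_Z (hS : ContDiff ℝ ∞ S.act) (x : EuclideanSpace ℝ (Fin d)) :
    ContDiff ℝ ∞ fun θ => deriv S.act (S.Z x θ) := (contDiff_deriv_act hS).comp (contDiff_Z hS x)

theorem contDiff_B1 (hS : ContDiff ℝ ∞ S.act) (x x' : EuclideanSpace ℝ (Fin d)) :
    ContDiff ℝ ∞ (S.B1 x x') := (contDiff_act_Z hS x').mul (contDiff_act_Z hS x)

theorem contDiff_B2 (hS : ContDiff ℝ ∞ S.act) (j : Fin N₁) (x x' : EuclideanSpace ℝ (Fin d)) :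
    ContDiff ℝ ∞ (S.B2 j x x') :=
  (((ContDiff.mul (by fun_prop) (contDiff_deriv_act_Z hS x')).mul
    (contDiff_deriv_act_Z hS x)).mul (contDiff_act_inner hS j x')).mul (contDiff_act_inner hS j x)

theorem contDiff_B3 (hS : ContDiff ℝ ∞ S.act) (j : Fin N₁) (x : EuclideanSpace ℝ (Fin d)) :
    ContDiff ℝ ∞ (S.B3 j x) :=
  (ContDiff.mul (by fun_prop) (contDiff_deriv_act_inner hS j x)).mul (contDiff_deriv_act_Z hS x)

/-- In gradient descent the factor that drives w^{1,j} is the one by which the output responds to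
it. This is why A contains products of two B³ terms. -/
theorem D_eq_B3 (j : Fin N₁) (x : EuclideanSpace ℝ (Fin d)) : S.D j x = S.B3 j x := by
  funext θ
  simp only [D, B3]
  ring

theorem contDiff_system_v (hS : ContDiff ℝ ∞ S.act) (i : Fin M) (a : Option (Fin N₁)) :
    ContDiff ℝ ∞ (S.system.v i a) := by
  cases a with
  | none =>
    refine (contDiff_act_Z hS _).prodMk (ContDiff.prodMk (contDiff_pi.2 fun j => ?_) contDiff_const)
    exact contDiff_const.mul ((contDiff_fst.mul (contDiff_deriv_act_Z hS _)).mul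
      (contDiff_act_inner hS j _))
  | some j => exact contDiff_const

theorem contDiff_system_D (hS : ContDiff ℝ ∞ S.act) (i : Fin M) (a : Option (Fin N₁)) :
    ContDiff ℝ ∞ (S.system.D i a) := by
  cases a with
  | none => exact contDiff_const
  | some j =>
    change ContDiff ℝ ∞ (S.D j (S.x i))
    rw [D_eq_B3]
    exact contDiff_B3 hS j _

theorem contDiff_system_F (hS : ContDiff ℝ ∞ S.act) (k : Fin M) :
    ContDiff ℝ ∞ (S.system.F k) := contDiff_fst.mul (contDiff_act_Z hS _)

/-! ### The derivatives along the vector fields of the system -/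

theorem contDiff_dc {f : UnitParam d N₁ → ℝ} (hf : ContDiff ℝ ∞ f) : ContDiff ℝ ∞ (dc f) :=
  (hf.fderiv_right (m := ∞) (by simp)).clm_apply contDiff_const

theorem contDiff_dw2 {f : UnitParam d N₁ → ℝ} (hf : ContDiff ℝ ∞ f) (j : Fin N₁) :
    ContDiff ℝ ∞ (dw2 j f) :=
  (hf.fderiv_right (m := ∞) (by simp)).clm_apply contDiff_const

theorem contDiff_dw1 {f : UnitParam d N₁ → ℝ} (hf : ContDiff ℝ ∞ f) (j : Fin N₁)
    (x : EuclideanSpace ℝ (Fin d)) : ContDiff ℝ ∞ (dw1 j x f) :=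
  (hf.fderiv_right (m := ∞) (by simp)).clm_apply contDiff_const

theorem contDiff_gradW2 (hS : ContDiff ℝ ∞ S.act) {f : UnitParam d N₁ → ℝ} (hf : ContDiff ℝ ∞ f)
    (x : EuclideanSpace ℝ (Fin d)) : ContDiff ℝ ∞ (S.gradW2 x f) :=
  (contDiff_fst.mul (contDiff_deriv_act_Z hS _)).mul
    (ContDiff.sum fun j _ => (contDiff_act_inner hS j x).mul (contDiff_dw2 hf j))

theorem lie_none (f : UnitParam d N₁ → ℝ) (i : Fin M) :
    S.system.lie i none f = fun θ => dc f θ * S.act (S.Z (S.x i) θ) +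
      1 / (N₁ : ℝ) ^ (1 - S.γ₁) * S.gradW2 (S.x i) f θ := by
  funext θ
  simp only [ParticleSystem.lie, system, Option.elim_none, gradW2, dc, dw2]
  set g : Fin N₁ → ℝ := fun j => 1 / (N₁ : ℝ) ^ (1 - S.γ₁) *
      (θ.1 * deriv S.act (S.Z (S.x i) θ) * S.act (inner ℝ (θ.2.2 j) (S.x i))) with hg
  have h1 : ((S.act (S.Z (S.x i) θ), g, 0) : UnitParam d N₁) =
      S.act (S.Z (S.x i) θ) • ((1, 0, 0) : UnitParam d N₁) +
        ∑ j, g j • ((0, Pi.single j 1, 0) : UnitParam d N₁) := by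
    have h2 : ∑ j, g j • ((0, Pi.single j 1, 0) : UnitParam d N₁) = (0, g, 0) := by
      refine Prod.ext ?_ (Prod.ext ?_ ?_)
      · simp [Prod.fst_sum]
      · rw [Prod.snd_sum, Prod.fst_sum]
        simp only [Prod.smul_mk]
        funext j
        simp [Finset.sum_apply, Pi.single_apply]
      · rw [Prod.snd_sum, Prod.snd_sum]
        simp
    rw [h2]
    simp
  rw [h1, map_add, map_smul, map_sum]
  simp only [map_smul, smul_eq_mul, hg]
  rw [mul_comm, Finset.mul_sum, Finset.mul_sum]
  congr 1
  exact Finset.sum_congr rfl fun j _ => by ring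

theorem lie_some (f : UnitParam d N₁ → ℝ) (i : Fin M) (j : Fin N₁) :
    S.system.lie i (some j) f = fun θ => 1 / (N₁ : ℝ) ^ (1 - S.γ₁) * dw1 j (S.x i) f θ := by
  funext θ
  simp only [ParticleSystem.lie, system, Option.elim_some, dw1]
  have : ((0, 0, Pi.single j ((1 / (N₁ : ℝ) ^ (1 - S.γ₁)) • S.x i)) : UnitParam d N₁) =
      (1 / (N₁ : ℝ) ^ (1 - S.γ₁)) • ((0, 0, Pi.single j (S.x i)) : UnitParam d N₁) := by
    simp [Pi.single_smul]
  rw [this, map_smul, smul_eq_mul]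

theorem fderiv_system_F (hS : ContDiff ℝ ∞ S.act) (k : Fin M) (θ v : UnitParam d N₁) :
    fderiv ℝ (S.system.F k) θ v = v.1 * S.act (S.Z (S.x k) θ) +
      θ.1 * (deriv S.act (S.Z (S.x k) θ) * (1 / (N₁ : ℝ) ^ S.γ₁ *
        ∑ j, (v.2.1 j * S.act (inner ℝ (θ.2.2 j) (S.x k)) +
          θ.2.1 j * (deriv S.act (inner ℝ (θ.2.2 j) (S.x k)) * inner ℝ (v.2.2 j) (S.x k))))) := by
  have hact : ∀ r, HasDerivAt S.act (deriv S.act r) r := fun r =>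
    ((hS.differentiable (by simp)) r).hasDerivAt
  -- Restricting to a line reduces the computation to the chain rule in one variable.
  have h1 := ((((contDiff_system_F hS k).differentiable (by simp)) θ).hasFDerivAt).hasLineDerivAt v
  refine HasDerivAt.unique (h1 : HasDerivAt (fun t : ℝ => S.system.F k (θ + t • v)) _ 0) ?_
  have hin : ∀ j, HasDerivAt (fun t : ℝ => (inner ℝ ((θ + t • v).2.2 j) (S.x k) : ℝ))
      (inner ℝ (v.2.2 j) (S.x k)) 0 := by
    intro j
    have : (fun t : ℝ => (inner ℝ ((θ + t • v).2.2 j) (S.x k) : ℝ)) =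
        fun t => inner ℝ (θ.2.2 j) (S.x k) + t * inner ℝ (v.2.2 j) (S.x k) := by
      funext t
      simp [inner_add_left, real_inner_smul_left]
    rw [this]
    simpa using ((hasDerivAt_id (0 : ℝ)).mul_const (inner ℝ (v.2.2 j) (S.x k) : ℝ)).const_add
      (inner ℝ (θ.2.2 j) (S.x k) : ℝ)
  have hw : ∀ j, HasDerivAt (fun t : ℝ => (θ + t • v).2.1 j) (v.2.1 j) 0 := by
    intro j
    simpa using ((hasDerivAt_id (0 : ℝ)).mul_const (v.2.1 j)).const_add (θ.2.1 j)
  have hc : HasDerivAt (fun t : ℝ => (θ + t • v).1) v.1 0 := by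
    simpa using ((hasDerivAt_id (0 : ℝ)).mul_const v.1).const_add θ.1
  have hZ : HasDerivAt (fun t : ℝ => S.Z (S.x k) (θ + t • v)) (1 / (N₁ : ℝ) ^ S.γ₁ *
        ∑ j, (v.2.1 j * S.act (inner ℝ (θ.2.2 j) (S.x k)) +
          θ.2.1 j * (deriv S.act (inner ℝ (θ.2.2 j) (S.x k)) * inner ℝ (v.2.2 j) (S.x k)))) 0 := by
    refine HasDerivAt.const_mul _ (HasDerivAt.fun_sum fun j _ => ?_)
    have h2 : HasDerivAt (fun t : ℝ => S.act (inner ℝ ((θ + t • v).2.2 j) (S.x k)))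
        (deriv S.act (inner ℝ (θ.2.2 j) (S.x k)) * inner ℝ (v.2.2 j) (S.x k)) 0 := by
      refine HasDerivAt.comp (h₂ := S.act) 0 ?_ (hin j)
      simpa using hact (inner ℝ (θ.2.2 j) (S.x k))
    simpa using (hw j).fun_mul h2
  have hF : HasDerivAt (fun t : ℝ => S.act (S.Z (S.x k) (θ + t • v)))
      (deriv S.act (S.Z (S.x k) θ) * (1 / (N₁ : ℝ) ^ S.γ₁ *
        ∑ j, (v.2.1 j * S.act (inner ℝ (θ.2.2 j) (S.x k)) +
          θ.2.1 j * (deriv S.act (inner ℝ (θ.2.2 j) (S.x k)) * inner ℝ (v.2.2 j) (S.x k))))) 0 := by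
    refine HasDerivAt.comp (h₂ := S.act) 0 ?_ hZ
    simpa using hact (S.Z (S.x k) θ)
  have h3 := hc.fun_mul hF
  rw [zero_smul, add_zero] at h3
  exact h3

/-- The power of N₁ in the vector fields and the one in Z always combine to 1/N₁, which removes γ₁
from A. -/
theorem one_div_rpow_mul (hN₁ : 0 < N₁) :
    1 / (N₁ : ℝ) ^ (1 - S.γ₁) * (1 / (N₁ : ℝ) ^ S.γ₁) = 1 / N₁ := by
  have h : (0 : ℝ) < N₁ := by exact_mod_cast hN₁
  rw [div_mul_div_comm, ← Real.rpow_add h, sub_add_cancel, Real.rpow_one, one_mul]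

theorem lie_none_F (hN₁ : 0 < N₁) (hS : ContDiff ℝ ∞ S.act) (i k : Fin M) :
    S.system.lie i none (S.system.F k) = fun θ => S.B1 (S.x k) (S.x i) θ +
      1 / (N₁ : ℝ) * ∑ j, S.B2 j (S.x k) (S.x i) θ := by
  funext θ
  rw [ParticleSystem.lie, fderiv_system_F hS, ← one_div_rpow_mul (S := S) hN₁]
  simp only [system, Option.elim_none, B1, B2, Pi.zero_apply, inner_zero_left, mul_zero, add_zero,
    Finset.mul_sum]
  congr 1
  exact Finset.sum_congr rfl fun j _ => by ring

theorem lie_some_F (hN₁ : 0 < N₁) (hS : ContDiff ℝ ∞ S.act) (i k : Fin M) (j : Fin N₁) :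
    S.system.lie i (some j) (S.system.F k) = fun θ =>
      (1 / (N₁ : ℝ) * inner ℝ (S.x k) (S.x i)) * S.B3 j (S.x k) θ := by
  funext θ
  rw [ParticleSystem.lie, fderiv_system_F hS, ← one_div_rpow_mul (S := S) hN₁]
  simp only [system, Option.elim_some, B3, Pi.zero_apply, zero_mul, zero_add]
  rw [Finset.sum_eq_single j]
  · rw [Pi.single_eq_same, real_inner_smul_left, real_inner_comm (S.x k) (S.x i)]
    ring
  · intro j' _ hj'
    rw [Pi.single_eq_of_ne hj', inner_zero_left]
    ring
  · simp

/-- The functionals μ and ν are kept general so that one formula serves A (both equal to the mean),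
its first variation (one of them varied) and the quadratic term (both varied). -/
theorem mix_F (hN₁ : 0 < N₁) (hS : ContDiff ℝ ∞ S.act) {μ ν : (UnitParam d N₁ → ℝ) → ℝ}
    (hν : SmoothLinear ν) (i k : Fin M) :
    S.system.mix μ ν (S.system.F k) i =
      μ (fun _ => 1) * (ν (S.B1 (S.x k) (S.x i)) + 1 / (N₁ : ℝ) * ∑ j, ν (S.B2 j (S.x k) (S.x i))) +
      1 / (N₁ : ℝ) * ∑ j, inner ℝ (S.x k) (S.x i) * (ν (S.B3 j (S.x k)) * μ (S.B3 j (S.x i))) := by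
  rw [ParticleSystem.mix, Fintype.sum_option, lie_none_F hN₁ hS]
  have h2 : ContDiff ℝ ∞ fun θ => ∑ j, S.B2 j (S.x k) (S.x i) θ :=
    ContDiff.sum fun j _ => contDiff_B2 hS j _ _
  rw [hν.map_add _ _ (contDiff_B1 hS _ _) (contDiff_const.mul h2), hν.map_mul _ _ h2,
    hν.map_sum _ fun j => contDiff_B2 hS j _ _]
  congr 1
  rw [Finset.mul_sum]
  refine Finset.sum_congr rfl fun j _ => ?_
  rw [lie_some_F hN₁ hS, hν.map_mul _ _ (contDiff_B3 hS _ _)]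
  change μ (S.D j (S.x i)) * _ = _
  rw [D_eq_B3]
  ring

theorem mix_eq (hS : ContDiff ℝ ∞ S.act) {μ ν : (UnitParam d N₁ → ℝ) → ℝ}
    (hν : SmoothLinear ν) {f : UnitParam d N₁ → ℝ} (hf : ContDiff ℝ ∞ f) (i : Fin M) :
    S.system.mix μ ν f i =
      μ (fun _ => 1) * (ν (fun θ => dc f θ * S.act (S.Z (S.x i) θ)) +
        1 / (N₁ : ℝ) ^ (1 - S.γ₁) * ν (S.gradW2 (S.x i) f)) +
      1 / (N₁ : ℝ) ^ (1 - S.γ₁) * ν (fun θ => ∑ j, μ (S.D j (S.x i)) * dw1 j (S.x i) f θ) := by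
  have h1 : ContDiff ℝ ∞ fun θ => dc f θ * S.act (S.Z (S.x i) θ) :=
    (contDiff_dc hf).mul (contDiff_act_Z hS _)
  rw [ParticleSystem.mix, Fintype.sum_option, lie_none,
    hν.map_add _ _ h1 (contDiff_const.mul (contDiff_gradW2 hS hf _)),
    hν.map_mul _ _ (contDiff_gradW2 hS hf _)]
  congr 1
  rw [hν.map_sum _ fun j => contDiff_const.mul (contDiff_dw1 hf j _), Finset.mul_sum]
  refine Finset.sum_congr rfl fun j _ => ?_
  rw [lie_some, hν.map_mul _ _ (contDiff_dw1 hf j _), hν.map_mul _ _ (contDiff_dw1 hf j _)]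
  change μ (S.D j (S.x i)) * _ = _
  ring

end TwoLayerNet

namespace TwoLayerNet

variable {d N₁ M : ℕ} (S : TwoLayerNet d N₁ M)

/-! ### Averages over the initial parameters -/

/-- The joint law of `(C^i, W^{2,1,i}, …, W^{2,N₁,i})` at initialization. -/
noncomputable def initLaw : Measure (ℝ × (Fin N₁ → ℝ)) :=
  S.lawC.prod (Measure.pi fun _ : Fin N₁ => S.lawW2)

/-- The parameters of a unit with first layer weights `w`. -/
def unitParam (w : Fin N₁ → EuclideanSpace ℝ (Fin d)) (u : ℝ × (Fin N₁ → ℝ)) : UnitParam d N₁ :=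
  (u.1, u.2, w)

variable {S}

theorem Regular.isProbabilityMeasure_initLaw (hS : S.Regular) :
    IsProbabilityMeasure S.initLaw := by
  have := hS.probC
  have := hS.probW2
  unfold initLaw
  infer_instance

theorem continuous_unitParam : Continuous fun q : (Fin N₁ → EuclideanSpace ℝ (Fin d)) ×
    (ℝ × (Fin N₁ → ℝ)) => unitParam q.1 q.2 := by
  unfold unitParam
  fun_prop

/-- This moves w from the measure into the integrand, so that dependence on w becomes a matter of
parametric integrals against a fixed law. -/
theorem Regular.γ₀_eq_map (hS : S.Regular) (w : Fin N₁ → EuclideanSpace ℝ (Fin d)) :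
    S.γ₀ w = S.initLaw.map (unitParam w) := by
  have := hS.probC
  have := hS.probW2
  rw [γ₀, initLaw, Measure.prod_dirac]
  conv_lhs => rw [← Measure.map_id (μ := S.lawC)]
  rw [Measure.map_prod_map _ _ measurable_id (by fun_prop)]
  rfl

theorem Regular.mean_eq (hS : S.Regular) (w : Fin N₁ → EuclideanSpace ℝ (Fin d))
    {f : UnitParam d N₁ → ℝ} (hf : Continuous f) :
    S.mean w f = ∫ u, f (unitParam w u) ∂S.initLaw := by
  have hm : Measurable (unitParam (d := d) w) := by unfold unitParam; fun_prop
  rw [mean, hS.γ₀_eq_map, integral_map hm.aemeasurable hf.aestronglyMeasurable]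

theorem exists_norm_le_of_isCompact {E : Type*} [NormedAddCommGroup E] [MeasurableSpace E]
    {μ : Measure E} (h : ∃ K : Set E, IsCompact K ∧ μ Kᶜ = 0) : ∃ R, ∀ᵐ x ∂μ, ‖x‖ ≤ R := by
  obtain ⟨K, hK, h0⟩ := h
  obtain ⟨R, hR⟩ := hK.isBounded.exists_norm_le
  exact ⟨R, (show ∀ᵐ x ∂μ, x ∈ K from h0).mono hR⟩

theorem Regular.exists_norm_le (hS : S.Regular) : ∃ R, ∀ᵐ u ∂S.initLaw, ‖u‖ ≤ R := by
  have := hS.probC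
  have := hS.probW2
  obtain ⟨R₁, h1⟩ := exists_norm_le_of_isCompact hS.compactC
  obtain ⟨R₂, h2⟩ := exists_norm_le_of_isCompact hS.compactW2
  refine ⟨max |R₁| |R₂|, ?_⟩
  have h3 : ∀ᵐ u ∂S.initLaw, ‖u.1‖ ≤ R₁ := Measure.quasiMeasurePreserving_fst.ae h1
  have h4 : ∀ᵐ u ∂S.initLaw, ∀ j, ‖u.2 j‖ ≤ R₂ :=
    Measure.quasiMeasurePreserving_snd.ae
      (ae_all_iff.2 fun j => (Measure.quasiMeasurePreserving_eval (μ := fun _ : Fin N₁ => S.lawW2) j).ae h2)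
  filter_upwards [h3, h4] with u hu1 hu2
  rw [Prod.norm_def]
  refine max_le_max (hu1.trans (le_abs_self _)) ?_
  exact (pi_norm_le_iff_of_nonneg (abs_nonneg _)).2 fun j => (hu2 j).trans (le_abs_self _)

theorem Regular.integrable (hS : S.Regular) {f : ℝ × (Fin N₁ → ℝ) → ℝ} (hf : Continuous f) :
    Integrable f S.initLaw := by
  have := hS.isProbabilityMeasure_initLaw
  obtain ⟨R, hR⟩ := hS.exists_norm_le
  obtain ⟨B, hB⟩ := exists_abs_le_closedBall hf R
  refine Integrable.of_bound hf.aestronglyMeasurable B (hR.mono fun u hu => ?_)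
  exact hB.2 u hu

theorem Regular.continuous_mean (hS : S.Regular) {f : UnitParam d N₁ → ℝ} (hf : Continuous f) :
    Continuous fun w => S.mean w f := by
  have := hS.isProbabilityMeasure_initLaw
  obtain ⟨R, hR⟩ := hS.exists_norm_le
  -- Compact support turns the mean into an integral over a fixed compact ball, where joint
  -- continuity suffices.
  have h1 : S.initLaw.restrict (Metric.closedBall 0 R) = S.initLaw :=
    Measure.restrict_eq_self_of_ae_mem (hR.mono fun u hu => by simpa using hu)
  have h2 := continuous_parametric_integral_of_continuous (μ := S.initLaw)
    (f := fun (w : Fin N₁ → EuclideanSpace ℝ (Fin d)) u => f (unitParam w u))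
    (hf.comp continuous_unitParam) (isCompact_closedBall (0 : ℝ × (Fin N₁ → ℝ)) R)
  rw [h1] at h2
  convert h2 using 2 with w
  exact hS.mean_eq w hf

theorem Regular.mean_const (hS : S.Regular) (w : Fin N₁ → EuclideanSpace ℝ (Fin d)) (c : ℝ) :
    S.mean w (fun _ => c) = c := by
  have := hS.isProbabilityMeasure_initLaw
  rw [hS.mean_eq w continuous_const]
  simp

theorem Regular.mean_smoothLinear (hS : S.Regular) (w : Fin N₁ → EuclideanSpace ℝ (Fin d)) :
    SmoothLinear (S.mean w) where
  map_add f g hf hg := by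
    have hu : Continuous (unitParam (d := d) w) := by unfold unitParam; fun_prop
    rw [hS.mean_eq w hf.continuous, hS.mean_eq w hg.continuous,
      hS.mean_eq w (f := fun θ => f θ + g θ) (hf.continuous.add hg.continuous)]
    exact integral_add (hS.integrable (hf.continuous.comp hu))
      (hS.integrable (hg.continuous.comp hu))
  map_mul c f hf := by rw [mean, integral_const_mul, mean]

theorem Regular.mean_F (hS : S.Regular) (w : Fin N₁ → EuclideanSpace ℝ (Fin d)) (k : Fin M) :
    S.mean w (S.system.F k) = 0 := by
  have := hS.probC
  have := hS.probW2
  rw [hS.mean_eq w (contDiff_system_F hS.act_smooth k).continuous]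
  -- The integrand factorises because Z does not depend on c, for which 0 is inserted; the factor
  -- from c is its mean, zero.
  have := integral_prod_mul (μ := S.lawC) (ν := Measure.pi fun _ : Fin N₁ => S.lawW2) (fun c => c)
    (fun w2 => S.act (S.Z (S.x k) (0, w2, w)))
  rw [hS.meanC, zero_mul] at this
  exact this

/-! ### The coefficients of the limiting equations in terms of the particle system -/

theorem Regular.A_eq (hS : S.Regular) (hN₁ : 0 < N₁) (w : Fin N₁ → EuclideanSpace ℝ (Fin d))
    (k i : Fin M) : S.A w (S.x k) (S.x i) = S.system.mix (S.mean w) (S.mean w) (S.system.F k) i := by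
  rw [mix_F hN₁ hS.act_smooth (hS.mean_smoothLinear w), hS.mean_const, A, Finset.sum_add_distrib]
  ring

/-- Product rule for `mix`. A functional that vanishes on constants contributes no `B1` or `B2`
terms from the first slot. -/
theorem Regular.dA_eq (hS : S.Regular) (hN₁ : 0 < N₁) (w : Fin N₁ → EuclideanSpace ℝ (Fin d))
    {ℓ : (UnitParam d N₁ → ℝ) → ℝ} (hℓ : SmoothLinear ℓ) (h1 : ℓ (fun _ => 1) = 0) (k i : Fin M) :
    S.dA w ℓ (S.x k) (S.x i) = S.system.mix (S.mean w) ℓ (S.system.F k) i +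
      S.system.mix ℓ (S.mean w) (S.system.F k) i := by
  rw [mix_F hN₁ hS.act_smooth hℓ, mix_F hN₁ hS.act_smooth (hS.mean_smoothLinear w),
    hS.mean_const, h1, dA]
  simp only [mul_add, Finset.sum_add_distrib]
  ring

theorem Regular.ddA_eq (hS : S.Regular) (hN₁ : 0 < N₁)
    {ℓ : (UnitParam d N₁ → ℝ) → ℝ} (hℓ : SmoothLinear ℓ) (h1 : ℓ (fun _ => 1) = 0) (k i : Fin M) :
    S.ddA ℓ (S.x k) (S.x i) = S.system.mix ℓ ℓ (S.system.F k) i := by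
  rw [mix_F hN₁ hS.act_smooth hℓ, h1, ddA]
  ring

theorem Regular.mean_Cf (hS : S.Regular) (w : Fin N₁ → EuclideanSpace ℝ (Fin d))
    {f : UnitParam d N₁ → ℝ} (hf : ContDiff ℝ ∞ f) (i : Fin M) :
    S.mean w (S.Cf w (S.x i) f) = S.system.mix (S.mean w) (S.mean w) f i := by
  have hm := hS.mean_smoothLinear w
  have h1 : ContDiff ℝ ∞ fun θ => dc f θ * S.act (S.Z (S.x i) θ) :=
    (contDiff_dc hf).mul (contDiff_act_Z hS.act_smooth _)
  have h2 := contDiff_gradW2 hS.act_smooth hf (S.x i)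
  have h3 : ContDiff ℝ ∞ (S.gradW1 w (S.x i) f) :=
    ContDiff.sum fun j _ => contDiff_const.mul (contDiff_dw1 hf j _)
  rw [mix_eq hS.act_smooth hm hf, hS.mean_const]
  unfold Cf
  rw [hm.map_add _ _ (h1.add (contDiff_const.mul h2)) (contDiff_const.mul h3),
    hm.map_add _ _ h1 (contDiff_const.mul h2), hm.map_mul _ _ h2, hm.map_mul _ _ h3, one_mul]
  rfl

variable {h K : ℝ → Fin M → ℝ}

theorem Regular.l_eq (hS : S.Regular) (w : Fin N₁ → EuclideanSpace ℝ (Fin d))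
    {f : UnitParam d N₁ → ℝ} (hf : ContDiff ℝ ∞ f) (t : ℝ) :
    S.l w h t f = S.system.lin (1 / (M : ℝ)) (S.mean w) h t f := by
  simp only [l, ParticleSystem.lin, hS.mean_Cf w hf]
  rfl

theorem Regular.lin_smoothLinear (hS : S.Regular) (w : Fin N₁ → EuclideanSpace ℝ (Fin d))
    (hh : Continuous h) (t : ℝ) :
    SmoothLinear (S.system.lin (1 / (M : ℝ)) (S.mean w) h t) :=
  ParticleSystem.lin_smoothLinear _ (contDiff_system_v hS.act_smooth) (hS.mean_smoothLinear w) hh t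

theorem Regular.l_smoothLinear (hS : S.Regular) (w : Fin N₁ → EuclideanSpace ℝ (Fin d))
    (hh : Continuous h) (t : ℝ) : SmoothLinear (S.l w h t) where
  map_add f g hf hg := by
    rw [hS.l_eq w hf, hS.l_eq w hg, hS.l_eq w (f := fun θ => f θ + g θ) (hf.add hg), (hS.lin_smoothLinear w hh t).map_add f g hf hg]
  map_mul c f hf := by
    rw [hS.l_eq w hf, hS.l_eq w (contDiff_const.mul hf), (hS.lin_smoothLinear w hh t).map_mul c f hf]

theorem Regular.l_one (hS : S.Regular) (w : Fin N₁ → EuclideanSpace ℝ (Fin d)) (t : ℝ) :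
    S.l w h t (fun _ => 1) = 0 := by
  rw [hS.l_eq w contDiff_const, ParticleSystem.lin_const _ (hS.mean_smoothLinear w)]

/-- `mix` evaluates its functionals only at coefficients and Lie derivatives, which are smooth;
agreement on smooth functions is all that is known of `l` and `lin`. -/
theorem Regular.mix_congr (hS : S.Regular) {μ μ' ν ν' : (UnitParam d N₁ → ℝ) → ℝ}
    (hμ : ∀ f, ContDiff ℝ ∞ f → μ f = μ' f) (hν : ∀ f, ContDiff ℝ ∞ f → ν f = ν' f)
    {f : UnitParam d N₁ → ℝ} (hf : ContDiff ℝ ∞ f) (i : Fin M) :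
    S.system.mix μ ν f i = S.system.mix μ' ν' f i :=
  Finset.sum_congr rfl fun a _ => by
    rw [hμ _ (contDiff_system_D hS.act_smooth i a),
      hν _ (ParticleSystem.contDiff_lie (contDiff_system_v hS.act_smooth) hf i a)]

theorem Regular.L_eq (hS : S.Regular) (w : Fin N₁ → EuclideanSpace ℝ (Fin d)) (hh : Continuous h)
    {f : UnitParam d N₁ → ℝ} (hf : ContDiff ℝ ∞ f) (t : ℝ) :
    S.L w h K t f = S.system.quad (1 / (M : ℝ)) (S.mean w) h K t f := by
  have key : ∀ s i, S.l w h s (fun θ => dc f θ * S.act (S.Z (S.x i) θ)) +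
        1 / (N₁ : ℝ) ^ (1 - S.γ₁) * S.l w h s (S.gradW2 (S.x i) f) +
        1 / (N₁ : ℝ) ^ (1 - S.γ₁) * S.l w h s (S.gradW1 w (S.x i) f) +
        1 / (N₁ : ℝ) ^ (1 - S.γ₁) *
          S.mean w (fun θ => ∑ j, S.l w h s (S.D j (S.x i)) * dw1 j (S.x i) f θ) =
      S.system.mix (S.mean w) (S.system.lin (1 / (M : ℝ)) (S.mean w) h s) f i +
      S.system.mix (S.system.lin (1 / (M : ℝ)) (S.mean w) h s) (S.mean w) f i := by
    intro s i
    have hl := hS.l_smoothLinear (h := h) w hh s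
    rw [hS.mix_congr (μ' := S.mean w) (ν' := S.l w h s) (fun _ _ => rfl)
      (fun g hg => (hS.l_eq w hg s).symm) hf,
      hS.mix_congr (μ' := S.l w h s) (ν' := S.mean w) (fun g hg => (hS.l_eq w hg s).symm)
      (fun _ _ => rfl) hf, mix_eq hS.act_smooth hl hf,
      mix_eq hS.act_smooth (hS.mean_smoothLinear w) hf, hS.mean_const, hS.l_one w]
    unfold gradW1
    ring
  simp only [L, ParticleSystem.quad, hS.mean_Cf w hf, key]
  rfl

theorem Regular.quad_smoothLinear (hS : S.Regular) (w : Fin N₁ → EuclideanSpace ℝ (Fin d))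
    (hh : Continuous h) (hK : Continuous K) (t : ℝ) :
    SmoothLinear (S.system.quad (1 / (M : ℝ)) (S.mean w) h K t) :=
  ParticleSystem.quad_smoothLinear _ (contDiff_system_v hS.act_smooth) (hS.mean_smoothLinear w)
    hh hK t

theorem Regular.dA_congr (hS : S.Regular) (w : Fin N₁ → EuclideanSpace ℝ (Fin d))
    {ℓ ℓ' : (UnitParam d N₁ → ℝ) → ℝ} (h : ∀ f, ContDiff ℝ ∞ f → ℓ f = ℓ' f) (k i : Fin M) :
    S.dA w ℓ (S.x k) (S.x i) = S.dA w ℓ' (S.x k) (S.x i) := by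
  simp only [dA, h _ (contDiff_B1 hS.act_smooth _ _), h _ (contDiff_B2 hS.act_smooth _ _ _),
    h _ (contDiff_B3 hS.act_smooth _ _)]

theorem Regular.ddA_congr (hS : S.Regular)
    {ℓ ℓ' : (UnitParam d N₁ → ℝ) → ℝ} (h : ∀ f, ContDiff ℝ ∞ f → ℓ f = ℓ' f) (k i : Fin M) :
    S.ddA ℓ (S.x k) (S.x i) = S.ddA ℓ' (S.x k) (S.x i) := by
  simp only [ddA, h _ (contDiff_B3 hS.act_smooth _ _)]

theorem Regular.dA_l (hS : S.Regular) (hN₁ : 0 < N₁) (w : Fin N₁ → EuclideanSpace ℝ (Fin d))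
    (hh : Continuous h) (t : ℝ) (k i : Fin M) :
    S.dA w (S.l w h t) (S.x k) (S.x i) =
      S.system.mix (S.mean w) (S.system.lin (1 / (M : ℝ)) (S.mean w) h t) (S.system.F k) i +
      S.system.mix (S.system.lin (1 / (M : ℝ)) (S.mean w) h t) (S.mean w) (S.system.F k) i := by
  rw [hS.dA_congr w fun f hf => hS.l_eq w hf t, hS.dA_eq hN₁ w (hS.lin_smoothLinear w hh t)
    (ParticleSystem.lin_const _ (hS.mean_smoothLinear w) _ _)]

theorem Regular.forcing_eq (hS : S.Regular) (hN₁ : 0 < N₁)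
    (w : Fin N₁ → EuclideanSpace ℝ (Fin d)) (hh : Continuous h) (hK : Continuous K) (t : ℝ)
    (k i : Fin M) :
    S.system.forcing (1 / (M : ℝ)) (S.mean w) h K t (S.system.F k) i =
      (S.y i - h t i) * S.dA w (S.L w h K t) (S.x k) (S.x i) +
        (S.y i - h t i) * S.ddA (S.l w h t) (S.x k) (S.x i) -
        K t i * S.dA w (S.l w h t) (S.x k) (S.x i) := by
  rw [hS.dA_l hN₁ w hh, hS.ddA_congr fun f hf => hS.l_eq w hf t,
    hS.ddA_eq hN₁ (hS.lin_smoothLinear w hh t)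
      (ParticleSystem.lin_const _ (hS.mean_smoothLinear w) _ _),
    hS.dA_congr w fun f hf => hS.L_eq w hh hf t, hS.dA_eq hN₁ w (hS.quad_smoothLinear w hh hK t)
      (ParticleSystem.quad_const _ (hS.mean_smoothLinear w) _ _), ParticleSystem.forcing,
    show S.system.y = S.y from rfl]
  ring

end TwoLayerNet

/-! ### Linear equations in coordinates -/

section MatrixODE

variable {M : ℕ}

/-- The operator with matrix `c`. -/
noncomputable def matrixCLM (c : Fin M → Fin M → ℝ) : (Fin M → ℝ) →L[ℝ] (Fin M → ℝ) :=
  ∑ k, ∑ i, c k i • (ContinuousLinearMap.proj (R := ℝ) (φ := fun _ : Fin M => ℝ) i).smulRight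
    (Pi.single k 1)

theorem matrixCLM_apply (c : Fin M → Fin M → ℝ) (ψ : Fin M → ℝ) (k : Fin M) :
    matrixCLM c ψ k = ∑ i, c k i * ψ i := by
  simp [matrixCLM, Pi.single_apply, Finset.sum_apply]

theorem continuous_matrixCLM {X : Type*} [TopologicalSpace X] {c : X → Fin M → Fin M → ℝ}
    (hc : ∀ k i, Continuous fun x => c x k i) : Continuous fun x => matrixCLM (c x) := by
  unfold matrixCLM
  exact continuous_finsetSum _ fun k _ => continuous_finsetSum _ fun i _ =>
    (hc k i).smul continuous_const

theorem linearODE_matrixCLM (c : Fin M → Fin M → ℝ) (ψ₀ : Fin M → ℝ) {F : ℝ → Fin M → ℝ}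
    (hF : Continuous F) (t : ℝ) (k : Fin M) :
    linearODE (matrixCLM c) ψ₀ F t k = ψ₀ k + ∫ s in (0 : ℝ)..t,
      (F s k - ∑ i, c k i * linearODE (matrixCLM c) ψ₀ F s i) := by
  have hc : Continuous (linearODE (matrixCLM c) ψ₀ F) :=
    (continuous_linearODE (X := Unit) (A := fun _ => matrixCLM c) (ψ₀ := fun _ => ψ₀)
      (F := fun _ => F) continuous_const continuous_const (hF.comp continuous_snd)).comp
      (by fun_prop : Continuous fun t : ℝ => ((), t))
  conv_lhs => rw [linearODE_eq_integral _ _ hF]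
  rw [Pi.add_apply]
  congr 1
  have h1 := (ContinuousLinearMap.proj (R := ℝ) (φ := fun _ : Fin M => ℝ) k).intervalIntegral_comp_comm
    ((hF.sub ((matrixCLM c).continuous.comp hc)).intervalIntegrable (μ := volume) 0 t)
  refine h1.symm.trans (intervalIntegral.integral_congr fun s _ => ?_)
  simp [matrixCLM_apply]

end MatrixODE

theorem Continuous.section_right {X Y Z : Type*} [TopologicalSpace X] [TopologicalSpace Y]
    [TopologicalSpace Z] {f : X → Y → Z} (h : Continuous fun q : X × Y => f q.1 q.2) (x : X) :
    Continuous (f x) :=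
  h.comp (Continuous.prodMk_right x)

namespace TwoLayerNet

variable {d N₁ M : ℕ} (S : TwoLayerNet d N₁ M)

/-! ### The solutions of the limiting equations -/

/-- The matrix `M⁻¹ A_{x,x'}`. -/
noncomputable def kernelMatrix (w : Fin N₁ → EuclideanSpace ℝ (Fin d)) (k i : Fin M) : ℝ :=
  1 / (M : ℝ) * S.system.mix (S.mean w) (S.mean w) (S.system.F k) i

/-- The solution of the limiting linear equation with initial value `ψ₀` and source `F`. -/
noncomputable def solution (w : Fin N₁ → EuclideanSpace ℝ (Fin d)) (ψ₀ : Fin M → ℝ)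
    (F : ℝ → Fin M → ℝ) : ℝ → Fin M → ℝ :=
  linearODE (matrixCLM (S.kernelMatrix w)) ψ₀ F

/-- The limit of the output. -/
noncomputable def limitOutput (w : Fin N₁ → EuclideanSpace ℝ (Fin d)) : ℝ → Fin M → ℝ :=
  S.solution w 0 fun _ k => ∑ i, S.kernelMatrix w k i * S.y i

/-- The source of the equation of the first order fluctuations. -/
noncomputable def fluctuationSource (w : Fin N₁ → EuclideanSpace ℝ (Fin d)) (s : ℝ) (k : Fin M) :
    ℝ :=
  1 / (M : ℝ) * ∑ i, (S.y i - S.limitOutput w s i) *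
    (S.system.mix (S.mean w) (S.system.lin (1 / (M : ℝ)) (S.mean w) (S.limitOutput w) s)
        (S.system.F k) i +
      S.system.mix (S.system.lin (1 / (M : ℝ)) (S.mean w) (S.limitOutput w) s) (S.mean w)
        (S.system.F k) i)

/-- The limit of the first order fluctuations. -/
noncomputable def limitFluctuation (w : Fin N₁ → EuclideanSpace ℝ (Fin d)) : ℝ → Fin M → ℝ :=
  S.solution w 0 (S.fluctuationSource w)

/-- The source of the equation of the second order fluctuations. -/
noncomputable def forcingSource (w : Fin N₁ → EuclideanSpace ℝ (Fin d)) (s : ℝ) (k : Fin M) : ℝ :=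
  1 / (M : ℝ) * ∑ i, S.system.forcing (1 / (M : ℝ)) (S.mean w) (S.limitOutput w)
    (S.limitFluctuation w) s (S.system.F k) i

/-- The limit of the second order fluctuations, started from `ψ₀` and with the source multiplied by
`b`. -/
noncomputable def limitSecond (b : ℝ) (w : Fin N₁ → EuclideanSpace ℝ (Fin d)) (ψ₀ : Fin M → ℝ) :
    ℝ → Fin M → ℝ :=
  S.solution w ψ₀ fun s => b • S.forcingSource w s

variable {S}

theorem solution_apply (w : Fin N₁ → EuclideanSpace ℝ (Fin d)) (ψ₀ : Fin M → ℝ)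
    {F : ℝ → Fin M → ℝ} (hF : Continuous F) (t : ℝ) (k : Fin M) :
    S.solution w ψ₀ F t k = ψ₀ k + ∫ s in (0 : ℝ)..t,
      (F s k - ∑ i, S.kernelMatrix w k i * S.solution w ψ₀ F s i) :=
  linearODE_matrixCLM _ _ hF t k

theorem Regular.continuous_kernelMatrix (hS : S.Regular) (k i : Fin M) :
    Continuous fun w => S.kernelMatrix w k i :=
  continuous_const.mul (S.system.continuous_mix_of_smooth (contDiff_system_D hS.act_smooth)
    (contDiff_system_v hS.act_smooth) (fun _ hf => hS.continuous_mean hf.continuous)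
    (fun _ hf => hS.continuous_mean hf.continuous) (contDiff_system_F hS.act_smooth k) i)

theorem Regular.continuous_solution (hS : S.Regular) {X : Type*} [TopologicalSpace X]
    {w : X → Fin N₁ → EuclideanSpace ℝ (Fin d)} {ψ₀ : X → Fin M → ℝ} {F : X → ℝ → Fin M → ℝ}
    (hw : Continuous w) (hψ : Continuous ψ₀) (hF : Continuous fun q : X × ℝ => F q.1 q.2) :
    Continuous fun q : X × ℝ => S.solution (w q.1) (ψ₀ q.1) (F q.1) q.2 :=
  continuous_linearODE (continuous_matrixCLM fun k i => (hS.continuous_kernelMatrix k i).comp hw)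
    hψ hF

theorem Regular.continuous_limitOutput (hS : S.Regular) :
    Continuous fun q : (Fin N₁ → EuclideanSpace ℝ (Fin d)) × ℝ => S.limitOutput q.1 q.2 :=
  hS.continuous_solution (w := id) (ψ₀ := 0)
    (F := fun w _ k => ∑ i, S.kernelMatrix w k i * S.y i) continuous_id continuous_const
    (continuous_pi fun k =>
    continuous_finsetSum _ fun i _ =>
      ((hS.continuous_kernelMatrix k i).comp continuous_fst).mul continuous_const)

theorem Regular.continuous_fluctuationSource (hS : S.Regular) :
    Continuous fun q : (Fin N₁ → EuclideanSpace ℝ (Fin d)) × ℝ => S.fluctuationSource q.1 q.2 := by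
  have hD := contDiff_system_D hS.act_smooth
  have hv := contDiff_system_v hS.act_smooth
  have hm : ∀ f, ContDiff ℝ ∞ f → Continuous
      fun q : (Fin N₁ → EuclideanSpace ℝ (Fin d)) × ℝ => S.mean q.1 f :=
    fun f hf => (hS.continuous_mean hf.continuous).comp continuous_fst
  have hl : ∀ f, ContDiff ℝ ∞ f → Continuous
      fun q : (Fin N₁ → EuclideanSpace ℝ (Fin d)) × ℝ =>
        S.system.lin (1 / (M : ℝ)) (S.mean q.1) (S.limitOutput q.1) q.2 f :=
    fun f hf => S.system.continuous_lin_param _ hD hv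
      (fun f hf => hS.continuous_mean hf.continuous) hS.continuous_limitOutput hf
  refine continuous_pi fun k => continuous_const.mul (continuous_finsetSum _ fun i _ => ?_)
  have hF := contDiff_system_F hS.act_smooth k
  exact (continuous_const.sub ((continuous_apply i).comp hS.continuous_limitOutput)).mul
    ((S.system.continuous_mix_of_smooth hD hv hm hl hF i).add
      (S.system.continuous_mix_of_smooth hD hv hl hm hF i))

theorem Regular.continuous_limitFluctuation (hS : S.Regular) :
    Continuous fun q : (Fin N₁ → EuclideanSpace ℝ (Fin d)) × ℝ => S.limitFluctuation q.1 q.2 :=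
  hS.continuous_solution (w := id) (ψ₀ := 0) (F := S.fluctuationSource) continuous_id
    continuous_const hS.continuous_fluctuationSource

theorem Regular.continuous_forcingSource (hS : S.Regular) :
    Continuous fun q : (Fin N₁ → EuclideanSpace ℝ (Fin d)) × ℝ => S.forcingSource q.1 q.2 :=
  continuous_pi fun k => continuous_const.mul (continuous_finsetSum _ fun i _ =>
    S.system.continuous_forcing_param _ (contDiff_system_D hS.act_smooth)
      (contDiff_system_v hS.act_smooth) (fun _ hf => hS.continuous_mean hf.continuous)
      hS.continuous_limitOutput hS.continuous_limitFluctuation (contDiff_system_F hS.act_smooth k) i)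

theorem Regular.continuous_limitSecond (hS : S.Regular) (b : ℝ) {X : Type*} [TopologicalSpace X]
    {w : X → Fin N₁ → EuclideanSpace ℝ (Fin d)} {ψ₀ : X → Fin M → ℝ} (hw : Continuous w)
    (hψ : Continuous ψ₀) : Continuous fun q : X × ℝ => S.limitSecond b (w q.1) (ψ₀ q.1) q.2 :=
  hS.continuous_solution (F := fun x s => b • S.forcingSource (w x) s) hw hψ
    (Continuous.const_smul (hS.continuous_forcingSource.comp
    (by fun_prop : Continuous fun q : X × ℝ => (w q.1, q.2))) b)

theorem Regular.continuous_limitOutput_path (hS : S.Regular)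
    (w : Fin N₁ → EuclideanSpace ℝ (Fin d)) : Continuous (S.limitOutput w) :=
  hS.continuous_limitOutput.section_right w

theorem Regular.continuous_limitFluctuation_path (hS : S.Regular)
    (w : Fin N₁ → EuclideanSpace ℝ (Fin d)) : Continuous (S.limitFluctuation w) :=
  hS.continuous_limitFluctuation.section_right w

theorem Regular.continuous_limitSecond_path (hS : S.Regular) (b : ℝ)
    (w : Fin N₁ → EuclideanSpace ℝ (Fin d)) (ψ₀ : Fin M → ℝ) : Continuous (S.limitSecond b w ψ₀) :=
  (hS.continuous_limitSecond b (X := Unit) (w := fun _ => w) (ψ₀ := fun _ => ψ₀) continuous_const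
    continuous_const).section_right (f := fun _ => S.limitSecond b w ψ₀) ()

theorem limitOutput_eq_lin (w : Fin N₁ → EuclideanSpace ℝ (Fin d)) (t : ℝ) (k : Fin M) :
    S.limitOutput w t k =
      S.system.lin (1 / (M : ℝ)) (S.mean w) (S.limitOutput w) t (S.system.F k) := by
  have h1 : S.limitOutput w t k = (0 : Fin M → ℝ) k + ∫ s in (0 : ℝ)..t,
      (∑ i, S.kernelMatrix w k i * S.y i - ∑ i, S.kernelMatrix w k i * S.limitOutput w s i) :=
    solution_apply w 0 continuous_const t k
  rw [h1, Pi.zero_apply, zero_add, ParticleSystem.lin]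
  refine intervalIntegral.integral_congr fun s _ => ?_
  simp only [kernelMatrix, ← Finset.sum_sub_distrib, Finset.mul_sum]
  exact Finset.sum_congr rfl fun i _ => by rw [show S.system.y = S.y from rfl]; ring

theorem Regular.limitFluctuation_eq_quad (hS : S.Regular)
    (w : Fin N₁ → EuclideanSpace ℝ (Fin d)) (t : ℝ) (k : Fin M) :
    S.limitFluctuation w t k = S.system.quad (1 / (M : ℝ)) (S.mean w) (S.limitOutput w)
      (S.limitFluctuation w) t (S.system.F k) := by
  have hF : Continuous (S.fluctuationSource w) :=
    hS.continuous_fluctuationSource.section_right w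
  have h1 : S.limitFluctuation w t k = (0 : Fin M → ℝ) k + ∫ s in (0 : ℝ)..t,
      (S.fluctuationSource w s k - ∑ i, S.kernelMatrix w k i * S.limitFluctuation w s i) :=
    solution_apply w 0 hF t k
  rw [h1, Pi.zero_apply, zero_add, ParticleSystem.quad]
  refine intervalIntegral.integral_congr fun s _ => ?_
  simp only [fluctuationSource, kernelMatrix, ← Finset.sum_sub_distrib, Finset.mul_sum]
  exact Finset.sum_congr rfl fun i _ => by rw [show S.system.y = S.y from rfl]; ring

theorem Regular.limitSecond_eq (hS : S.Regular) (b : ℝ)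
    (w : Fin N₁ → EuclideanSpace ℝ (Fin d)) (ψ₀ : Fin M → ℝ) (t : ℝ) (k : Fin M) :
    S.limitSecond b w ψ₀ t k = ψ₀ k + ∫ s in (0 : ℝ)..t, 1 / (M : ℝ) * ∑ i,
      (b * S.system.forcing (1 / (M : ℝ)) (S.mean w) (S.limitOutput w)
        (S.limitFluctuation w) s (S.system.F k) i -
        S.limitSecond b w ψ₀ s i * S.system.mix (S.mean w) (S.mean w) (S.system.F k) i) := by
  have hF : Continuous fun s => b • S.forcingSource w s :=
    (hS.continuous_forcingSource.section_right w).const_smul b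
  have h1 : S.limitSecond b w ψ₀ t k = ψ₀ k + ∫ s in (0 : ℝ)..t,
      ((b • S.forcingSource w s) k - ∑ i, S.kernelMatrix w k i * S.limitSecond b w ψ₀ s i) :=
    solution_apply w ψ₀ hF t k
  rw [h1]
  congr 1
  refine intervalIntegral.integral_congr fun s _ => ?_
  simp only [forcingSource, kernelMatrix, Pi.smul_apply, smul_eq_mul, Finset.mul_sum,
    ← Finset.sum_sub_distrib]
  exact Finset.sum_congr rfl fun i _ => by ring

theorem limitSecond_smul_add (a b : ℝ) (w : Fin N₁ → EuclideanSpace ℝ (Fin d)) (ψ₀ : Fin M → ℝ)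
    (t : ℝ) : S.limitSecond b w (a • ψ₀) t =
      a • S.limitSecond 0 w ψ₀ t + b • S.limitSecond 1 w 0 t := by
  simp only [limitSecond, solution, zero_smul, one_smul]
  exact linearODE_smul_add _ a b ψ₀ _ t

theorem Regular.isLimitOutput (hS : S.Regular) (hN₁ : 0 < N₁) (T : ℝ)
    (w : Fin N₁ → EuclideanSpace ℝ (Fin d)) : S.IsLimitOutput T w (S.limitOutput w) := by
  refine ⟨(hS.continuous_limitOutput_path w).continuousOn, fun t _ k => ?_⟩
  rw [limitOutput_eq_lin, ParticleSystem.lin]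
  simp only [hS.A_eq hN₁]
  rfl

theorem Regular.isLimitFluctuation (hS : S.Regular) (hN₁ : 0 < N₁) (T : ℝ)
    (w : Fin N₁ → EuclideanSpace ℝ (Fin d)) :
    S.IsLimitFluctuation₁ T w (S.limitOutput w) (S.limitFluctuation w) := by
  refine ⟨(hS.continuous_limitFluctuation_path w).continuousOn, fun t _ k => ?_⟩
  rw [hS.limitFluctuation_eq_quad, ParticleSystem.quad]
  simp only [hS.A_eq hN₁, hS.dA_l hN₁ w (hS.continuous_limitOutput_path w)]
  rfl

theorem Regular.solvesHomogeneous (hS : S.Regular) (hN₁ : 0 < N₁) (T : ℝ)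
    (w : Fin N₁ → EuclideanSpace ℝ (Fin d)) (ψ₀ : Fin M → ℝ) :
    S.SolvesHomogeneous T w ψ₀ (S.limitSecond 0 w ψ₀) := by
  refine ⟨(hS.continuous_limitSecond_path 0 w ψ₀).continuousOn, fun t _ k => ?_⟩
  rw [hS.limitSecond_eq, sub_eq_add_neg, ← intervalIntegral.integral_neg]
  congr 1
  refine intervalIntegral.integral_congr fun s _ => ?_
  simp only [zero_mul, zero_sub, Finset.sum_neg_distrib, mul_neg, hS.A_eq hN₁]

theorem Regular.solvesForced (hS : S.Regular) (hN₁ : 0 < N₁) (T : ℝ)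
    (w : Fin N₁ → EuclideanSpace ℝ (Fin d)) (ψ₀ : Fin M → ℝ) :
    S.SolvesForced T w (S.limitOutput w) (S.limitFluctuation w) ψ₀ (S.limitSecond 1 w ψ₀) := by
  refine ⟨(hS.continuous_limitSecond_path 1 w ψ₀).continuousOn, fun t _ k => ?_⟩
  rw [hS.limitSecond_eq]
  congr 1
  refine intervalIntegral.integral_congr fun s _ => ?_
  simp only [hS.forcing_eq hN₁ w (hS.continuous_limitOutput_path w)
    (hS.continuous_limitFluctuation_path w), hS.A_eq hN₁]
  congr 1
  exact Finset.sum_congr rfl fun i _ => by ring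

end TwoLayerNet

/-! ### A countable class of observables stable under the vector fields -/

namespace ParticleSystem

variable {E ι α : Type*} [NormedAddCommGroup E] [NormedSpace ℝ E] [Fintype ι] [Fintype α]
  (S : ParticleSystem E ι α)

/-- The iterated derivatives of the observables and the coefficients of the system. -/
noncomputable def word (b : ι ⊕ ι × α) : List (ι × α) → E → ℝ
  | [] => b.elim S.F fun q => S.D q.1 q.2
  | q :: l => S.lie q.1 q.2 (word b l)

theorem contDiff_word {S : ParticleSystem E ι α} (hF : ∀ i, ContDiff ℝ ∞ (S.F i))
    (hD : ∀ i a, ContDiff ℝ ∞ (S.D i a)) (hv : ∀ i a, ContDiff ℝ ∞ (S.v i a)) (b : ι ⊕ ι × α)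
    (l : List (ι × α)) : ContDiff ℝ ∞ (S.word b l) := by
  induction l with
  | nil =>
    cases b with
    | inl i => exact hF i
    | inr q => exact hD q.1 q.2
  | cons q l ih => exact contDiff_lie hv ih q.1 q.2

end ParticleSystem

namespace TwoLayerNet

variable {d N₁ M : ℕ} (S : TwoLayerNet d N₁ M)

/-! ### Stochastic gradient descent in terms of the particle system -/

/-- The weight that the sample `p` gives to the `i`-th data point. -/
noncomputable def dataWeight (p : EuclideanSpace ℝ (Fin d) × ℝ) (i : Fin M) : ℝ :=
  open scoped Classical in
  (if (S.x i, S.y i) = p then 1 else 0) / ∑ i', if (S.x i', S.y i') = p then 1 else 0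

variable {S}

theorem dataWeight_mem (p : EuclideanSpace ℝ (Fin d) × ℝ) (i : Fin M) :
    S.dataWeight p i ∈ Icc (0 : ℝ) 1 := by
  classical
  rw [dataWeight]
  have h0 : ∀ i', (0 : ℝ) ≤ if (S.x i', S.y i') = p then 1 else 0 := fun i' => by split_ifs <;> simp
  have h1 := Finset.single_le_sum (fun i' _ => h0 i') (Finset.mem_univ i)
  exact ⟨div_nonneg (h0 i) (Finset.sum_nonneg fun i' _ => h0 i'), div_le_one_of_le₀ h1
    (Finset.sum_nonneg fun i' _ => h0 i')⟩

/-- Coinciding data points cannot be told apart by the sample, so its unit weight is split evenly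
among them; a quantity that depends on the point alone does not notice. -/
theorem sum_dataWeight_smul {V : Type*} [AddCommGroup V] [Module ℝ V]
    (G : EuclideanSpace ℝ (Fin d) × ℝ → V) (i₀ : Fin M) :
    ∑ i, S.dataWeight (S.x i₀, S.y i₀) i • G (S.x i, S.y i) = G (S.x i₀, S.y i₀) := by
  classical
  set p := (S.x i₀, S.y i₀)
  have h1 : ∀ i, S.dataWeight p i • G (S.x i, S.y i) = S.dataWeight p i • G p := by
    intro i
    by_cases h : (S.x i, S.y i) = p
    · rw [h]
    · simp [dataWeight, h]
  have hpos : (0 : ℝ) < ∑ i', if (S.x i', S.y i') = p then (1 : ℝ) else 0 :=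
    Finset.sum_pos' (fun i' _ => by split_ifs <;> simp) ⟨i₀, Finset.mem_univ _, by simp [p]⟩
  rw [Finset.sum_congr rfl fun i _ => h1 i, ← Finset.sum_smul]
  simp only [dataWeight]
  rw [← Finset.sum_div, div_self hpos.ne', one_smul]

/-- A point of multiplicity r receives the share 1/r from each of r indices. Therefore its mean
weight under the empirical law is 1/M, with or without repetitions. -/
theorem sum_dataWeight_data (i : Fin M) :
    ∑ i₀, S.dataWeight (S.x i₀, S.y i₀) i = 1 := by
  classical
  have h1 : ∀ i₀, S.dataWeight (S.x i₀, S.y i₀) i =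
      (if (S.x i₀, S.y i₀) = (S.x i, S.y i) then 1 else 0) /
        ∑ i', if (S.x i', S.y i') = (S.x i, S.y i) then (1 : ℝ) else 0 := by
    intro i₀
    by_cases h : (S.x i₀, S.y i₀) = (S.x i, S.y i)
    · simp [dataWeight, h]
    · rw [dataWeight, if_neg (Ne.symm h), if_neg h, zero_div, zero_div]
  have hpos : (0 : ℝ) < ∑ i', if (S.x i', S.y i') = (S.x i, S.y i) then (1 : ℝ) else 0 :=
    Finset.sum_pos' (fun i' _ => by split_ifs <;> simp) ⟨i, Finset.mem_univ _, by simp⟩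
  rw [Finset.sum_congr rfl fun i₀ _ => h1 i₀, ← Finset.sum_div, div_self hpos.ne']

theorem out_eq_output {N : ℕ} (hN : 0 < N) (θ : NetState d N₁ N) (k : Fin M) :
    S.system.out ((N : ℝ) ^ (S.γ₂ - 1)) θ.unit k = S.output θ (S.x k) := by
  have hN' : (0 : ℝ) < N := by exact_mod_cast hN
  rw [ParticleSystem.out, particleMean, output, ← mul_assoc, ← mul_inv, ← Real.rpow_add_one hN'.ne',
    sub_add_cancel, one_div]
  rfl

/-- The direction in which the sample `p` moves the `n`-th unit. -/
noncomputable def direction (S : TwoLayerNet d N₁ M) {N : ℕ} (θ : NetState d N₁ N) (n : Fin N)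
    (p : EuclideanSpace ℝ (Fin d) × ℝ) : UnitParam d N₁ :=
  (p.2 - S.output θ p.1) • (S.act (S.Z p.1 (θ.unit n)),
    fun j => 1 / (N₁ : ℝ) ^ (1 - S.γ₁) *
      ((θ.unit n).1 * deriv S.act (S.Z p.1 (θ.unit n)) * S.act (inner ℝ (θ.W1 j) p.1)),
    fun j => (particleMean θ.unit (S.D j p.1) * (1 / (N₁ : ℝ) ^ (1 - S.γ₁))) • p.1)

theorem incr_eq_sum_direction {N : ℕ} (hN : 0 < N) (θ : NetState d N₁ N) (ξ : Fin M → ℝ)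
    (n : Fin N) : S.system.incr ((N : ℝ) ^ (S.γ₂ - 1)) ξ θ.unit n =
      ∑ i, ξ i • S.direction θ n (S.x i, S.y i) := by
  have hN' : (N : ℝ) ≠ 0 := by exact_mod_cast hN.ne'
  rw [ParticleSystem.incr]
  refine Finset.sum_congr rfl fun i _ => ?_
  rw [out_eq_output hN, direction, smul_smul]
  congr 1
  rw [Fintype.sum_option]
  have h1 : particleMean θ.unit (S.system.D i none) = 1 := by
    simp [particleMean, system, hN']
  have h2 : ∑ j, particleMean θ.unit (S.system.D i (some j)) • S.system.v i (some j) (θ.unit n) =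
      (0, 0, fun j => (particleMean θ.unit (S.D j (S.x i)) * (1 / (N₁ : ℝ) ^ (1 - S.γ₁))) • S.x i) := by
    refine Prod.ext ?_ (Prod.ext ?_ ?_)
    · simp [Prod.fst_sum, system]
    · simp [Prod.snd_sum, Prod.fst_sum, system]
    · rw [Prod.snd_sum, Prod.snd_sum]
      funext j
      rw [Finset.sum_apply, Finset.sum_eq_single j]
      · simp [system, smul_smul]
      · intro j' _ hj'
        simp [system, Pi.single_eq_of_ne (Ne.symm hj')]
      · simp
  rw [h1, h2, one_smul]
  simp [system, NetState.unit]

/-- The exponents of the learning rates are such that all three kinds of weights move with the same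
step ε/N; the extra 1/N in the rate of the first layer turns its sum over units into a mean. -/
theorem unit_sgdStep_eq_direction {N : ℕ} (hN₁ : 0 < N₁) (hN : 0 < N) (θ : NetState d N₁ N)
    (n : Fin N) (p : EuclideanSpace ℝ (Fin d) × ℝ) : (S.sgdStep θ p).unit n =
      θ.unit n + ((N : ℝ) ^ (S.γ₂ - 1) / N) • S.direction θ n p := by
  have hN' : (0 : ℝ) < N := by exact_mod_cast hN
  have hN₁' : (0 : ℝ) < N₁ := by exact_mod_cast hN₁
  have e1 : S.rateC N / (N : ℝ) ^ S.γ₂ = (N : ℝ) ^ (S.γ₂ - 1) / N := by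
    rw [rateC, ← Real.rpow_sub_one hN'.ne', div_div, ← Real.rpow_add hN', one_div,
      ← Real.rpow_neg hN'.le]
    congr 1
    ring
  have e0 : (1 : ℝ) / ((N₁ : ℝ) ^ (1 - 2 * S.γ₁) * (N₁ : ℝ) ^ S.γ₁) = 1 / (N₁ : ℝ) ^ (1 - S.γ₁) := by
    rw [← Real.rpow_add hN₁']
    congr 2
    ring
  have e2 : S.rateW2 N / ((N₁ : ℝ) ^ S.γ₁ * (N : ℝ) ^ S.γ₂) =
      (N : ℝ) ^ (S.γ₂ - 1) / N * (1 / (N₁ : ℝ) ^ (1 - S.γ₁)) := by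
    rw [← e1, ← e0, rateC, rateW2]
    field_simp
  have e3 : S.rateW1 N / (N₁ : ℝ) ^ S.γ₁ * (1 / (N : ℝ) ^ S.γ₂) =
      (N : ℝ) ^ (S.γ₂ - 1) / N * (1 / (N₁ : ℝ) ^ (1 - S.γ₁)) * (N : ℝ)⁻¹ := by
    have : (N : ℝ) ^ (3 - 2 * S.γ₂) = (N : ℝ) ^ (2 - 2 * S.γ₂) * N := by
      rw [← Real.rpow_add_one hN'.ne']
      congr 1
      ring
    rw [← e1, ← e0, rateC, rateW1, this]
    field_simp
  refine Prod.ext ?_ (Prod.ext ?_ ?_)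
  · change θ.C n + _ = θ.C n + _
    rw [e1]
    simp only [direction, Prod.smul_mk, smul_eq_mul]
    ring
  · funext j
    change θ.W2 j n + _ = θ.W2 j n + _
    rw [e2]
    simp only [direction, Prod.smul_mk, smul_eq_mul, Pi.smul_apply, NetState.unit]
    ring
  · funext j
    change θ.W1 j + _ = θ.W1 j + _
    simp only [direction, Prod.smul_mk, Pi.smul_apply, smul_smul]
    congr 2
    have : ∑ i, θ.C i * deriv S.act (S.Z p.1 (θ.unit i)) * θ.W2 j i *
        deriv S.act (inner ℝ (θ.W1 j) p.1) = ∑ i, S.D j p.1 (θ.unit i) :=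
      Finset.sum_congr rfl fun i _ => by
        simp only [D, NetState.unit]
        ring
    rw [particleMean, ← this, ← Finset.sum_mul]
    linear_combination ((p.2 - S.output θ p.1) * (∑ i, θ.C i * deriv S.act (S.Z p.1 (θ.unit i)) * θ.W2 j i) *
        deriv S.act (inner ℝ (θ.W1 j) p.1)) * e3

theorem unit_sgdStep {N : ℕ} (hN₁ : 0 < N₁) (hN : 0 < N) (θ : NetState d N₁ N) (n : Fin N)
    (i₀ : Fin M) : (S.sgdStep θ (S.x i₀, S.y i₀)).unit n = θ.unit n +
      ((N : ℝ) ^ (S.γ₂ - 1) / N) • S.system.incr ((N : ℝ) ^ (S.γ₂ - 1))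
        (S.dataWeight (S.x i₀, S.y i₀)) θ.unit n := by
  rw [unit_sgdStep_eq_direction hN₁ hN, incr_eq_sum_direction hN,
    sum_dataWeight_smul (S.direction θ n)]

end TwoLayerNet

/-! ### Powers of the number of units -/

theorem tendsto_natCast_rpow_of_neg {a : ℝ} (ha : a < 0) :
    Tendsto (fun N : ℕ => (N : ℝ) ^ a) atTop (𝓝 0) := by
  have := (tendsto_rpow_neg_atTop (neg_pos.2 ha)).comp (tendsto_natCast_atTop_atTop (R := ℝ))
  simpa [Function.comp_def] using this

theorem eventually_natCast_pos : ∀ᶠ N : ℕ in atTop, (0 : ℝ) < N :=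
  (eventually_gt_atTop 0).mono fun N hN => by exact_mod_cast hN

/-! ### Pathwise expansion of the trained network -/

namespace TwoLayerNet

variable {d N₁ M : ℕ} (S : TwoLayerNet d N₁ M)

/-- Initial parameters and samples for which the laws of large numbers hold at rate `n ^ (s - 1/2)`,
along all the iterated derivatives of the coefficients. -/
structure Typical (s : ℝ) (c : ℕ → ℝ) (w2 : Fin N₁ → ℕ → ℝ)
    (w : Fin N₁ → EuclideanSpace ℝ (Fin d)) (p : ℕ → EuclideanSpace ℝ (Fin d) × ℝ) : Prop where
  bounded : ∃ R, ∀ i, ‖(c i, fun j => w2 j i)‖ ≤ R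
  sample : ∀ k, ∃ i, p k = (S.x i, S.y i)
  weight : ∀ i, (fun n : ℕ => ∑ k ∈ Finset.range n, (S.dataWeight (p k) i - 1 / (M : ℝ)))
    =O[atTop] fun n => (n : ℝ) ^ (1 / 2 + s)
  init : ∀ b l, (fun n : ℕ => ∑ i ∈ Finset.range n,
    (S.system.word b l (unitParam w (c i, fun j => w2 j i)) - S.mean w (S.system.word b l)))
    =O[atTop] fun n => (n : ℝ) ^ (1 / 2 + s)

/-- The units of the network with `N` units, after `k` steps of training. -/
noncomputable def units (c : ℕ → ℝ) (w2 : Fin N₁ → ℕ → ℝ)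
    (w : Fin N₁ → EuclideanSpace ℝ (Fin d)) (p : ℕ → EuclideanSpace ℝ (Fin d) × ℝ)
    (N k : ℕ) : Fin N → UnitParam d N₁ :=
  (S.sgd (N₂ := N) ⟨fun i => c i, fun j i => w2 j i, w⟩ p k).unit

/-- The rescaled output `N^{-1/2} ∑_i C^i σ(Z^{2,i}(x))` at initialization. -/
noncomputable def initSum (c : ℕ → ℝ) (w2 : Fin N₁ → ℕ → ℝ)
    (w : Fin N₁ → EuclideanSpace ℝ (Fin d)) (N : ℕ) (k : Fin M) : ℝ :=
  (N : ℝ) ^ (-(1 / 2) : ℝ) * ∑ i ∈ Finset.range N,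
    S.system.F k (unitParam w (c i, fun j => w2 j i))

variable {S} {s T : ℝ} {c : ℕ → ℝ} {w2 : Fin N₁ → ℕ → ℝ}
  {w : Fin N₁ → EuclideanSpace ℝ (Fin d)} {p : ℕ → EuclideanSpace ℝ (Fin d) × ℝ}

theorem particleMean_units_zero (N : ℕ) (f : UnitParam d N₁ → ℝ) :
    particleMean (S.units c w2 w p N 0) f =
      (N : ℝ)⁻¹ * ∑ i ∈ Finset.range N, f (unitParam w (c i, fun j => w2 j i)) := by
  rw [particleMean, Finset.sum_range]
  rfl

/-- The scales are ε = N^(γ₂-1) and δ = N^(-1/2+s), and `s < γ₂ - 1/2` says exactly that δ/ε tends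
to zero. From here on the analysis of a typical realisation is deterministic. -/
theorem Typical.isTraining (ty : S.Typical s c w2 w p) (hS : S.Regular) (hN₁ : 0 < N₁)
    (hT : 0 < T) (hγ : S.γ₂ < 1) (hs : 0 < s) (hsγ : s < S.γ₂ - 1 / 2) :
    S.system.IsTraining T (1 / (M : ℝ)) (fun N => (N : ℝ) ^ (S.γ₂ - 1))
      (fun N => (N : ℝ) ^ (-(1 / 2) + s)) (range fun q : _ × _ => S.system.word q.1 q.2) (S.mean w)
      (fun k => S.dataWeight (p k)) (S.units c w2 w p) where
  T_pos := hT
  step N k n := by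
    obtain ⟨i, hi⟩ := ty.sample k
    have := unit_sgdStep (S := S) hN₁ n.pos (S.sgd (N₂ := N) ⟨fun i => c i, fun j i => w2 j i, w⟩ p k) n i
    rw [← hi] at this
    exact this
  eps_pos := eventually_natCast_pos.mono fun N hN => Real.rpow_pos_of_pos hN _
  eps_tendsto := tendsto_natCast_rpow_of_neg (by linarith)
  delta_tendsto := by
    refine (tendsto_natCast_rpow_of_neg (a := -(1 / 2) + s - (S.γ₂ - 1)) (by linarith)).congr' ?_
    filter_upwards [eventually_natCast_pos] with N hN
    rw [Real.rpow_sub hN]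
  inv_le_delta := by
    filter_upwards [eventually_ge_atTop 1] with N hN
    have hN' : (1 : ℝ) ≤ N := by exact_mod_cast hN
    rw [← Real.rpow_neg_one]
    exact Real.rpow_le_rpow_of_exponent_le hN' (by linarith)
  weight_mem k i := dataWeight_mem _ _
  weight_sum := by
    have h1 : ∀ i, ∃ C > 0, ∀ n : ℕ, |∑ k ∈ Finset.range n, (S.dataWeight (p k) i - 1 / (M : ℝ))| ≤
        C * (n : ℝ) ^ (1 / 2 + s) := by
      intro i
      obtain ⟨C, hC, h⟩ := Asymptotics.bound_of_isBigO_nat_atTop (ty.weight i)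
      refine ⟨C, hC, fun n => ?_⟩
      -- The global bound extracted from `=O` is only available where the comparison value is
      -- nonzero, so `n = 0` is treated apart.
      rcases Nat.eq_zero_or_pos n with rfl | hn
      · simp only [Finset.range_zero, Finset.sum_empty, abs_zero]
        positivity
      have hn' : (0 : ℝ) < n := by exact_mod_cast hn
      have h2 := h (x := n) (Real.rpow_pos_of_pos hn' _).ne'
      rwa [Real.norm_eq_abs, Real.norm_eq_abs, abs_of_pos (Real.rpow_pos_of_pos hn' _)] at h2
    choose C hC h using h1
    refine ⟨(∑ i, C i) * T ^ (1 / 2 + s), ?_⟩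
    filter_upwards [eventually_natCast_pos] with N hN k hk i
    have h3 : C i ≤ ∑ i, C i := Finset.single_le_sum (fun i _ => (hC i).le) (Finset.mem_univ i)
    have h4 : (N : ℝ) * (N : ℝ) ^ (-(1 / 2) + s) = (N : ℝ) ^ (1 / 2 + s) := by
      rw [← Real.rpow_one_add' hN.le (by linarith)]
      congr 1
      ring
    calc _ ≤ C i * (k : ℝ) ^ (1 / 2 + s) := h i k
      _ ≤ (∑ i, C i) * ((N : ℝ) * T) ^ (1 / 2 + s) :=
          mul_le_mul h3 (Real.rpow_le_rpow (Nat.cast_nonneg _) hk (by linarith)) (by positivity)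
            (Finset.sum_nonneg fun i _ => (hC i).le)
      _ = _ := by rw [Real.mul_rpow hN.le hT.le, h4]; ring
  smooth f hf := by
    obtain ⟨q, rfl⟩ := hf
    exact (ParticleSystem.contDiff_word (contDiff_system_F hS.act_smooth)
      (contDiff_system_D hS.act_smooth) (contDiff_system_v hS.act_smooth) q.1 q.2).of_le
      (WithTop.coe_le_coe.2 le_top)
  continuous_v i a := (contDiff_system_v hS.act_smooth i a).continuous
  lie_mem f hf i a := by
    obtain ⟨q, rfl⟩ := hf
    exact ⟨(q.1, (i, a) :: q.2), rfl⟩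
  D_mem i a := ⟨(Sum.inr (i, a), []), rfl⟩
  F_mem i := ⟨(Sum.inl i, []), rfl⟩
  init f hf := by
    obtain ⟨q, rfl⟩ := hf
    have h1 := (Asymptotics.isBigO_refl (fun N : ℕ => (N : ℝ)⁻¹) atTop).mul (ty.init q.1 q.2)
    refine h1.congr' ?_ ?_
    · filter_upwards [eventually_natCast_pos] with N hN
      rw [particleMean_units_zero, Finset.sum_sub_distrib, Finset.sum_const, Finset.card_range,
        nsmul_eq_mul, mul_sub, inv_mul_cancel_left₀ hN.ne']
    · filter_upwards [eventually_natCast_pos] with N hN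
      rw [← Real.rpow_neg_one, ← Real.rpow_add hN]
      congr 1
      ring
  mean_F := hS.mean_F w
  bounded := by
    obtain ⟨R, hR⟩ := ty.bounded
    refine ⟨max R ‖w‖, fun N n => ?_⟩
    have h1 := hR n
    rw [Prod.norm_def, max_le_iff] at h1
    change ‖((c n, (fun j => w2 j n), w) : UnitParam d N₁)‖ ≤ _
    rw [Prod.norm_def, Prod.norm_def]
    exact max_le (h1.1.trans (le_max_left _ _))
      (max_le (h1.2.trans (le_max_left _ _)) (le_max_right _ _))

theorem out_units_zero {N : ℕ} (hN : 0 < N) (k : Fin M) :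
    S.system.out ((N : ℝ) ^ (S.γ₂ - 1)) (S.units c w2 w p N 0) k =
      (N : ℝ) ^ (1 / 2 - S.γ₂) * S.initSum c w2 w N k := by
  have hN' : (0 : ℝ) < N := by exact_mod_cast hN
  rw [ParticleSystem.out, particleMean_units_zero, initSum, ← mul_assoc, ← mul_assoc,
    ← Real.rpow_add hN', ← mul_inv, ← Real.rpow_add_one hN'.ne', ← Real.rpow_neg hN'.le]
  congr 2
  ring

theorem Typical.initSum_isBigO (ty : S.Typical s c w2 w p) (hS : S.Regular) (k : Fin M) :
    (fun N => S.initSum c w2 w N k) =O[atTop] fun N : ℕ => (N : ℝ) ^ s := by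
  have h1 := (Asymptotics.isBigO_refl (fun N : ℕ => (N : ℝ) ^ (-(1 / 2) : ℝ)) atTop).mul
    (ty.init (Sum.inl k) [])
  refine h1.congr' ?_ ?_
  · refine Eventually.of_forall fun N => ?_
    have : S.mean w (S.system.word (Sum.inl k) []) = 0 := hS.mean_F w k
    simp only [this, sub_zero]
    rfl
  · filter_upwards [eventually_natCast_pos] with N hN
    rw [← Real.rpow_add hN]
    congr 1
    ring

/-- The homogeneous solution is linear in its initial value, so unit vectors suffice. Uniformity in
`ψ₀` is essential, as the bound is applied to initial sums that change with N. -/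
theorem Regular.exists_limitSecond_le (hS : S.Regular) (w : Fin N₁ → EuclideanSpace ℝ (Fin d))
    (T : ℝ) : ∃ B, ∀ t ∈ Icc 0 T, ∀ (ψ₀ : Fin M → ℝ) k, |S.limitSecond 0 w ψ₀ t k| ≤ B * ∑ i, |ψ₀ i| := by
  have h1 : ∀ i : Fin M, ∃ B, ∀ t ∈ Icc 0 T, ‖S.limitSecond 0 w (Pi.single i 1) t‖ ≤ B := fun i =>
    isCompact_Icc.exists_bound_of_continuousOn
      (hS.continuous_limitSecond_path 0 w (Pi.single i 1)).continuousOn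
  choose B hB using h1
  have hadd : ∀ (t : ℝ) (a : Fin M → ℝ), S.limitSecond 0 w a t =
      ∑ i, a i • S.limitSecond 0 w (Pi.single i 1) t := by
    intro t a
    have hlin : ∀ ψ, S.limitSecond 0 w ψ t =
        NormedSpace.exp (t • -matrixCLM (S.kernelMatrix w)) ψ := by
      intro ψ
      simp [limitSecond, solution, linearODE]
    simp only [hlin, ← map_smul, ← map_sum]
    congr 1
    exact (pi_eq_sum_univ' a).trans (Finset.sum_congr rfl fun i _ => by
      congr 1)
  refine ⟨∑ i, |B i|, fun t ht ψ₀ k => ?_⟩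
  rw [hadd, Finset.sum_apply, Finset.mul_sum]
  refine (Finset.abs_sum_le_sum_abs _ _).trans (Finset.sum_le_sum fun i _ => ?_)
  rw [Pi.smul_apply, smul_eq_mul, abs_mul, mul_comm]
  refine mul_le_mul_of_nonneg_right ?_ (abs_nonneg _)
  calc _ ≤ ‖S.limitSecond 0 w (Pi.single i 1) t‖ := norm_le_pi_norm _ k
    _ ≤ |B i| := (hB i t ht).trans (le_abs_self _)
    _ ≤ _ := Finset.single_le_sum (f := fun i => |B i|) (fun i _ => abs_nonneg _) (Finset.mem_univ i)

/-- The factor of the Gaussian initial value in the limit. -/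
noncomputable def initFactor (S : TwoLayerNet d N₁ M) (ζ : ℝ) : ℝ :=
  open scoped Classical in if ζ = S.γ₂ - 1 / 2 then 1 else 0

/-- The factor of the source in the limit. -/
noncomputable def sourceFactor (S : TwoLayerNet d N₁ M) (ζ : ℝ) : ℝ :=
  open scoped Classical in if ζ = 2 - 2 * S.γ₂ then 1 else 0

/-- The second order fluctuations stay close to the solution of the limiting equation whose initial
value is the rescaled initial output. -/
theorem Typical.fluctuation_sub (ty : S.Typical s c w2 w p) (hS : S.Regular) (hN₁ : 0 < N₁)
    (hT : 0 < T) (hγ : S.γ₂ < 1) (hs : 0 < s) (hsγ : s < S.γ₂ - 1 / 2) (hsγ' : s < 1 - S.γ₂)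
    {ζ : ℝ} (hζ₁ : ζ ≤ S.γ₂ - 1 / 2) (hζ₂ : ζ ≤ 2 - 2 * S.γ₂)
    (hsζ : ζ ≠ S.γ₂ - 1 / 2 → s < S.γ₂ - 1 / 2 - ζ) {η : ℝ} (hη : 0 < η) :
    ∀ᶠ N : ℕ in atTop, ∀ t ∈ Icc 0 T, ∀ k,
      |S.fluctuation₂ ζ N c w2 w p (S.limitOutput w) (S.limitFluctuation w) t k -
        S.limitSecond (S.sourceFactor ζ) w (S.initFactor ζ • S.initSum c w2 w N) t k| ≤ η := by
  have tr := ty.isTraining hS hN₁ hT hγ hs hsγ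
  have main : ∀ k, ∃ C, ∀ᶠ N : ℕ in atTop, ∀ t ∈ Icc 0 T,
      |S.outputPath N c w2 w p t k - (S.limitOutput w t k +
        (N : ℝ) ^ (S.γ₂ - 1) * S.limitFluctuation w t k +
        ((N : ℝ) ^ (S.γ₂ - 1)) ^ 2 * S.limitSecond 1 w 0 t k +
        S.limitSecond 0 w (S.system.out ((N : ℝ) ^ (S.γ₂ - 1)) (S.units c w2 w p N 0)) t k)| ≤
        C * (((N : ℝ) ^ (S.γ₂ - 1)) ^ 3 + (N : ℝ) ^ (-(1 / 2) + s)) := by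
    intro k
    have h1 := tr.outPath_sub_second (hS.continuous_limitOutput_path w)
      (hS.continuous_limitFluctuation_path w) (hS.continuous_limitSecond_path 1 w 0)
      (V := fun N => S.limitSecond 0 w (S.system.out ((N : ℝ) ^ (S.γ₂ - 1)) (S.units c w2 w p N 0)))
      (fun N => hS.continuous_limitSecond_path 0 w _)
      (fun t _ k => limitOutput_eq_lin w t k) (fun t _ k => hS.limitFluctuation_eq_quad w t k)
      (fun t _ k => by
        rw [hS.limitSecond_eq]
        simp only [Pi.zero_apply, zero_add, one_mul])
      (fun N t _ k => by
        rw [hS.limitSecond_eq]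
        simp only [zero_mul, zero_sub, Finset.sum_neg_distrib, mul_neg,
          intervalIntegral.integral_neg, ← sub_eq_add_neg]) k
    obtain ⟨C, hC⟩ := (isBigO_uniformlyOn_iff (a := fun N : ℕ =>
      ((N : ℝ) ^ (S.γ₂ - 1)) ^ 3 + (N : ℝ) ^ (-(1 / 2) + s))).1 h1
    refine ⟨C, ?_⟩
    filter_upwards [hC, eventually_gt_atTop 0] with N hN hN0 t ht
    have h2 := hN t ht
    rw [abs_of_nonneg (a := _ + _) (by positivity)] at h2
    have h3 : ParticleSystem.IsTraining.outPath S.system (fun N : ℕ => (N : ℝ) ^ (S.γ₂ - 1))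
        (S.units c w2 w p) k (N, t) = S.outputPath N c w2 w p t k :=
      out_eq_output hN0 _ k
    rwa [h3] at h2
  choose C hC using main
  obtain ⟨B, hB⟩ := hS.exists_limitSecond_le w T
  obtain ⟨B', hB'⟩ := isCompact_Icc.exists_bound_of_continuousOn (s := Icc 0 T)
    (hS.continuous_limitSecond_path 1 w 0).continuousOn
  -- The remainder times `N ^ ζ`: the exponents are at most `γ₂ - 1` and `γ₂ - 1 + s`, negative
  -- because `s < 1 - γ₂`.
  have t1 : Tendsto (fun N : ℕ => (∑ k, |C k|) * ((N : ℝ) ^ (ζ + 3 * (S.γ₂ - 1)) +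
      (N : ℝ) ^ (ζ - 1 / 2 + s))) atTop (𝓝 0) := by
    simpa using ((tendsto_natCast_rpow_of_neg (by linarith)).add
      (tendsto_natCast_rpow_of_neg (by linarith))).const_mul (∑ k, |C k|)
  have t2 : Tendsto (fun N : ℕ => |(N : ℝ) ^ (ζ - (2 - 2 * S.γ₂)) - S.sourceFactor ζ| * B')
      atTop (𝓝 0) := by
    have h0 : Tendsto (fun N : ℕ => (N : ℝ) ^ (ζ - (2 - 2 * S.γ₂)) - S.sourceFactor ζ)
        atTop (𝓝 0) := by
      rcases eq_or_ne ζ (2 - 2 * S.γ₂) with h | h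
      · simp [sourceFactor, h]
      · have := tendsto_natCast_rpow_of_neg (sub_neg.2 (lt_of_le_of_ne hζ₂ h))
        simpa [sourceFactor, h] using this
    simpa using h0.abs.mul_const B'
  -- In the critical case the difference is identically zero, so no bound on the initial sums is
  -- needed. Otherwise they grow at most like `N ^ s`, which the choice of `s` beats.
  have t3 : Tendsto (fun N : ℕ => |(N : ℝ) ^ (ζ - (S.γ₂ - 1 / 2)) - S.initFactor ζ| *
      (B * ∑ i, |S.initSum c w2 w N i|)) atTop (𝓝 0) := by
    rcases eq_or_ne ζ (S.γ₂ - 1 / 2) with h | h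
    · simp [initFactor, h]
    · have h0 : ∀ i, Tendsto (fun N : ℕ => (N : ℝ) ^ (ζ - (S.γ₂ - 1 / 2)) *
          S.initSum c w2 w N i) atTop (𝓝 0) := by
        intro i
        have h1 := (Asymptotics.isBigO_refl (fun N : ℕ => (N : ℝ) ^ (ζ - (S.γ₂ - 1 / 2)))
          atTop).mul (ty.initSum_isBigO hS i)
        have h3 := hsζ h
        refine h1.trans_tendsto ((tendsto_natCast_rpow_of_neg
          (a := ζ - (S.γ₂ - 1 / 2) + s) (by linarith)).congr' ?_)
        filter_upwards [eventually_natCast_pos] with N hN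
        rw [Real.rpow_add hN]
      have h2 : Tendsto (fun N : ℕ => B * ∑ i, |(N : ℝ) ^ (ζ - (S.γ₂ - 1 / 2)) *
          S.initSum c w2 w N i|) atTop (𝓝 0) := by
        simpa using (tendsto_finsetSum Finset.univ fun i _ => (h0 i).abs).const_mul B
      refine h2.congr fun N => ?_
      simp only [initFactor, h, if_false, sub_zero, abs_mul, ← Finset.mul_sum]
      ring
  have t := (t1.add t2).add t3
  simp only [add_zero] at t
  filter_upwards [t.eventually (gt_mem_nhds hη), eventually_all.2 hC, eventually_gt_atTop 0]
    with N hN hCN hN0 t ht k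
  have hN' : (0 : ℝ) < N := by exact_mod_cast hN0
  have e0 : (N : ℝ) ^ (ζ - S.φ) * (N : ℝ) ^ S.φ = (N : ℝ) ^ ζ := by
    rw [← Real.rpow_add hN', sub_add_cancel]
  have e1 : (N : ℝ) ^ (ζ - S.φ) = (N : ℝ) ^ ζ * (N : ℝ) ^ (S.γ₂ - 1) := by
    rw [← Real.rpow_add hN', φ]
    congr 1
    ring
  have e2 : (N : ℝ) ^ ζ * ((N : ℝ) ^ (S.γ₂ - 1)) ^ 2 = (N : ℝ) ^ (ζ - (2 - 2 * S.γ₂)) := by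
    rw [← Real.rpow_natCast ((N : ℝ) ^ (S.γ₂ - 1)), ← Real.rpow_mul hN'.le, ← Real.rpow_add hN']
    congr 1
    push_cast
    ring
  have e3 : (N : ℝ) ^ ζ * ((N : ℝ) ^ (S.γ₂ - 1)) ^ 3 = (N : ℝ) ^ (ζ + 3 * (S.γ₂ - 1)) := by
    rw [← Real.rpow_natCast ((N : ℝ) ^ (S.γ₂ - 1)), ← Real.rpow_mul hN'.le, ← Real.rpow_add hN']
    congr 1
    push_cast
    ring
  have e4 : (N : ℝ) ^ ζ * (N : ℝ) ^ (-(1 / 2) + s) = (N : ℝ) ^ (ζ - 1 / 2 + s) := by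
    rw [← Real.rpow_add hN']
    congr 1
    ring
  have e5 : (N : ℝ) ^ ζ * (N : ℝ) ^ (1 / 2 - S.γ₂) = (N : ℝ) ^ (ζ - (S.γ₂ - 1 / 2)) := by
    rw [← Real.rpow_add hN']
    congr 1
    ring
  have hV : S.system.out ((N : ℝ) ^ (S.γ₂ - 1)) (S.units c w2 w p N 0) =
      (N : ℝ) ^ (1 / 2 - S.γ₂) • S.initSum c w2 w N := funext fun k => out_units_zero hN0 k
  have hV' : ∀ a : ℝ, S.limitSecond 0 w (a • S.initSum c w2 w N) t k =
      a * S.limitSecond 0 w (S.initSum c w2 w N) t k := by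
    intro a
    rw [limitSecond_smul_add]
    simp
  have h1 := hCN k t ht
  rw [hV, hV'] at h1
  rw [limitSecond_smul_add, Pi.add_apply, Pi.smul_apply, Pi.smul_apply, smul_eq_mul, smul_eq_mul,
    fluctuation₂, fluctuation₁]
  set H := S.limitOutput w t k
  set κ := S.limitFluctuation w t k
  set U := S.limitSecond 1 w 0 t k with hU
  set V := S.limitSecond 0 w (S.initSum c w2 w N) t k with hVdef
  set g := S.outputPath N c w2 w p t k
  have hU' : |U| ≤ B' := (norm_le_pi_norm (S.limitSecond 1 w 0 t) k).trans (hB' t ht)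
  have hVb : |V| ≤ B * ∑ i, |S.initSum c w2 w N i| := hB t ht _ k
  -- The fluctuation is `N ^ ζ * (g - H - ε κ)`; the expansion of `g` is inserted, and what remains
  -- is its error and the deviations of the two powers of `N` from their limits.
  have split : (N : ℝ) ^ (ζ - S.φ) * ((N : ℝ) ^ S.φ * (g - H) - κ) -
      (S.initFactor ζ * V + S.sourceFactor ζ * U) =
      (N : ℝ) ^ ζ * (g - (H + (N : ℝ) ^ (S.γ₂ - 1) * κ + ((N : ℝ) ^ (S.γ₂ - 1)) ^ 2 * U +
        (N : ℝ) ^ (1 / 2 - S.γ₂) * V)) +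
      ((N : ℝ) ^ (ζ - (2 - 2 * S.γ₂)) - S.sourceFactor ζ) * U +
      ((N : ℝ) ^ (ζ - (S.γ₂ - 1 / 2)) - S.initFactor ζ) * V := by
    rw [← e2, ← e5]
    linear_combination (g - H) * e0 - κ * e1
  rw [split]
  have hCk : C k ≤ ∑ k, |C k| := (le_abs_self _).trans
    (Finset.single_le_sum (f := fun k => |C k|) (fun _ _ => abs_nonneg _) (Finset.mem_univ k))
  refine (abs_add_three _ _ _).trans (le_trans ?_ hN.le)
  simp only [abs_mul]
  refine add_le_add (add_le_add ?_ ?_) ?_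
  · rw [abs_of_pos (Real.rpow_pos_of_pos hN' ζ), ← e3, ← e4, ← mul_add, mul_left_comm]
    refine mul_le_mul_of_nonneg_left (h1.trans ?_) (by positivity)
    exact mul_le_mul_of_nonneg_right hCk (by positivity)
  · exact mul_le_mul_of_nonneg_left hU' (abs_nonneg _)
  · exact mul_le_mul_of_nonneg_left hVb (abs_nonneg _)

end TwoLayerNet

end SmoothCoefficients

/-! ### Sums of bounded independent random variables -/

theorem summable_exp_neg_mul_natCast_rpow {a b : ℝ} (ha : 0 < a) (hb : 0 < b) :
    Summable fun n : ℕ => Real.exp (-a * (n : ℝ) ^ b) := by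
  have h1 : Tendsto (fun n : ℕ => (n : ℝ) ^ b) atTop atTop :=
    (tendsto_rpow_atTop hb).comp tendsto_natCast_atTop_atTop
  have h2 := ((isLittleO_exp_neg_mul_rpow_atTop ha (-2 / b)).comp_tendsto h1).isBigO
  refine summable_of_isBigO_nat (Real.summable_nat_rpow.2 (by norm_num : (-2 : ℝ) < -1)) ?_
  refine h2.congr (fun _ => rfl) fun n => ?_
  rw [Function.comp_apply, ← Real.rpow_mul (Nat.cast_nonneg n), mul_div_cancel₀ _ hb.ne']

/-- The sub-Gaussian tail at level n^(1/2+s) is exp(-n^(2s)/(2c)), which is summable; Borel–Cantelli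
concludes. -/
theorem ae_eventually_sum_lt {Ω : Type*} [MeasurableSpace Ω] {P : Measure Ω}
    [IsProbabilityMeasure P] {X : ℕ → Ω → ℝ} {c : NNReal} (hX : iIndepFun X P)
    (hc : 0 < c) (hsub : ∀ i, HasSubgaussianMGF (X i) c P) {s : ℝ} (hs : 0 < s) :
    ∀ᵐ ω ∂P, ∀ᶠ n : ℕ in atTop, ∑ i ∈ Finset.range n, X i ω < (n : ℝ) ^ (1 / 2 + s) := by
  have h1 : ∀ᶠ n : ℕ in atTop, P.real {ω | (n : ℝ) ^ (1 / 2 + s) ≤ ∑ i ∈ Finset.range n, X i ω} ≤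
      Real.exp (-(1 / (2 * c)) * (n : ℝ) ^ (2 * s)) := by
    filter_upwards [eventually_gt_atTop 0] with n hn
    have hn' : (0 : ℝ) < n := by exact_mod_cast hn
    refine (HasSubgaussianMGF.measure_sum_range_ge_le_of_iIndepFun hX (fun i _ => hsub i)
      (Real.rpow_nonneg hn'.le _)).trans (le_of_eq ?_)
    congr 1
    have : ((n : ℝ) ^ (1 / 2 + s)) ^ 2 = n * (n : ℝ) ^ (2 * s) := by
      rw [← Real.rpow_natCast, ← Real.rpow_mul hn'.le, ← Real.rpow_one_add' hn'.le (by positivity)]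
      congr 1
      push_cast
      ring
    have hc' : (0 : ℝ) < c := by exact_mod_cast hc
    rw [this]
    field_simp
  have h2 : Summable fun n : ℕ => P.real {ω | (n : ℝ) ^ (1 / 2 + s) ≤ ∑ i ∈ Finset.range n, X i ω} :=
    summable_of_isBigO_nat (summable_exp_neg_mul_natCast_rpow
      (by positivity : (0 : ℝ) < 1 / (2 * c)) (by positivity : 0 < 2 * s))
      (Asymptotics.IsBigO.of_bound 1 (h1.mono fun n hn => by
        rwa [Real.norm_of_nonneg measureReal_nonneg, Real.norm_of_nonneg (Real.exp_pos _).le,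
          one_mul]))
  have h3 : ∑' n : ℕ, P {ω | (n : ℝ) ^ (1 / 2 + s) ≤ ∑ i ∈ Finset.range n, X i ω} ≠ ⊤ := by
    have := h2.tsum_ofReal_ne_top
    simpa using this
  filter_upwards [ae_eventually_notMem h3] with ω hω
  exact hω.mono fun n hn => not_le.1 hn

theorem ae_isBigO_sum {Ω : Type*} [MeasurableSpace Ω] {P : Measure Ω} [IsProbabilityMeasure P]
    {X : ℕ → Ω → ℝ} (hX : iIndepFun X P) (hm : ∀ i, AEMeasurable (X i) P) {B : ℝ}
    (hB : ∀ i, ∀ᵐ ω ∂P, |X i ω| ≤ B) (h0 : ∀ i, ∫ ω, X i ω ∂P = 0) {s : ℝ} (hs : 0 < s) :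
    ∀ᵐ ω ∂P, (fun n => ∑ i ∈ Finset.range n, X i ω) =O[atTop] fun n : ℕ => (n : ℝ) ^ (1 / 2 + s) := by
  -- The `+ 1` keeps the sub-Gaussian constant positive even when `B = 0`.
  set b := |B| + 1
  have hb : 0 < b := by positivity
  have hsub : ∀ i, HasSubgaussianMGF (X i) ((‖b - -b‖₊ / 2) ^ 2) P := by
    intro i
    have := hasSubgaussianMGF_of_mem_Icc (hm i) (a := -b) (b := b) ((hB i).mono fun ω hω =>
      abs_le.1 (hω.trans ((le_abs_self B).trans (le_add_of_nonneg_right zero_le_one))))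
    simpa [h0] using this
  have hc : (0 : NNReal) < (‖b - -b‖₊ / 2) ^ 2 := by
    have : b - -b ≠ 0 := by linarith
    have := nnnorm_pos.2 this
    positivity
  have hX' : iIndepFun (fun i => -X i) P := hX.comp (fun _ x => -x) fun _ => measurable_neg
  filter_upwards [ae_eventually_sum_lt hX hc hsub hs,
    ae_eventually_sum_lt hX' hc (fun i => (hsub i).neg) hs] with ω h1 h2
  refine Asymptotics.IsBigO.of_bound 1 ?_
  filter_upwards [h1, h2] with n h1 h2
  simp only [Pi.neg_apply, Finset.sum_neg_distrib] at h2
  rw [one_mul, Real.norm_eq_abs]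
  exact (abs_lt.2 ⟨by linarith, h1⟩).le.trans (le_abs_self _)

/-! ### Blocks of independent random variables -/

/-- Independence means that the joint law is a product measure, and a product over pairs is a
product over the first index of products over the second. -/
theorem iIndepFun_curry {Ω κ ι 𝓧 : Type*} [MeasurableSpace Ω] [MeasurableSpace 𝓧] {P : Measure Ω}
    [IsProbabilityMeasure P] {X : ι × κ → Ω → 𝓧} (hm : ∀ q, Measurable (X q)) (h : iIndepFun X P) :
    iIndepFun (fun i ω k => X (i, k) ω) P := by
  have hp : ∀ i k, IsProbabilityMeasure (P.map (X (i, k))) :=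
    fun i k => Measure.isProbabilityMeasure_map (hm _).aemeasurable
  have hk : ∀ i, iIndepFun (fun k => X (i, k)) P :=
    fun i => h.precomp (g := fun k => (i, k)) (Prod.mk_right_injective i)
  have h1 : P.map (fun ω (q : (_ : ι) × κ) => X (q.1, q.2) ω) =
      Measure.infinitePi fun q : (_ : ι) × κ => P.map (X (q.1, q.2)) := by
    refine (iIndepFun_iff_map_fun_eq_infinitePi_map (fun q => hm _)).1
      (h.precomp (g := fun q : (_ : ι) × κ => (q.1, q.2)) ?_)
    exact (Equiv.sigmaEquivProd ι κ).injective
  rw [iIndepFun_iff_map_fun_eq_infinitePi_map (fun i => measurable_pi_lambda _ fun k => hm _)]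
  have h2 := Measure.infinitePi_map_piCurry (fun i k => P.map (X (i, k)))
  rw [← h1, Measure.map_map (by fun_prop) (by fun_prop)] at h2
  refine h2.trans ?_
  congr 1
  funext i
  rw [(iIndepFun_iff_map_fun_eq_infinitePi_map fun k => hm _).1 (hk i)]

theorem indepFun_of_iIndep {Ω ι β γ : Type*} {mΩ : MeasurableSpace Ω} {P : Measure Ω}
    [mβ : MeasurableSpace β] [mγ : MeasurableSpace γ] {m : ι → MeasurableSpace Ω} (hm : ∀ i, m i ≤ mΩ)
    (h : iIndep m P) {A B : Set ι} (hAB : Disjoint A B) {f : Ω → β} {g : Ω → γ}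
    (hf : Measurable[⨆ i ∈ A, m i] f) (hg : Measurable[⨆ i ∈ B, m i] g) : IndepFun f g P :=
  (IndepFun_iff_Indep f g P).2 (indep_of_indep_of_le_left (indep_of_indep_of_le_right
    (indep_iSup_of_disjoint hm h hAB) hg.comap_le) hf.comap_le)

theorem measurable_biSup_of_mem {Ω ι β : Type*} [mβ : MeasurableSpace β] {m : ι → MeasurableSpace Ω}
    {A : Set ι} {i : ι} (hi : i ∈ A) {f : Ω → β} (hf : MeasurableSpace.comap f mβ = m i) :
    Measurable[⨆ i ∈ A, m i] f :=
  measurable_iff_comap_le.2 (hf.le.trans (le_iSup₂_of_le i hi le_rfl))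

/-! ### Laws and independence of the initial parameters -/

namespace TwoLayerNet

variable {d N₁ M : ℕ} {S : TwoLayerNet d N₁ M} {Ω : Type*} [MeasurableSpace Ω] {P : Measure Ω}
  [IsProbabilityMeasure P] {C : ℕ → Ω → ℝ} {W2 : Fin N₁ → ℕ → Ω → ℝ}
  {W1 : Fin N₁ → Ω → EuclideanSpace ℝ (Fin d)} {p : ℕ → Ω → EuclideanSpace ℝ (Fin d) × ℝ}

namespace Assumptions

theorem regular (hS : S.Assumptions P C W2 W1 p) (hN₁ : 0 < N₁) : S.Regular where
  act_smooth := hS.act_smooth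
  probC := by
    rw [← (hS.hasLawC 0).map_eq]
    exact Measure.isProbabilityMeasure_map (hS.measurableC 0).aemeasurable
  probW2 := by
    rw [← (hS.hasLawW2 ⟨0, hN₁⟩ 0).map_eq]
    exact Measure.isProbabilityMeasure_map (hS.measurableW2 _ 0).aemeasurable
  compactC := hS.compactC
  compactW2 := hS.compactW2
  meanC := hS.meanC

/-- The σ-algebras of the initial parameters and of the samples. -/
abbrev σAlg (C : ℕ → Ω → ℝ) (W2 : Fin N₁ → ℕ → Ω → ℝ) (W1 : Fin N₁ → Ω → EuclideanSpace ℝ (Fin d))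
    (p : ℕ → Ω → EuclideanSpace ℝ (Fin d) × ℝ) :
    ℕ ⊕ (Fin N₁ × ℕ) ⊕ Fin N₁ ⊕ ℕ → MeasurableSpace Ω :=
  Sum.elim (fun i : ℕ => MeasurableSpace.comap (C i) inferInstance)
      (Sum.elim (fun q : Fin N₁ × ℕ => MeasurableSpace.comap (W2 q.1 q.2) inferInstance)
        (Sum.elim (fun j : Fin N₁ => MeasurableSpace.comap (W1 j) inferInstance)
          (fun k : ℕ => MeasurableSpace.comap (p k) inferInstance)))

theorem σAlg_le (hS : S.Assumptions P C W2 W1 p) (i) : σAlg C W2 W1 p i ≤ ‹MeasurableSpace Ω› := by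
  rcases i with i | i | i | i
  exacts [(hS.measurableC i).comap_le, (hS.measurableW2 _ _).comap_le,
    (hS.measurableW1 i).comap_le, (hS.measurable_sample i).comap_le]

theorem iIndepFun_sample (hS : S.Assumptions P C W2 W1 p) : iIndepFun p P :=
  (iIndepFun_iff_iIndep _ _ _).2
    (hS.independent.precomp (g := fun k => Sum.inr (Sum.inr (Sum.inr k)))
      fun a b h => by simpa using h)

theorem iIndepFun_W1 (hS : S.Assumptions P C W2 W1 p) : iIndepFun W1 P :=
  (iIndepFun_iff_iIndep _ _ _).2
    (hS.independent.precomp (g := fun k => Sum.inr (Sum.inr (Sum.inl k)))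
      fun a b h => by simpa using h)

theorem map_W1 (hS : S.Assumptions P C W2 W1 p) :
    P.map (fun ω j => W1 j ω) = Measure.pi fun _ => S.lawW1 := by
  rw [hS.iIndepFun_W1.map_fun_eq_pi_map fun j => (hS.measurableW1 j).aemeasurable]
  simp only [(hS.hasLawW1 _).map_eq]

/-- The initial parameters of the `i`-th unit of the second layer. -/
def initUnit (C : ℕ → Ω → ℝ) (W2 : Fin N₁ → ℕ → Ω → ℝ) (i : ℕ) (ω : Ω) : ℝ × (Fin N₁ → ℝ) :=
  (C i ω, fun j => W2 j i ω)

theorem measurable_initUnit (hS : S.Assumptions P C W2 W1 p) (i : ℕ) :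
    Measurable (initUnit C W2 i) :=
  (hS.measurableC i).prodMk (measurable_pi_lambda _ fun j => hS.measurableW2 j i)

theorem map_initUnit (hS : S.Assumptions P C W2 W1 p) (i : ℕ) :
    P.map (initUnit C W2 i) = S.initLaw := by
  have h1 : iIndepFun (fun j => W2 j i) P := (iIndepFun_iff_iIndep _ _ _).2
    (hS.independent.precomp (g := fun j => Sum.inr (Sum.inl (j, i))) fun a b h => by simpa using h)
  have h2 : IndepFun (C i) (fun ω j => W2 j i ω) P := by
    refine indepFun_of_iIndep hS.σAlg_le hS.independent (A := {Sum.inl i})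
      (B := range fun j => Sum.inr (Sum.inl (j, i))) ?_ ?_ ?_
    · rw [Set.disjoint_singleton_left]
      simp
    · exact measurable_biSup_of_mem (mem_singleton _) rfl
    · refine @measurable_pi_lambda _ _ _ (_) _ _ fun j => ?_
      exact measurable_biSup_of_mem (i := Sum.inr (Sum.inl (j, i))) (mem_range_self j) rfl
  have h3 := (indepFun_iff_map_prod_eq_prod_map_map (hS.measurableC i).aemeasurable
    (measurable_pi_lambda _ fun j => hS.measurableW2 j i).aemeasurable).1 h2
  rw [(hS.hasLawC i).map_eq, h1.map_fun_eq_pi_map fun j => (hS.measurableW2 j i).aemeasurable] at h3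
  simp only [(hS.hasLawW2 _ _).map_eq] at h3
  exact h3

theorem iIndepFun_initUnit (hS : S.Assumptions P C W2 W1 p) : iIndepFun (initUnit C W2) P := by
  -- All scalars C^i and W^{2,j,i} form one independent family, indexed by the unit and a slot,
  -- which is then grouped by units.
  set Y : ℕ × Option (Fin N₁) → Ω → ℝ := fun q => q.2.elim (C q.1) fun j => W2 j q.1
  have hY : iIndepFun Y P := by
    refine (iIndepFun_iff_iIndep _ _ _).2 ?_
    have := hS.independent.precomp (g := fun q : ℕ × Option (Fin N₁) =>
      q.2.elim (Sum.inl q.1) fun j => Sum.inr (Sum.inl (j, q.1))) ?_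
    · convert this using 2 with q
      rcases q with ⟨i, _ | j⟩ <;> rfl
    · rintro ⟨i, _ | j⟩ ⟨i', _ | j'⟩ h
      all_goals simp at h
      · rw [h]
      · rw [h.1, h.2]
  have hm : ∀ q, Measurable (Y q) := by
    rintro ⟨i, _ | j⟩
    exacts [hS.measurableC i, hS.measurableW2 j i]
  exact (iIndepFun_curry hm hY).comp
    (fun _ (f : Option (Fin N₁) → ℝ) => (f none, fun j => f (some j))) fun _ => by fun_prop

theorem indepFun_W1_initUnit (hS : S.Assumptions P C W2 W1 p) :
    IndepFun (fun ω j => W1 j ω) (fun ω i => initUnit C W2 i ω) P := by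
  refine indepFun_of_iIndep hS.σAlg_le hS.independent
    (A := range fun j => Sum.inr (Sum.inr (Sum.inl j)))
    (B := range Sum.inl ∪ range fun q => Sum.inr (Sum.inl q)) ?_ ?_ ?_
  · rw [Set.disjoint_left]
    rintro _ ⟨j, rfl⟩ (⟨i, hi⟩ | ⟨i, hi⟩)
    all_goals simp at hi
  · refine @measurable_pi_lambda _ _ _ (_) _ _ fun j => ?_
    exact measurable_biSup_of_mem (i := Sum.inr (Sum.inr (Sum.inl j))) (mem_range_self j) rfl
  · refine @measurable_pi_lambda _ _ _ (_) _ _ fun i => ?_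
    refine @Measurable.prodMk _ _ _ _ _ (_) _ _ ?_ ?_
    · exact measurable_biSup_of_mem (i := Sum.inl i) (Or.inl (mem_range_self i)) rfl
    · refine @measurable_pi_lambda _ _ _ (_) _ _ fun j => ?_
      exact measurable_biSup_of_mem (i := Sum.inr (Sum.inl (j, i)))
        (Or.inr (mem_range_self (j, i))) rfl

theorem map_W1_initUnit (hS : S.Assumptions P C W2 W1 p) :
    P.map (fun ω => ((fun j => W1 j ω), fun i => initUnit C W2 i ω)) =
      (Measure.pi fun _ => S.lawW1).prod (P.map fun ω i => initUnit C W2 i ω) := by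
  rw [← hS.map_W1]
  exact (indepFun_iff_map_prod_eq_prod_map_map
    (measurable_pi_lambda _ fun j => hS.measurableW1 j).aemeasurable
    (measurable_pi_lambda _ fun i => hS.measurable_initUnit i).aemeasurable).1
    hS.indepFun_W1_initUnit

/-- A property of the initial first layer weights and the remaining initial parameters holds almost
surely if it holds almost surely for fixed first layer weights. -/
theorem ae_of_forall_ae (hS : S.Assumptions P C W2 W1 p)
    {Q : (Fin N₁ → EuclideanSpace ℝ (Fin d)) → (ℕ → ℝ × (Fin N₁ → ℝ)) → Prop}
    (hQ : MeasurableSet {q : (Fin N₁ → EuclideanSpace ℝ (Fin d)) × (ℕ → ℝ × (Fin N₁ → ℝ)) | Q q.1 q.2})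
    (h : ∀ w, ∀ᵐ ω ∂P, Q w fun i => initUnit C W2 i ω) :
    ∀ᵐ ω ∂P, Q (fun j => W1 j ω) fun i => initUnit C W2 i ω := by
  have hU : Measurable fun ω i => initUnit C W2 i ω :=
    measurable_pi_lambda _ fun i => hS.measurable_initUnit i
  have hW : Measurable fun ω j => W1 j ω := measurable_pi_lambda _ fun j => hS.measurableW1 j
  have : IsProbabilityMeasure (P.map fun ω i => initUnit C W2 i ω) :=
    Measure.isProbabilityMeasure_map hU.aemeasurable
  refine ae_of_ae_map (p := fun q => Q q.1 q.2) (hW.prodMk hU).aemeasurable ?_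
  rw [hS.map_W1_initUnit]
  refine (Measure.ae_prod_iff_ae_ae hQ).2 (Eventually.of_forall fun w => ?_)
  exact (ae_map_iff hU.aemeasurable (hQ.preimage measurable_prodMk_left)).2 (h w)

end Assumptions

end TwoLayerNet

/-- Fubini over the first layer weights requires this measurability. Constant and threshold may be
taken natural, which leaves countable operations. -/
theorem measurableSet_isBigO {α : Type*} [MeasurableSpace α] {f : ℕ → α → ℝ}
    (hf : ∀ n, Measurable (f n)) (g : ℕ → ℝ) :
    MeasurableSet {x | (fun n => f n x) =O[atTop] g} := by
  have : {x | (fun n => f n x) =O[atTop] g} =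
      ⋃ K : ℕ, ⋃ n₀ : ℕ, ⋂ n : ℕ, ⋂ _ : n₀ ≤ n, {x | ‖f n x‖ ≤ K * ‖g n‖} := by
    ext x
    simp only [mem_ofPred_eq, mem_iUnion, mem_iInter, Asymptotics.isBigO_iff, eventually_atTop]
    constructor
    · rintro ⟨c, n₀, h⟩
      exact ⟨⌈c⌉₊, n₀, fun n hn => (h n hn).trans
        (mul_le_mul_of_nonneg_right (Nat.le_ceil c) (norm_nonneg _))⟩
    · rintro ⟨K, n₀, h⟩
      exact ⟨K, n₀, h⟩
  rw [this]
  exact MeasurableSet.iUnion fun K => MeasurableSet.iUnion fun n₀ => MeasurableSet.iInter fun n =>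
    MeasurableSet.iInter fun _ => measurableSet_le (hf n).norm measurable_const

/-! ### Almost sure rates for samples and initial parameters -/

namespace TwoLayerNet

variable {d N₁ M : ℕ} {S : TwoLayerNet d N₁ M} {Ω : Type*} [MeasurableSpace Ω] {P : Measure Ω}
  [IsProbabilityMeasure P] {C : ℕ → Ω → ℝ} {W2 : Fin N₁ → ℕ → Ω → ℝ}
  {W1 : Fin N₁ → Ω → EuclideanSpace ℝ (Fin d)} {p : ℕ → Ω → EuclideanSpace ℝ (Fin d) × ℝ}

theorem measurable_dataWeight (i : Fin M) : Measurable fun q => S.dataWeight q i := by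
  classical
  unfold dataWeight
  have h : ∀ i' : Fin M, Measurable fun q : EuclideanSpace ℝ (Fin d) × ℝ =>
      if (S.x i', S.y i') = q then (1 : ℝ) else 0 := fun i' =>
    Measurable.ite (measurableSet_eq_fun measurable_const measurable_id) measurable_const
      measurable_const
  refine Measurable.div ?_ (Finset.measurable_sum _ fun i' _ => ?_)
  · convert h i
  · convert h i'

theorem ae_dataLaw : ∀ᵐ q ∂S.dataLaw, ∃ i, q = (S.x i, S.y i) := by
  have hm : MeasurableSet {q : EuclideanSpace ℝ (Fin d) × ℝ | ∃ i, q = (S.x i, S.y i)}ᶜ := by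
    have : {q : EuclideanSpace ℝ (Fin d) × ℝ | ∃ i, q = (S.x i, S.y i)} =
        range fun i => (S.x i, S.y i) := by
      ext q
      simp [eq_comm]
    rw [this]
    exact (finite_range _).measurableSet.compl
  rw [ae_iff, dataLaw, Measure.smul_apply, Measure.finsetSum_apply]
  rw [Finset.sum_eq_zero, smul_zero]
  intro i _
  exact (Measure.dirac_apply' _ hm).trans (by simpa using ⟨i, rfl, rfl⟩)

theorem integral_dataWeight (i : Fin M) :
    ∫ q, S.dataWeight q i ∂S.dataLaw = 1 / (M : ℝ) := by
  have hint : ∀ i₀ ∈ Finset.univ, Integrable (fun q => S.dataWeight q i)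
      (Measure.dirac (S.x i₀, S.y i₀)) := fun i₀ _ =>
    integrable_dirac' (measurable_dataWeight i).stronglyMeasurable (by simp)
  rw [dataLaw, integral_smul_measure, integral_finsetSum_measure hint]
  simp only [integral_dirac, sum_dataWeight_data]
  simp

namespace Assumptions

theorem ae_sample (hS : S.Assumptions P C W2 W1 p) :
    ∀ᵐ ω ∂P, ∀ k, ∃ i, p k ω = (S.x i, S.y i) := by
  refine ae_all_iff.2 fun k => ae_of_ae_map (hS.measurable_sample k).aemeasurable
    (p := fun q => ∃ i, q = (S.x i, S.y i)) ?_
  rw [(hS.hasLaw_sample k).map_eq]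
  exact ae_dataLaw

theorem ae_weight (hS : S.Assumptions P C W2 W1 p) {s : ℝ} (hs : 0 < s) :
    ∀ᵐ ω ∂P, ∀ i, (fun n : ℕ => ∑ k ∈ Finset.range n, (S.dataWeight (p k ω) i - 1 / (M : ℝ)))
      =O[atTop] fun n => (n : ℝ) ^ (1 / 2 + s) := by
  refine ae_all_iff.2 fun i => ?_
  have hm := (measurable_dataWeight (S := S) i).sub_const (1 / (M : ℝ))
  have hmem := fun q => dataWeight_mem (S := S) q i
  refine ae_isBigO_sum (X := fun k ω => S.dataWeight (p k ω) i - 1 / (M : ℝ)) (B := 1 + |1 / (M : ℝ)|)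
    (hS.iIndepFun_sample.comp (fun _ q => S.dataWeight q i - 1 / (M : ℝ)) fun _ => hm)
    (fun k => (hm.comp (hS.measurable_sample k)).aemeasurable) (fun k => Eventually.of_forall
      fun ω => (abs_sub _ _).trans (add_le_add_left (abs_le.2 ⟨by linarith [(hmem (p k ω)).1],
        (hmem (p k ω)).2⟩) _)) (fun k => ?_) hs
  have : IsProbabilityMeasure S.dataLaw := by
    rw [← (hS.hasLaw_sample k).map_eq]
    exact Measure.isProbabilityMeasure_map (hS.measurable_sample k).aemeasurable
  rw [← integral_map (φ := p k) (f := fun q => S.dataWeight q i - 1 / (M : ℝ))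
    (hS.measurable_sample k).aemeasurable hm.aestronglyMeasurable, (hS.hasLaw_sample k).map_eq,
    integral_sub _ (integrable_const _), integral_dataWeight]
  · simp
  · refine Integrable.of_bound (measurable_dataWeight i).aestronglyMeasurable 1
      (Eventually.of_forall fun q => ?_)
    exact abs_le.2 ⟨by linarith [(hmem q).1], (hmem q).2⟩

theorem ae_bounded (hS : S.Assumptions P C W2 W1 p) (hN₁ : 0 < N₁) :
    ∃ R, ∀ᵐ ω ∂P, ∀ i, ‖initUnit C W2 i ω‖ ≤ R := by
  obtain ⟨R, hR⟩ := (hS.regular hN₁).exists_norm_le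
  refine ⟨R, ae_all_iff.2 fun i => ae_of_ae_map (hS.measurable_initUnit i).aemeasurable
    (p := fun u => ‖u‖ ≤ R) ?_⟩
  rwa [hS.map_initUnit]

/-- For frozen w the summands are independent, bounded and centred, so `ae_isBigO_sum` applies;
`ae_of_forall_ae` then replaces w by the random first layer. -/
theorem ae_init (hS : S.Assumptions P C W2 W1 p) (hN₁ : 0 < N₁) {s : ℝ} (hs : 0 < s)
    {f : UnitParam d N₁ → ℝ} (hf : Continuous f) :
    ∀ᵐ ω ∂P, (fun n : ℕ => ∑ i ∈ Finset.range n,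
      (f (unitParam (fun j => W1 j ω) (initUnit C W2 i ω)) - S.mean (fun j => W1 j ω) f))
      =O[atTop] fun n => (n : ℝ) ^ (1 / 2 + s) := by
  have hreg := hS.regular hN₁
  have hmean := hreg.continuous_mean hf
  have hcont := hf.comp (continuous_unitParam (d := d) (N₁ := N₁))
  refine hS.ae_of_forall_ae (Q := fun w u => (fun n : ℕ => ∑ i ∈ Finset.range n,
    (f (unitParam w (u i)) - S.mean w f)) =O[atTop] fun n => (n : ℝ) ^ (1 / 2 + s)) ?_ fun w => ?_
  · refine measurableSet_isBigO (f := fun n (q : (Fin N₁ → EuclideanSpace ℝ (Fin d)) ×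
      (ℕ → ℝ × (Fin N₁ → ℝ))) => ∑ i ∈ Finset.range n, (f (unitParam q.1 (q.2 i)) - S.mean q.1 f))
      (fun n => Finset.measurable_sum _ fun i _ => ?_) _
    have h1 : Measurable fun q : (Fin N₁ → EuclideanSpace ℝ (Fin d)) × (ℕ → ℝ × (Fin N₁ → ℝ)) =>
        f (unitParam q.1 (q.2 i)) := hcont.measurable.comp
      (measurable_fst.prodMk ((measurable_pi_apply i).comp measurable_snd))
    exact h1.sub (hmean.measurable.comp measurable_fst)
  · have hw : Continuous fun u => f (unitParam w u) := Continuous.section_right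
      (f := fun w u => f (unitParam w u)) hcont w
    have hw' := hw.sub (continuous_const (y := S.mean w f))
    obtain ⟨R, hR⟩ := hreg.exists_norm_le
    obtain ⟨B, hB⟩ := exists_abs_le_closedBall hw' R
    refine ae_isBigO_sum (X := fun i ω => f (unitParam w (initUnit C W2 i ω)) - S.mean w f) (B := B)
      (hS.iIndepFun_initUnit.comp (fun _ u => f (unitParam w u) - S.mean w f)
        fun _ => hw'.measurable)
      (fun i => (hw'.measurable.comp (hS.measurable_initUnit i)).aemeasurable) (fun i => ?_)
      (fun i => ?_) hs
    · refine ae_of_ae_map (p := fun u => |f (unitParam w u) - S.mean w f| ≤ B)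
        (hS.measurable_initUnit i).aemeasurable ?_
      rw [hS.map_initUnit]
      exact hR.mono fun u hu => hB.2 u hu
    · have := hreg.isProbabilityMeasure_initLaw
      rw [← integral_map (φ := initUnit C W2 i) (f := fun u => f (unitParam w u) - S.mean w f)
        (hS.measurable_initUnit i).aemeasurable hw'.aestronglyMeasurable, hS.map_initUnit,
        integral_sub (hreg.integrable hw) (integrable_const _), ← hreg.mean_eq w hf]
      simp

theorem ae_typical (hS : S.Assumptions P C W2 W1 p) (hN₁ : 0 < N₁) {s : ℝ}
    (hs : 0 < s) : ∀ᵐ ω ∂P, S.Typical s (fun i => C i ω) (fun j i => W2 j i ω) (fun j => W1 j ω)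
      (fun k => p k ω) := by
  have hreg := hS.regular hN₁
  obtain ⟨R, hR⟩ := hS.ae_bounded hN₁
  have hinit : ∀ᵐ ω ∂P, ∀ b l, (fun n : ℕ => ∑ i ∈ Finset.range n,
      (S.system.word b l (unitParam (fun j => W1 j ω) (initUnit C W2 i ω)) -
        S.mean (fun j => W1 j ω) (S.system.word b l)))
      =O[atTop] fun n => (n : ℝ) ^ (1 / 2 + s) :=
    -- There are countably many words, so one null set serves them all; for the class of all smooth
    -- functions this would fail as an argument.
    ae_all_iff.2 fun b => ae_all_iff.2 fun l => hS.ae_init hN₁ hs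
      (ParticleSystem.contDiff_word (contDiff_system_F hreg.act_smooth)
        (contDiff_system_D hreg.act_smooth) (contDiff_system_v hreg.act_smooth) b l).continuous
  filter_upwards [hR, hS.ae_sample, hS.ae_weight hs, hinit] with ω h1 h2 h3 h4
  exact ⟨⟨R, h1⟩, h2, h3, h4⟩

end Assumptions

end TwoLayerNet

/-- The mass of a closed set is a limit of integrals of thickened indicators, each continuous in the
parameter. This yields the measurability of the Gaussian kernel. -/
theorem measurable_toMeasure_of_continuous {X E : Type*} [TopologicalSpace X] [MeasurableSpace X]
    [OpensMeasurableSpace X] [PseudoEMetricSpace E] [MeasurableSpace E] [BorelSpace E]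
    {μ : X → ProbabilityMeasure E} (h : Continuous μ) : Measurable fun x => (μ x : Measure E) := by
  refine Measurable.measure_of_isPiSystem_of_isProbabilityMeasure
    (BorelSpace.measurable_eq.trans borel_eq_generateFrom_isClosed) isPiSystem_isClosed
    fun F hF => ?_
  have hδ : ∀ n : ℕ, (0 : ℝ) < 1 / ((n : ℝ) + 1) := fun n => by positivity
  refine measurable_of_tendsto_metrizable (f := fun (n : ℕ) x =>
    ∫⁻ e, thickenedIndicator (hδ n) F e ∂(μ x : Measure E)) (fun n => ?_) ?_
  · refine Continuous.measurable (continuous_iff_continuousAt.2 fun x => ?_)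
    exact ProbabilityMeasure.tendsto_iff_forall_lintegral_tendsto.1 (h.tendsto x)
      (thickenedIndicator (hδ n) F)
  · refine tendsto_pi_nhds.2 fun x => ?_
    exact tendsto_lintegral_thickenedIndicator_of_isClosed _ hF hδ
      tendsto_one_div_add_atTop_nhds_zero_nat

namespace TwoLayerNet

variable {d N₁ M : ℕ} {S : TwoLayerNet d N₁ M}

/-! ### The Gaussian limit of the rescaled initial output -/

/-- The quadratic form is the second moment of a linear combination of the observables. It gives
positivity of the covariance and the variance in the central limit theorem. -/
theorem Regular.dotProduct_cov (hS : S.Regular) (w : Fin N₁ → EuclideanSpace ℝ (Fin d))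
    (x : Fin M → ℝ) : x ⬝ᵥ (S.cov w).mulVec x =
      S.mean w fun θ => (∑ k, x k * S.system.F k θ) ^ 2 := by
  have hF := contDiff_system_F (S := S) hS.act_smooth
  have hm := hS.mean_smoothLinear w
  have h1 : (fun θ => (∑ k, x k * S.system.F k θ) ^ 2) =
      fun θ => ∑ k, ∑ k', (x k * x k') * (S.system.F k θ * S.system.F k' θ) := by
    funext θ
    rw [sq, Finset.sum_mul_sum]
    exact Finset.sum_congr rfl fun k _ => Finset.sum_congr rfl fun k' _ => by ring
  rw [h1, hm.map_sum _ fun k => ContDiff.sum fun k' _ =>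
    contDiff_const.mul ((hF k).mul (hF k')), dotProduct]
  refine Finset.sum_congr rfl fun k _ => ?_
  rw [hm.map_sum _ fun k' => contDiff_const.mul ((hF k).mul (hF k')), Matrix.mulVec, dotProduct,
    Finset.mul_sum]
  refine Finset.sum_congr rfl fun k' _ => ?_
  rw [hm.map_mul _ _ ((hF k).mul (hF k')), mul_assoc, mul_comm (x k')]
  rfl

theorem Regular.posSemidef_cov (hS : S.Regular) (w : Fin N₁ → EuclideanSpace ℝ (Fin d)) :
    (S.cov w).PosSemidef := by
  refine Matrix.PosSemidef.of_dotProduct_mulVec_nonneg ?_ fun x => ?_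
  · ext k k'
    simp only [Matrix.conjTranspose_apply, cov, Matrix.of_apply, star_trivial]
    congr 1
    funext θ
    ring
  · rw [star_trivial, hS.dotProduct_cov]
    exact integral_nonneg fun θ => sq_nonneg _

theorem Regular.continuous_cov (hS : S.Regular) (k k' : Fin M) :
    Continuous fun w => S.cov w k k' :=
  hS.continuous_mean ((contDiff_system_F hS.act_smooth k).continuous.mul
    (contDiff_system_F hS.act_smooth k').continuous)

/-- The centred Gaussian law with covariance `S.cov w`. -/
noncomputable def gaussianLaw (S : TwoLayerNet d N₁ M) (w : Fin N₁ → EuclideanSpace ℝ (Fin d)) :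
    ProbabilityMeasure (EuclideanSpace ℝ (Fin M)) :=
  ⟨multivariateGaussian 0 (S.cov w), inferInstance⟩

theorem Regular.charFun_gaussianLaw (hS : S.Regular) (w : Fin N₁ → EuclideanSpace ℝ (Fin d))
    (t : EuclideanSpace ℝ (Fin M)) : charFun (S.gaussianLaw w : Measure _) t =
      Complex.exp (-((t.ofLp ⬝ᵥ (S.cov w).mulVec t.ofLp : ℝ) : ℂ) / 2) := by
  refine (charFun_multivariateGaussian (hS.posSemidef_cov w) t).trans ?_
  rw [inner_zero_right]
  congr 1
  simp [neg_div]

/-- Convergence of characteristic functions covers degenerate covariances without separate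
treatment. -/
theorem Regular.continuous_gaussianLaw (hS : S.Regular) : Continuous S.gaussianLaw := by
  refine continuous_iff_seqContinuous.2 fun v w hv => ?_
  refine ProbabilityMeasure.tendsto_iff_tendsto_charFun.2 fun t => ?_
  simp only [Function.comp_apply, hS.charFun_gaussianLaw]
  have hc : Continuous fun w => t.ofLp ⬝ᵥ (S.cov w).mulVec t.ofLp := by
    simp only [dotProduct, Matrix.mulVec]
    exact continuous_finsetSum _ fun k _ => continuous_const.mul
      (continuous_finsetSum _ fun k' _ => (hS.continuous_cov k k').mul continuous_const)
  have hc' : Continuous fun w => Complex.exp (-((t.ofLp ⬝ᵥ (S.cov w).mulVec t.ofLp : ℝ) : ℂ) / 2) := by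
    fun_prop
  exact (hc'.tendsto w).comp hv

/-- The conditional law of the Gaussian initial value, given the first layer weights. -/
noncomputable def gaussianKernel (hS : S.Regular) :
    Kernel (Fin N₁ → EuclideanSpace ℝ (Fin d)) (EuclideanSpace ℝ (Fin M)) where
  toFun w := multivariateGaussian 0 (S.cov w)
  measurable' := measurable_toMeasure_of_continuous hS.continuous_gaussianLaw

instance (hS : S.Regular) : IsMarkovKernel (gaussianKernel hS) :=
  ⟨fun w => inferInstanceAs (IsProbabilityMeasure (multivariateGaussian 0 (S.cov w)))⟩

/-- The rescaled initial output. -/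
noncomputable def gaussianSum (S : TwoLayerNet d N₁ M) (N : ℕ)
    (w : Fin N₁ → EuclideanSpace ℝ (Fin d)) (u : ℕ → ℝ × (Fin N₁ → ℝ)) :
    EuclideanSpace ℝ (Fin M) :=
  WithLp.toLp 2 fun k => (N : ℝ) ^ (-(1 / 2) : ℝ) * ∑ i ∈ Finset.range N,
    S.system.F k (unitParam w (u i))

theorem Regular.continuous_gaussianSum (hS : S.Regular) (N : ℕ) :
    Continuous fun q : (Fin N₁ → EuclideanSpace ℝ (Fin d)) × (ℕ → ℝ × (Fin N₁ → ℝ)) =>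
      S.gaussianSum N q.1 q.2 := by
  refine (PiLp.continuous_toLp 2 _).comp (continuous_pi fun k => continuous_const.mul
    (continuous_finsetSum _ fun i _ => ?_))
  exact ((contDiff_system_F hS.act_smooth k).continuous.comp continuous_unitParam).comp
    (by fun_prop : Continuous fun q : (Fin N₁ → EuclideanSpace ℝ (Fin d)) ×
      (ℕ → ℝ × (Fin N₁ → ℝ)) => (q.1, q.2 i))

variable {Ω : Type*} [MeasurableSpace Ω] {P : Measure Ω}
  [IsProbabilityMeasure P] {C : ℕ → Ω → ℝ} {W2 : Fin N₁ → ℕ → Ω → ℝ}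
  {W1 : Fin N₁ → Ω → EuclideanSpace ℝ (Fin d)} {p : ℕ → Ω → EuclideanSpace ℝ (Fin d) × ℝ}

namespace Assumptions

theorem measurable_gaussianSum (hS : S.Assumptions P C W2 W1 p) (hN₁ : 0 < N₁) (N : ℕ)
    (w : Fin N₁ → EuclideanSpace ℝ (Fin d)) :
    Measurable fun ω => S.gaussianSum N w fun i => initUnit C W2 i ω :=
  (((hS.regular hN₁).continuous_gaussianSum N).section_right w).measurable.comp
    (measurable_pi_lambda _ hS.measurable_initUnit)

/-- Cramér–Wold: the characteristic function at `t` is that of the scalar sum of `∑ k, t k * F k` at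
1, to which the one-dimensional central limit theorem applies. -/
theorem tendsto_gaussianSum (hS : S.Assumptions P C W2 W1 p) (hN₁ : 0 < N₁)
    (w : Fin N₁ → EuclideanSpace ℝ (Fin d)) :
    Tendsto (β := ProbabilityMeasure (EuclideanSpace ℝ (Fin M)))
      (fun N => ⟨P.map fun ω => S.gaussianSum N w fun i => initUnit C W2 i ω,
        Measure.isProbabilityMeasure_map (hS.measurable_gaussianSum hN₁ N w).aemeasurable⟩) atTop (𝓝 (S.gaussianLaw w)) := by
  have hreg := hS.regular hN₁
  refine ProbabilityMeasure.tendsto_iff_tendsto_charFun.2 fun t => ?_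
  set g : UnitParam d N₁ → ℝ := fun θ => ∑ k, t k * S.system.F k θ with hg
  have hgs : ContDiff ℝ (⊤ : ℕ∞) g := ContDiff.sum fun k _ =>
    contDiff_const.mul (contDiff_system_F hreg.act_smooth k)
  set Y : ℝ × (Fin N₁ → ℝ) → ℝ := fun u => g (unitParam w u) with hY
  have hYc : Continuous Y := Continuous.section_right (f := fun w u => g (unitParam w u))
    (hgs.continuous.comp continuous_unitParam) w
  set X : ℕ → Ω → ℝ := fun i ω => Y (initUnit C W2 i ω) with hX
  have hXm : ∀ i, Measurable (X i) := fun i => hYc.measurable.comp (hS.measurable_initUnit i)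
  have hint : ∀ f : ℝ × (Fin N₁ → ℝ) → ℝ, Continuous f →
      ∫ ω, f (initUnit C W2 0 ω) ∂P = ∫ u, f u ∂S.initLaw := fun f hf => by
    rw [← hS.map_initUnit 0, integral_map (hS.measurable_initUnit 0).aemeasurable
      hf.aestronglyMeasurable]
  have hX0 : ∫ ω, X 0 ω ∂P = 0 := by
    rw [hint Y hYc, ← hreg.mean_eq w hgs.continuous]
    have hm := hreg.mean_smoothLinear w
    have hF := contDiff_system_F (S := S) hreg.act_smooth
    rw [hg, hm.map_sum _ fun k => contDiff_const.mul (hF k)]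
    exact Finset.sum_eq_zero fun k _ => by rw [hm.map_mul _ _ (hF k), hreg.mean_F, mul_zero]
  have hvar : Var[X 0; P] = t.ofLp ⬝ᵥ (S.cov w).mulVec t.ofLp := by
    rw [variance_of_integral_eq_zero (hXm 0).aemeasurable hX0, hreg.dotProduct_cov,
      hreg.mean_eq w (f := fun θ => (∑ k, t k * S.system.F k θ) ^ 2) (hgs.continuous.pow 2)]
    exact hint (fun u => Y u ^ 2) (hYc.pow 2)
  have hind : iIndepFun X P :=
    hS.iIndepFun_initUnit.comp (fun _ => Y) fun _ => hYc.measurable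
  have hid : ∀ i, IdentDistrib (X i) (X 0) P P := fun i => by
    have h : IdentDistrib (initUnit C W2 i) (initUnit C W2 0) P P :=
      ⟨(hS.measurable_initUnit i).aemeasurable, (hS.measurable_initUnit 0).aemeasurable,
        by rw [hS.map_initUnit, hS.map_initUnit]⟩
    exact h.comp hYc.measurable
  have hL2 : MemLp (X 0) 2 P := by
    obtain ⟨R, hR⟩ := hreg.exists_norm_le
    obtain ⟨B, hB⟩ := exists_abs_le_closedBall hYc R
    refine MemLp.of_bound (hXm 0).aestronglyMeasurable B
      (ae_of_ae_map (p := fun u => ‖Y u‖ ≤ B) (hS.measurable_initUnit 0).aemeasurable ?_)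
    rw [hS.map_initUnit]
    exact hR.mono fun u hu => hB.2 u hu
  have hclt := tendstoInDistribution_inv_sqrt_mul_sum_sub (P' := gaussianReal 0 Var[X 0; P].toNNReal)
    (Y := id) HasLaw.id hL2 hind hid
  have h1 := ProbabilityMeasure.tendsto_iff_tendsto_charFun.1 hclt.tendsto 1
  have e2 : charFun (S.gaussianLaw w : Measure _) t =
      charFun ((gaussianReal 0 Var[X 0; P].toNNReal).map id) 1 := by
    rw [hreg.charFun_gaussianLaw, Measure.map_id, charFun_gaussianReal, ← hvar]
    congr 1
    simp [Real.coe_toNNReal _ (variance_nonneg _ _), neg_div]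
  rw [e2]
  refine h1.congr fun N => ?_
  change charFun (P.map _) 1 = charFun (P.map _) t
  rw [charFun_apply, charFun_apply, integral_map _ (by fun_prop), integral_map _ (by fun_prop)]
  · refine integral_congr_ae (Eventually.of_forall fun ω => ?_)
    simp only [hX0, mul_zero, sub_zero]
    congr 3
    rw [PiLp.inner_apply]
    simp only [gaussianSum, hX, hY, hg, RCLike.inner_apply, conj_trivial, one_mul]
    rw [Finset.sum_comm, Finset.mul_sum, Real.rpow_neg (Nat.cast_nonneg N), ← Real.sqrt_eq_rpow]
    refine Finset.sum_congr rfl fun k _ => ?_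
    rw [← Finset.mul_sum]
    ring
  · exact (hS.measurable_gaussianSum hN₁ N w).aemeasurable
  · exact ((Finset.measurable_sum _ fun i _ => hXm i).sub_const _ |>.const_mul _).aemeasurable

/-- The first layer weights and the rescaled initial output converge jointly in distribution. -/
theorem tendsto_joint (hS : S.Assumptions P C W2 W1 p) (hN₁ : 0 < N₁) [IsProbabilityMeasure S.lawW1] :
    TendstoInDistribution (fun (N : ℕ) ω =>
      ((fun j => W1 j ω), S.gaussianSum N (fun j => W1 j ω) fun i => initUnit C W2 i ω)) atTop id
      (fun _ => P) ((Measure.pi fun _ => S.lawW1) ⊗ₘ gaussianKernel (hS.regular hN₁)) := by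
  have hreg := hS.regular hN₁
  have hU : Measurable fun ω i => initUnit C W2 i ω :=
    measurable_pi_lambda _ hS.measurable_initUnit
  have hW : Measurable fun ω j => W1 j ω := measurable_pi_lambda _ hS.measurableW1
  have hG : ∀ N, Measurable fun ω => S.gaussianSum N (fun j => W1 j ω) fun i => initUnit C W2 i ω :=
    fun N => (hreg.continuous_gaussianSum N).measurable.comp (hW.prodMk hU)
  have : IsProbabilityMeasure (P.map fun ω i => initUnit C W2 i ω) :=
    Measure.isProbabilityMeasure_map hU.aemeasurable
  refine ⟨fun N => (hW.prodMk (hG N)).aemeasurable, aemeasurable_id, ?_⟩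
  refine ProbabilityMeasure.tendsto_iff_forall_integral_tendsto.2 fun F => ?_
  have e1 : ∀ N, ∫ q, F q ∂(P.map fun ω =>
      ((fun j => W1 j ω), S.gaussianSum N (fun j => W1 j ω) fun i => initUnit C W2 i ω)) =
      ∫ w, ∫ ω, F (w, S.gaussianSum N w fun i => initUnit C W2 i ω) ∂P
        ∂(Measure.pi fun _ => S.lawW1) := by
    intro N
    have hFm : Continuous fun q : (Fin N₁ → EuclideanSpace ℝ (Fin d)) × (ℕ → ℝ × (Fin N₁ → ℝ)) =>
        F (q.1, S.gaussianSum N q.1 q.2) :=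
      F.continuous.comp (continuous_fst.prodMk (hreg.continuous_gaussianSum N))
    rw [integral_map (hW.prodMk (hG N)).aemeasurable F.continuous.aestronglyMeasurable]
    have h2 := integral_map (μ := P) (hW.prodMk hU).aemeasurable
      (f := fun q => F (q.1, S.gaussianSum N q.1 q.2)) hFm.aestronglyMeasurable
    rw [← h2, hS.map_W1_initUnit, integral_prod]
    · refine integral_congr_ae (Eventually.of_forall fun w => ?_)
      exact integral_map hU.aemeasurable (hFm.section_right (f := fun w u =>
        F (w, S.gaussianSum N w u)) w).aestronglyMeasurable
    · exact Integrable.of_bound hFm.aestronglyMeasurable ‖F‖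
        (Eventually.of_forall fun q => F.norm_coe_le_norm _)
  have e2 : ∫ q, F q ∂(((Measure.pi fun _ => S.lawW1) ⊗ₘ gaussianKernel hreg).map id) =
      ∫ w, ∫ v, F (w, v) ∂(S.gaussianLaw w : Measure _) ∂(Measure.pi fun _ => S.lawW1) := by
    rw [Measure.map_id, Measure.integral_compProd]
    · rfl
    · exact Integrable.of_bound F.continuous.aestronglyMeasurable ‖F‖
        (Eventually.of_forall fun q => F.norm_coe_le_norm _)
  change Tendsto (fun N => ∫ q, F q ∂(P.map fun ω =>
      ((fun j => W1 j ω), S.gaussianSum N (fun j => W1 j ω) fun i => initUnit C W2 i ω))) atTop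
    (𝓝 (∫ q, F q ∂(((Measure.pi fun _ => S.lawW1) ⊗ₘ gaussianKernel hreg).map id)))
  rw [e2]
  simp only [e1]
  -- For each w the inner integrals converge by `tendsto_gaussianSum`, and `‖F‖` dominates them.
  refine tendsto_integral_of_dominated_convergence (fun _ => ‖F‖) (fun N => ?_)
    (integrable_const _) (fun N => Eventually.of_forall fun w => ?_)
    (Eventually.of_forall fun w => ?_)
  · have hm : Measurable fun q : (Fin N₁ → EuclideanSpace ℝ (Fin d)) × Ω =>
        F (q.1, S.gaussianSum N q.1 fun i => initUnit C W2 i q.2) :=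
      F.continuous.measurable.comp (measurable_fst.prodMk
        ((hreg.continuous_gaussianSum N).measurable.comp
          (measurable_fst.prodMk (hU.comp measurable_snd))))
    exact hm.stronglyMeasurable.integral_prod_right.aestronglyMeasurable
  · refine (norm_integral_le_of_norm_le_const (C := ‖F‖)
      (Eventually.of_forall fun ω => F.norm_coe_le_norm _)).trans (by simp)
  · have h3 := ProbabilityMeasure.tendsto_iff_forall_integral_tendsto.1
      (hS.tendsto_gaussianSum hN₁ w) (F.compContinuous ⟨fun v => (w, v), by fun_prop⟩)
    refine h3.congr fun N => ?_
    exact integral_map (hS.measurable_gaussianSum hN₁ N w).aemeasurable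
      (BoundedContinuousFunction.continuous _).aestronglyMeasurable

end Assumptions

end TwoLayerNet

/-! ### Step paths in the Skorokhod space -/

theorem eventually_floor_eq_right (N : ℕ) {T : ℝ} (t : Icc (0 : ℝ) T) :
    ∀ᶠ s : Icc (0 : ℝ) T in 𝓝[≥] t, ⌊(N : ℝ) * (s : ℝ)⌋₊ = ⌊(N : ℝ) * (t : ℝ)⌋₊ := by
  have h1 : ∀ᶠ s : Icc (0 : ℝ) T in 𝓝 t, (N : ℝ) * (s : ℝ) < ⌊(N : ℝ) * (t : ℝ)⌋₊ + 1 :=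
    (Continuous.tendsto (by fun_prop : Continuous fun s : Icc (0 : ℝ) T => (N : ℝ) * (s : ℝ))
      t).eventually (gt_mem_nhds (Nat.lt_floor_add_one _))
  filter_upwards [nhdsWithin_le_nhds h1, self_mem_nhdsWithin] with s hs hst
  have hst' : (t : ℝ) ≤ s := hst
  have h2 : (N : ℝ) * (t : ℝ) ≤ N * s := mul_le_mul_of_nonneg_left hst' (Nat.cast_nonneg N)
  refine (Nat.floor_eq_iff (mul_nonneg (Nat.cast_nonneg N) s.2.1)).2 ⟨?_, hs⟩
  exact (Nat.floor_le (mul_nonneg (Nat.cast_nonneg N) t.2.1)).trans h2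

/-- Just before t > 0 the floor is the largest integer strictly below `N t`, namely `⌈N t⌉ - 1`,
whether or not `N t` is an integer. For `N = 0` truncated subtraction gives 0 on both sides. -/
theorem eventually_floor_eq_left (N : ℕ) {T : ℝ} (t : Icc (0 : ℝ) T) :
    ∀ᶠ s : Icc (0 : ℝ) T in 𝓝[<] t, ⌊(N : ℝ) * (s : ℝ)⌋₊ = ⌈(N : ℝ) * (t : ℝ)⌉₊ - 1 := by
  rcases Nat.eq_zero_or_pos N with rfl | hN
  · simp
  have hN' : (0 : ℝ) < N := by exact_mod_cast hN
  have h1 : ∀ᶠ s : Icc (0 : ℝ) T in 𝓝 t, (⌈(N : ℝ) * (t : ℝ)⌉₊ : ℝ) - 1 < (N : ℝ) * (s : ℝ) :=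
    (Continuous.tendsto (by fun_prop : Continuous fun s : Icc (0 : ℝ) T => (N : ℝ) * (s : ℝ))
      t).eventually (lt_mem_nhds (by
        linarith [Nat.ceil_lt_add_one (mul_nonneg hN'.le t.2.1)]))
  filter_upwards [nhdsWithin_le_nhds h1, self_mem_nhdsWithin] with s hs hst
  have hst' : (s : ℝ) < t := hst
  have h2 : (N : ℝ) * (s : ℝ) < N * t := mul_lt_mul_of_pos_left hst' hN'
  have h3 : 0 < ⌈(N : ℝ) * (t : ℝ)⌉₊ :=
    Nat.ceil_pos.2 (lt_of_le_of_lt (mul_nonneg hN'.le s.2.1) h2)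
  refine (Nat.floor_eq_iff (mul_nonneg hN'.le s.2.1)).2 ?_
  rw [Nat.cast_sub h3, Nat.cast_one]
  exact ⟨hs.le, by linarith [Nat.le_ceil ((N : ℝ) * (t : ℝ))]⟩

namespace SkorokhodSpace

variable {T : ℝ} {E : Type*} [NormedAddCommGroup E]

/-- The path `t ↦ u ⌊N t⌋ + c t`. -/
noncomputable def ofStep (T : ℝ) (N : ℕ) (u : ℕ → E) (c : C(ℝ, E)) : SkorokhodSpace T E where
  path t := u ⌊(N : ℝ) * (t : ℝ)⌋₊ + c t
  right_continuous t := by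
    have hc : Continuous fun s : Icc (0 : ℝ) T => c s := by fun_prop
    refine ContinuousWithinAt.add ?_ hc.continuousWithinAt
    refine (tendsto_const_nhds (x := u ⌊(N : ℝ) * (t : ℝ)⌋₊)).congr' ?_
    exact (eventually_floor_eq_right N t).mono fun s hs => by simp only [hs]
  left_limit t := by
    have hc : Continuous fun s : Icc (0 : ℝ) T => c s := by fun_prop
    refine ⟨u (⌈(N : ℝ) * (t : ℝ)⌉₊ - 1) + c t, Tendsto.add ?_
      ((hc.tendsto t).mono_left nhdsWithin_le_nhds)⟩
    refine (tendsto_const_nhds (x := u (⌈(N : ℝ) * (t : ℝ)⌉₊ - 1))).congr' ?_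
    exact (eventually_floor_eq_left N t).mono fun s hs => by simp only [hs]

/-- Uniform convergence implies convergence in the Skorokhod topology. -/
theorem tendsto_of_uniform {α : Type*} {l : Filter α} {f : α → SkorokhodSpace T E}
    {z : SkorokhodSpace T E} (h : ∀ η > 0, ∀ᶠ a in l, ∀ t, dist (z.path t) ((f a).path t) ≤ η) :
    Tendsto f l (𝓝 z) := by
  refine TopologicalSpace.tendsto_nhds_generateFrom_iff.2 ?_
  rintro _ ⟨z₀, r, rfl⟩ ⟨τ, δ, hδ, hδr, hτ⟩
  -- The strict inequality `δ < r` in the definition of the ball leaves room for a uniform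
  -- perturbation under the same time change.
  filter_upwards [h ((r - δ) / 2) (by linarith)] with a ha
  refine ⟨τ, δ + (r - δ) / 2, by linarith, by linarith, fun t => ⟨?_, ?_⟩⟩
  · linarith [(hτ t).1]
  · exact (dist_triangle _ _ _).trans (add_le_add (hτ t).2 (ha (τ t)))

/-- On `[0,T]` only finitely many values `u n` are visited, so coordinatewise convergence is uniform
there. Continuity yields Borel measurability of the random paths without a description of the
Skorokhod σ-algebra. -/
theorem continuous_ofStep (T : ℝ) (N : ℕ) :
    Continuous fun q : (ℕ → E) × C(ℝ, E) => ofStep T N q.1 q.2 := by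
  refine continuous_iff_continuousAt.2 fun q => tendsto_of_uniform fun η hη => ?_
  have h1 : ∀ᶠ q' : (ℕ → E) × C(ℝ, E) in 𝓝 q, ∀ n ∈ Finset.range (⌊(N : ℝ) * T⌋₊ + 1),
      dist (q.1 n) (q'.1 n) < η / 2 := by
    refine (Finset.eventually_all _).2 fun n _ => ?_
    have hc : Continuous fun q' : (ℕ → E) × C(ℝ, E) => dist (q.1 n) (q'.1 n) := by fun_prop
    exact (hc.tendsto q).eventually (gt_mem_nhds (by simpa using half_pos hη))
  have h2 : ∀ᶠ q' : (ℕ → E) × C(ℝ, E) in 𝓝 q, ∀ t ∈ Icc 0 T, dist (q.2 t) (q'.2 t) < η / 2 := by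
    have := ContinuousMap.tendsto_iff_forall_isCompact_tendstoUniformlyOn.1
      (continuous_snd.tendsto q) (Icc 0 T) isCompact_Icc
    exact Metric.tendstoUniformlyOn_iff.1 this _ (half_pos hη)
  filter_upwards [h1, h2] with q' h1 h2 t
  refine (dist_add_add_le _ _ _ _).trans ?_
  have h3 : ⌊(N : ℝ) * (t : ℝ)⌋₊ ≤ ⌊(N : ℝ) * T⌋₊ :=
    Nat.floor_le_floor (mul_le_mul_of_nonneg_left t.2.2 (Nat.cast_nonneg N))
  linarith [h1 _ (Finset.mem_range.2 (Nat.lt_succ_of_le h3)), h2 t t.2]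

end SkorokhodSpace

/-- A version of Slutsky's theorem: bounded random variables `H N` that are eventually close to
`J (Z N)`, locally uniformly in the values of `Z N`, have the same limit in mean as `J (Z N)`. -/
theorem tendsto_integral_of_locally_close {Ω Ω' Q : Type*} [MeasurableSpace Ω] [MeasurableSpace Ω']
    {P : Measure Ω} [IsProbabilityMeasure P] {P' : Measure Ω'} [IsProbabilityMeasure P']
    [TopologicalSpace Q] [MeasurableSpace Q] [BorelSpace Q] [HasOuterApproxClosed Q]
    {Z : ℕ → Ω → Q} {Z' : Ω' → Q} (hZ : TendstoInDistribution Z atTop Z' (fun _ => P) P')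
    (hZm : ∀ N, Measurable (Z N))
    {H : ℕ → Ω → ℝ} (hH : ∀ N, Measurable (H N)) {B : ℝ} (hB : ∀ N ω, |H N ω| ≤ B)
    (J : BoundedContinuousFunction Q ℝ)
    (hclose : ∀ ε > 0, ∃ O : ℕ → Set Q, Monotone O ∧ (∀ m, IsOpen (O m)) ∧ ⋃ m, O m = univ ∧
      ∀ m, ∀ᵐ ω ∂P, ∀ᶠ N in atTop, Z N ω ∈ O m → |H N ω - J (Z N ω)| ≤ ε) :
    Tendsto (fun N => ∫ ω, H N ω ∂P) atTop (𝓝 (∫ ω, J (Z' ω) ∂P')) := by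
  have hJ : Tendsto (fun N => ∫ ω, J (Z N ω) ∂P) atTop (𝓝 (∫ ω, J (Z' ω) ∂P')) := by
    have h1 := ProbabilityMeasure.tendsto_iff_forall_integral_tendsto.1 hZ.tendsto J
    have e2 := integral_map hZ.aemeasurable_limit (f := J) J.continuous.aestronglyMeasurable
    rw [← e2]
    refine h1.congr fun N => ?_
    exact integral_map (hZm N).aemeasurable J.continuous.aestronglyMeasurable
  have hHi : ∀ N, Integrable (H N) P := fun N =>
    Integrable.of_bound (hH N).aestronglyMeasurable B (Eventually.of_forall (hB N))
  have hJm : ∀ N, Measurable fun ω => J (Z N ω) := fun N => J.continuous.measurable.comp (hZm N)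
  have hJi : ∀ N, Integrable (fun ω => J (Z N ω)) P := fun N =>
    Integrable.of_bound (hJm N).aestronglyMeasurable ‖J‖
      (Eventually.of_forall fun ω => J.norm_coe_le_norm _)
  suffices h0 : Tendsto (fun N => ∫ ω, H N ω ∂P - ∫ ω, J (Z N ω) ∂P) atTop (𝓝 0) by
    simpa using h0.add hJ
  set b := |B| + ‖J‖ + 1 with hb
  have hbpos : 0 < b := by positivity
  have hdb : ∀ N ω, |H N ω - J (Z N ω)| ≤ b := fun N ω => by
    have h1 := J.norm_coe_le_norm (Z N ω)
    rw [Real.norm_eq_abs] at h1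
    linarith [abs_sub (H N ω) (J (Z N ω)), hB N ω, le_abs_self B]
  refine Metric.tendsto_nhds.2 fun η hη => ?_
  obtain ⟨O, hmono, hopen, hun, hO⟩ := hclose (η / 4) (by linarith)
  -- The open sets exhaust the space, so the limit law neglects the complement of some `O m`; the
  -- portmanteau theorem passes this on to `Z N` for large `N`.
  have hlim : ∃ m, (P'.map Z') (O m)ᶜ < ENNReal.ofReal (η / 4 / b) := by
    have : IsProbabilityMeasure (P'.map Z') :=
      Measure.isProbabilityMeasure_map hZ.aemeasurable_limit
    have h1 : Tendsto (fun m => (P'.map Z') (O m)ᶜ) atTop (𝓝 0) := by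
      have := tendsto_measure_iInter_atTop (μ := P'.map Z') (s := fun m => (O m)ᶜ)
        (fun m => (hopen m).measurableSet.compl.nullMeasurableSet)
        (fun a b hab => compl_subset_compl.2 (hmono hab)) ⟨0, measure_ne_top _ _⟩
      rwa [← compl_iUnion, hun, compl_univ, measure_empty] at this
    exact (h1.eventually (gt_mem_nhds (ENNReal.ofReal_pos.2 (by positivity)))).exists
  obtain ⟨m, hm⟩ := hlim
  have hport : ∀ᶠ N in atTop, P.real {ω | Z N ω ∉ O m} < η / 4 / b := by
    have h1 := ProbabilityMeasure.limsup_measure_closed_le_of_tendsto hZ.tendsto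
      (hopen m).isClosed_compl
    have h2 := eventually_lt_of_limsup_lt (lt_of_le_of_lt h1 hm)
    filter_upwards [h2] with N hN
    have e : (P.map (Z N)) (O m)ᶜ = P {ω | Z N ω ∉ O m} :=
      Measure.map_apply (hZm N) (hopen m).measurableSet.compl
    have hN' : P {ω | Z N ω ∉ O m} < ENNReal.ofReal (η / 4 / b) := by rw [← e]; exact hN
    exact (ENNReal.lt_ofReal_iff_toReal_lt (measure_ne_top _ _)).1 hN'
  -- Almost every `ω` lies in only finitely many of these events, so their probabilities tend to
  -- zero by dominated convergence.
  set bad : ℕ → Set Ω := fun N => {ω | Z N ω ∈ O m ∧ η / 4 < |H N ω - J (Z N ω)|} with hbad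
  have hbm : ∀ N, MeasurableSet (bad N) := fun N =>
    ((hopen m).measurableSet.preimage (hZm N)).inter
      (measurableSet_lt measurable_const ((hH N).sub (hJm N)).abs)
  have hbt : Tendsto (fun N => ∫ ω, (bad N).indicator (fun _ => b) ω ∂P) atTop (𝓝 0) := by
    have := tendsto_integral_of_dominated_convergence (μ := P) (f := fun _ => (0 : ℝ))
      (F := fun N => (bad N).indicator fun _ => b) (fun _ => b)
      (fun N => (measurable_const.indicator (hbm N)).aestronglyMeasurable) (integrable_const _)
      (fun N => Eventually.of_forall fun ω => by
        rw [Real.norm_of_nonneg (indicator_nonneg (fun _ _ => hbpos.le) _)]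
        exact indicator_le_self' (fun _ _ => hbpos.le) ω)
      ((hO m).mono fun ω hω => tendsto_const_nhds.congr' (hω.mono fun N hN =>
        (indicator_of_notMem (s := bad N) (fun h => absurd (hN h.1) (not_le.2 h.2)) _).symm))
    simpa using this
  have hbe : ∀ᶠ N in atTop, ∫ ω, (bad N).indicator (fun _ => b) ω ∂P < η / 4 :=
    hbt.eventually (gt_mem_nhds (by linarith))
  filter_upwards [hport, hbe] with N h1 h2
  have hOm : MeasurableSet {ω | Z N ω ∉ O m} := ((hopen m).measurableSet.preimage (hZm N)).compl
  have hi1 : Integrable ({ω | Z N ω ∉ O m}.indicator fun _ => b) P :=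
    (integrable_const b).indicator hOm
  have hi2 : Integrable ((bad N).indicator fun _ => b) P := (integrable_const b).indicator (hbm N)
  rw [Real.dist_eq, sub_zero, ← integral_sub (hHi N) (hJi N)]
  calc |∫ ω, (H N ω - J (Z N ω)) ∂P| ≤ ∫ ω, |H N ω - J (Z N ω)| ∂P := abs_integral_le_integral_abs
    _ ≤ ∫ ω, (η / 4 + {ω | Z N ω ∉ O m}.indicator (fun _ => b) ω +
          (bad N).indicator (fun _ => b) ω) ∂P := by
        refine integral_mono ((hHi N).sub (hJi N)).abs (((integrable_const _).add hi1).add hi2)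
          fun ω => ?_
        have p1 : 0 ≤ {ω | Z N ω ∉ O m}.indicator (fun _ => b) ω :=
          indicator_nonneg (fun _ _ => hbpos.le) _
        have p2 : 0 ≤ (bad N).indicator (fun _ => b) ω := indicator_nonneg (fun _ _ => hbpos.le) _
        by_cases hz : Z N ω ∈ O m
        · by_cases hlt : η / 4 < |H N ω - J (Z N ω)|
          · have : (bad N).indicator (fun _ => b) ω = b := indicator_of_mem (s := bad N) ⟨hz, hlt⟩ _
            dsimp only
            linarith [hdb N ω]
          · dsimp only
            linarith
        · have : {ω | Z N ω ∉ O m}.indicator (fun _ => b) ω = b :=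
            indicator_of_mem (s := {ω | Z N ω ∉ O m}) hz _
          dsimp only
          linarith [hdb N ω]
    _ = η / 4 + P.real {ω | Z N ω ∉ O m} * b + ∫ ω, (bad N).indicator (fun _ => b) ω ∂P := by
        have e1 : ∫ ω, (η / 4 + {ω | Z N ω ∉ O m}.indicator (fun _ => b) ω) ∂P =
            η / 4 + P.real {ω | Z N ω ∉ O m} * b := by
          refine (integral_add (integrable_const _) hi1).trans ?_
          rw [integral_indicator_const _ hOm]
          simp
        rw [← e1]
        exact integral_add ((integrable_const _).add hi1) hi2
    _ < η := by
        have : P.real {ω | Z N ω ∉ O m} * b < η / 4 / b * b := mul_lt_mul_of_pos_right h1 hbpos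
        rw [div_mul_cancel₀ _ hbpos.ne'] at this
        linarith

/-! ### From uniform closeness to convergence in distribution -/

namespace SkorokhodSpace

variable {T : ℝ} {E : Type*} [NormedAddCommGroup E]

/-- Every neighbourhood of a path in the Skorokhod topology contains a uniform ball. -/
theorem exists_uniform_ball {z : SkorokhodSpace T E} {V : Set (SkorokhodSpace T E)}
    (hV : V ∈ 𝓝 z) : ∃ δ > 0, ∀ z', (∀ t, dist (z.path t) (z'.path t) ≤ δ) → z' ∈ V := by
  by_contra! h
  choose f hf hfV using fun n : ℕ => h (1 / ((n : ℝ) + 1)) Nat.one_div_pos_of_nat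
  have h1 : Tendsto f atTop (𝓝 z) := tendsto_of_uniform fun η hη => by
    filter_upwards [(tendsto_one_div_add_atTop_nhds_zero_nat (𝕜 := ℝ)).eventually
      (gt_mem_nhds hη)] with n hn t
    exact (hf n t).trans hn.le
  obtain ⟨n, hn⟩ := (h1.eventually hV).exists
  exact hfV n hn

/-- The continuous paths, as elements of the Skorokhod space. -/
noncomputable def ofContinuous (T : ℝ) (c : C(ℝ, E)) : SkorokhodSpace T E := ofStep T 0 0 c

theorem ofContinuous_path (c : C(ℝ, E)) (t : Icc (0 : ℝ) T) : (ofContinuous T c).path t = c t :=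
  zero_add _

theorem continuous_ofContinuous (T : ℝ) : Continuous fun c : C(ℝ, E) => ofContinuous T c :=
  (continuous_ofStep T 0).comp (by fun_prop : Continuous fun c : C(ℝ, E) => ((0 : ℕ → E), c))

/-- If the random paths `Ψ N` are almost surely eventually uniformly close to a continuous function
`c` of convergent random variables `(W, Z N)` with values in the continuous paths, then they
converge in distribution, jointly with `W`. -/
theorem tendstoInDistribution_of_uniformly_close {Ω Ω' X Y : Type*} [MeasurableSpace Ω]
    [MeasurableSpace Ω'] {P : Measure Ω} [IsProbabilityMeasure P] {P' : Measure Ω'}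
    [IsProbabilityMeasure P'] [TopologicalSpace X] [MeasurableSpace X] [BorelSpace X]
    [SecondCountableTopology X] [TopologicalSpace Y] [MeasurableSpace Y] [BorelSpace Y]
    [HasOuterApproxClosed (X × Y)]
    {W : Ω → X} {Z : ℕ → Ω → Y} {W' : Ω' → X} {Z' : Ω' → Y} (hW : Measurable W)
    (hZm : ∀ N, Measurable (Z N)) (hW' : Measurable W') (hZm' : Measurable Z')
    (hZ : TendstoInDistribution (fun N ω => (W ω, Z N ω)) atTop (fun ω => (W' ω, Z' ω))
      (fun _ => P) P')
    (c : C(X × Y, C(ℝ, E))) {Ψ : ℕ → Ω → SkorokhodSpace T E} (hΨ : ∀ N, Measurable (Ψ N))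
    (hclose : ∀ᵐ ω ∂P, ∀ η > 0, ∀ᶠ N in atTop, ∀ t : Icc (0 : ℝ) T,
      dist (c (W ω, Z N ω) t) ((Ψ N ω).path t) ≤ η) :
    TendstoInDistribution (fun N ω => (W ω, Ψ N ω)) atTop
      (fun ω => (W' ω, ofContinuous T (c (W' ω, Z' ω)))) (fun _ => P) P' := by
  have hΘ : Continuous fun q : X × Y => ofContinuous T (c q) :=
    (continuous_ofContinuous T).comp c.continuous
  have hm' : Measurable fun ω => (W' ω, ofContinuous T (c (W' ω, Z' ω))) :=
    hW'.prodMk (hΘ.measurable.comp (hW'.prodMk hZm'))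
  refine ⟨fun N => (hW.prodMk (hΨ N)).aemeasurable, hm'.aemeasurable, ?_⟩
  refine ProbabilityMeasure.tendsto_iff_forall_integral_tendsto.2 fun F => ?_
  have e2 := integral_map (μ := P') hm'.aemeasurable (f := F) F.continuous.aestronglyMeasurable
  refine Tendsto.congr (fun N => (integral_map (hW.prodMk (hΨ N)).aemeasurable
    F.continuous.aestronglyMeasurable).symm) ?_
  refine Eq.mp (congrArg (fun r => Tendsto _ atTop (𝓝 r)) e2.symm) ?_
  set J : BoundedContinuousFunction (X × Y) ℝ := F.compContinuous
    ⟨fun q => (q.1, ofContinuous T (c q)), continuous_fst.prodMk hΘ⟩ with hJ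
  refine tendsto_integral_of_locally_close hZ (fun N => hW.prodMk (hZm N))
    (fun N => F.continuous.measurable.comp (hW.prodMk (hΨ N))) (B := ‖F‖)
    (fun N ω => F.norm_coe_le_norm _) J fun ε hε => ?_
  -- `A m` collects the points near which `F` tolerates a uniform perturbation of size `1 / (m +
  -- 1)`. Continuity of `F` and uniform balls inside Skorokhod neighbourhoods make the interiors
  -- exhaust the space, which replaces uniform continuity of `F`.
  set A : ℕ → Set (X × Y) := fun m => {q | ∀ z' : SkorokhodSpace T E,
    (∀ t : Icc (0 : ℝ) T, dist (c q t) (z'.path t) ≤ 1 / ((m : ℝ) + 1)) →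
      |F (q.1, z') - J q| ≤ ε} with hA
  have hAm : Monotone A := fun m n hmn q hq z' hz' =>
    hq z' fun t => (hz' t).trans (one_div_le_one_div_of_le (by positivity)
      (by exact_mod_cast Nat.succ_le_succ hmn))
  refine ⟨fun m => interior (A m), fun m n hmn => interior_mono (hAm hmn),
    fun m => isOpen_interior, eq_univ_of_forall fun q₀ => ?_, fun m => ?_⟩
  · have h1 : ∀ᶠ r in 𝓝 (q₀.1, ofContinuous T (c q₀)), |F r - J q₀| < ε / 2 := by
      have hc : Continuous fun r => |F r - J q₀| := by fun_prop
      refine (hc.tendsto _).eventually (gt_mem_nhds ?_)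
      have : F (q₀.1, ofContinuous T (c q₀)) = J q₀ := rfl
      rw [this, sub_self, abs_zero]
      exact half_pos hε
    rw [nhds_prod_eq] at h1
    obtain ⟨U, hU, V, hV, hUV⟩ := mem_prod_iff.1 h1
    obtain ⟨δ, hδ, hδV⟩ := exists_uniform_ball hV
    obtain ⟨m, hm⟩ := exists_nat_one_div_lt (half_pos hδ)
    refine mem_iUnion.2 ⟨m, mem_interior_iff_mem_nhds.2 ?_⟩
    have h2 : ∀ᶠ q in 𝓝 q₀, ∀ t ∈ Icc 0 T, dist (c q₀ t) (c q t) < δ / 2 := by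
      have := ContinuousMap.tendsto_iff_forall_isCompact_tendstoUniformlyOn.1
        (c.continuous.tendsto q₀) (Icc 0 T) isCompact_Icc
      exact Metric.tendstoUniformlyOn_iff.1 this _ (half_pos hδ)
    filter_upwards [h2, continuous_fst.tendsto q₀ hU] with q h2 h3 z' hz'
    have h4 : |F (q.1, z') - J q₀| < ε / 2 := hUV ⟨h3, hδV z' fun t => by
      rw [ofContinuous_path]
      exact (dist_triangle _ (c q t) _).trans (by linarith [h2 t t.2, hz' t])⟩
    have h5 : |J q - J q₀| < ε / 2 := hUV (a := (q.1, ofContinuous T (c q))) ⟨h3, hδV _ fun t => by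
      rw [ofContinuous_path, ofContinuous_path]
      linarith [h2 t t.2]⟩
    have := abs_sub_le (F (q.1, z')) (J q₀) (J q)
    rw [abs_sub_comm (J q₀)] at this
    linarith
  · filter_upwards [hclose] with ω hω
    filter_upwards [hω (1 / ((m : ℝ) + 1)) Nat.one_div_pos_of_nat] with N hN hmem
    exact interior_subset hmem _ hN

end SkorokhodSpace

/-! ### Measurability of the training trajectories -/

namespace TwoLayerNet

variable {d N₁ M : ℕ} {S : TwoLayerNet d N₁ M}

section Measurability

variable {Ω : Type*} [MeasurableSpace Ω]

theorem measurable_Z {N : ℕ} (ha : Measurable S.act) {θ : Ω → NetState d N₁ N}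
    {x : Ω → EuclideanSpace ℝ (Fin d)}
    (hW2 : ∀ j i, Measurable fun ω => (θ ω).W2 j i) (hW1 : ∀ j, Measurable fun ω => (θ ω).W1 j)
    (hx : Measurable x) (i : Fin N) : Measurable fun ω => S.Z (x ω) ((θ ω).unit i) :=
  (Finset.measurable_sum _ fun j _ =>
    (hW2 j i).mul (ha.comp ((hW1 j).inner hx))).const_mul _

theorem measurable_output {N : ℕ} (ha : Measurable S.act) {θ : Ω → NetState d N₁ N}
    {x : Ω → EuclideanSpace ℝ (Fin d)} (hC : ∀ i, Measurable fun ω => (θ ω).C i)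
    (hW2 : ∀ j i, Measurable fun ω => (θ ω).W2 j i) (hW1 : ∀ j, Measurable fun ω => (θ ω).W1 j)
    (hx : Measurable x) : Measurable fun ω => S.output (θ ω) (x ω) :=
  (Finset.measurable_sum _ fun i _ =>
    (hC i).mul (ha.comp (measurable_Z ha hW2 hW1 hx i))).const_mul _

theorem measurable_sgd {N : ℕ} (ha : Measurable S.act) {θ : Ω → NetState d N₁ N}
    {p : ℕ → Ω → EuclideanSpace ℝ (Fin d) × ℝ} (hC : ∀ i, Measurable fun ω => (θ ω).C i)
    (hW2 : ∀ j i, Measurable fun ω => (θ ω).W2 j i) (hW1 : ∀ j, Measurable fun ω => (θ ω).W1 j)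
    (hp : ∀ k, Measurable (p k)) (n : ℕ) :
    (∀ i, Measurable fun ω => (S.sgd (θ ω) (fun k => p k ω) n).C i) ∧
      (∀ j i, Measurable fun ω => (S.sgd (θ ω) (fun k => p k ω) n).W2 j i) ∧
      ∀ j, Measurable fun ω => (S.sgd (θ ω) (fun k => p k ω) n).W1 j := by
  induction n with
  | zero => exact ⟨hC, hW2, hW1⟩
  | succ n ih =>
    obtain ⟨h1, h2, h3⟩ := ih
    have hx := (hp n).fst
    have hd : Measurable (deriv S.act) := measurable_deriv _
    have hZ := measurable_Z (S := S) ha h2 h3 hx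
    have hr := (hp n).snd.sub (measurable_output ha h1 h2 h3 hx)
    refine ⟨fun i => (h1 i).add ((hr.const_mul _).mul (ha.comp (hZ i))), fun j i => (h2 j i).add
      ((hr.const_mul _).mul (((h1 i).mul (hd.comp (hZ i))).mul (ha.comp ((h3 j).inner hx)))),
      fun j => (h3 j).add ((((hr.const_mul _).mul ((Finset.measurable_sum _ fun i _ =>
        ((h1 i).mul (hd.comp (hZ i))).mul (h2 j i)).const_mul _)).mul
          (hd.comp ((h3 j).inner hx))).smul hx)⟩

end Measurability

end TwoLayerNet

theorem EuclideanSpace.dist_le_of_forall {ι : Type*} [Fintype ι] {x y : EuclideanSpace ℝ ι}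
    {η : ℝ} (hη : 0 ≤ η) (h : ∀ k, |x k - y k| ≤ η) : dist x y ≤ (Fintype.card ι + 1) * η := by
  rw [EuclideanSpace.dist_eq]
  refine Real.sqrt_le_iff.2 ⟨by positivity, ?_⟩
  calc ∑ k, dist (x k) (y k) ^ 2 ≤ ∑ _k : ι, η ^ 2 :=
        Finset.sum_le_sum fun k _ => pow_le_pow_left₀ dist_nonneg (h k) 2
    _ = Fintype.card ι * η ^ 2 := by simp
    _ ≤ ((Fintype.card ι + 1) * η) ^ 2 := by
        rw [mul_pow]
        refine mul_le_mul_of_nonneg_right ?_ (sq_nonneg _)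
        nlinarith [(Nat.cast_nonneg (Fintype.card ι) : (0 : ℝ) ≤ Fintype.card ι)]

/-! ### Convergence of the second order fluctuations -/

namespace TwoLayerNet

variable {d N₁ M : ℕ} {S : TwoLayerNet d N₁ M}

/-- The part of the second order fluctuations that depends on the limits `h` and `K`, as a function
of the first layer weights. -/
noncomputable def Regular.centering (hS : S.Regular) (ζ : ℝ) (N : ℕ) :
    C(Fin N₁ → EuclideanSpace ℝ (Fin d), C(ℝ, EuclideanSpace ℝ (Fin M))) :=
  ContinuousMap.curry ⟨fun q => WithLp.toLp 2 fun k => -((N : ℝ) ^ (ζ - S.φ) *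
    ((N : ℝ) ^ S.φ * S.limitOutput q.1 q.2 k + S.limitFluctuation q.1 q.2 k)),
    (PiLp.continuous_toLp 2 _).comp (continuous_pi fun k => (continuous_const.mul
      ((continuous_const.mul ((continuous_apply k).comp hS.continuous_limitOutput)).add
        ((continuous_apply k).comp hS.continuous_limitFluctuation))).neg)⟩

/-- The second order fluctuations, as a path in the Skorokhod space. -/
noncomputable def Regular.fluctuationPath (hS : S.Regular) (T ζ : ℝ) (N : ℕ) (c : ℕ → ℝ)
    (w2 : Fin N₁ → ℕ → ℝ) (w : Fin N₁ → EuclideanSpace ℝ (Fin d))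
    (p : ℕ → EuclideanSpace ℝ (Fin d) × ℝ) : SkorokhodSpace T (EuclideanSpace ℝ (Fin M)) :=
  SkorokhodSpace.ofStep T N (fun n => WithLp.toLp 2 fun k => (N : ℝ) ^ (ζ - S.φ) * ((N : ℝ) ^ S.φ *
    S.output (S.sgd (N₂ := N) ⟨fun i => c i, fun j i => w2 j i, w⟩ p n) (S.x k)))
    (hS.centering ζ N w)

theorem Regular.fluctuationPath_apply (hS : S.Regular) {T : ℝ} (ζ : ℝ) (N : ℕ) (c : ℕ → ℝ)
    (w2 : Fin N₁ → ℕ → ℝ) (w : Fin N₁ → EuclideanSpace ℝ (Fin d))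
    (p : ℕ → EuclideanSpace ℝ (Fin d) × ℝ) (t : Icc (0 : ℝ) T) (k : Fin M) :
    (hS.fluctuationPath T ζ N c w2 w p).path t k =
      S.fluctuation₂ ζ N c w2 w p (S.limitOutput w) (S.limitFluctuation w) t k := by
  change (N : ℝ) ^ (ζ - S.φ) * ((N : ℝ) ^ S.φ * S.outputPath N c w2 w p t k) +
    -((N : ℝ) ^ (ζ - S.φ) * ((N : ℝ) ^ S.φ * S.limitOutput w t k + S.limitFluctuation w t k)) = _
  rw [fluctuation₂, fluctuation₁]
  ring

/-- The limiting path, as a function of the first layer weights and of the Gaussian vector. -/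
noncomputable def Regular.limitPath (hS : S.Regular) (a b : ℝ) :
    C((Fin N₁ → EuclideanSpace ℝ (Fin d)) × EuclideanSpace ℝ (Fin M),
      C(ℝ, EuclideanSpace ℝ (Fin M))) :=
  ContinuousMap.curry ⟨fun q => WithLp.toLp 2 (S.limitSecond b q.1.1 (a • q.1.2.ofLp) q.2),
    (PiLp.continuous_toLp 2 _).comp (hS.continuous_limitSecond b
      (ψ₀ := fun q : (Fin N₁ → EuclideanSpace ℝ (Fin d)) × EuclideanSpace ℝ (Fin M) =>
        a • q.2.ofLp) continuous_fst
      (((PiLp.continuous_ofLp 2 _).comp continuous_snd).const_smul a))⟩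

theorem Regular.limitPath_apply (hS : S.Regular) (a b : ℝ)
    (q : (Fin N₁ → EuclideanSpace ℝ (Fin d)) × EuclideanSpace ℝ (Fin M)) (t : ℝ) (k : Fin M) :
    hS.limitPath a b q t k = S.limitSecond b q.1 (a • q.2.ofLp) t k := rfl

variable {Ω : Type*} [MeasurableSpace Ω] {P : Measure Ω}
  [IsProbabilityMeasure P] {C : ℕ → Ω → ℝ} {W2 : Fin N₁ → ℕ → Ω → ℝ}
  {W1 : Fin N₁ → Ω → EuclideanSpace ℝ (Fin d)} {p : ℕ → Ω → EuclideanSpace ℝ (Fin d) × ℝ}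

namespace Assumptions

theorem measurable_fluctuationPath (hS : S.Assumptions P C W2 W1 p) (hN₁ : 0 < N₁) (T ζ : ℝ)
    (N : ℕ) : Measurable fun ω => (hS.regular hN₁).fluctuationPath T ζ N (fun i => C i ω)
      (fun j i => W2 j i ω) (fun j => W1 j ω) fun n => p n ω := by
  have ha : Measurable S.act := hS.act_smooth.continuous.measurable
  have hW : Measurable fun ω j => W1 j ω := measurable_pi_lambda _ hS.measurableW1
  have hu : Measurable fun (ω : Ω) (n : ℕ) => (WithLp.toLp 2 fun k => (N : ℝ) ^ (ζ - S.φ) *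
      ((N : ℝ) ^ S.φ * S.output (S.sgd (N₂ := N) ⟨fun i => C i ω, fun j i => W2 j i ω,
        fun j => W1 j ω⟩ (fun n => p n ω) n) (S.x k)) : EuclideanSpace ℝ (Fin M)) := by
    refine measurable_pi_lambda _ fun n => (PiLp.continuous_toLp 2 _).measurable.comp
      (measurable_pi_lambda _ fun k => ?_)
    obtain ⟨h1, h2, h3⟩ := measurable_sgd (S := S) (N := N) (θ := fun ω =>
      ⟨fun i => C i ω, fun j i => W2 j i ω, fun j => W1 j ω⟩) ha (fun i => hS.measurableC i)
      (fun j i => hS.measurableW2 j i) (fun j => hS.measurableW1 j) hS.measurable_sample n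
    exact ((measurable_output ha h1 h2 h3 measurable_const).const_mul _).const_mul _
  have hc : Continuous fun q : (ℕ → EuclideanSpace ℝ (Fin M)) ×
      (Fin N₁ → EuclideanSpace ℝ (Fin d)) =>
      SkorokhodSpace.ofStep T N q.1 ((hS.regular hN₁).centering ζ N q.2) :=
    (SkorokhodSpace.continuous_ofStep T N).comp (continuous_fst.prodMk
      (((hS.regular hN₁).centering ζ N).continuous.comp continuous_snd))
  exact hc.measurable.comp (hu.prodMk hW)

/-- The second order fluctuations converge in distribution, jointly with the first layer weights. -/
theorem tendsto_fluctuationPath (hS : S.Assumptions P C W2 W1 p) (hN₁ : 0 < N₁)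
    [IsProbabilityMeasure S.lawW1] {T : ℝ} (hT : 0 < T) (hγ : S.γ₂ ∈ Ioo (1 / 2 : ℝ) 1) {ζ : ℝ}
    (hζ₁ : ζ ≤ S.γ₂ - 1 / 2) (hζ₂ : ζ ≤ 2 - 2 * S.γ₂) :
    TendstoInDistribution (fun N ω => ((fun j => W1 j ω), (hS.regular hN₁).fluctuationPath T ζ N
      (fun i => C i ω) (fun j i => W2 j i ω) (fun j => W1 j ω) fun n => p n ω)) atTop
      (fun q => (q.1, SkorokhodSpace.ofContinuous T
        ((hS.regular hN₁).limitPath (S.initFactor ζ) (S.sourceFactor ζ) (q.1, q.2))))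
      (fun _ => P) ((Measure.pi fun _ => S.lawW1) ⊗ₘ gaussianKernel (hS.regular hN₁)) := by
  -- The loss `s` must stay below every gap between exponents; the gap `γ₂ - 1/2 - ζ` counts only
  -- when it is not zero.
  obtain ⟨s, hs, hsγ, hsγ', hsζ⟩ : ∃ s : ℝ, 0 < s ∧ s < S.γ₂ - 1 / 2 ∧ s < 1 - S.γ₂ ∧
      (ζ ≠ S.γ₂ - 1 / 2 → s < S.γ₂ - 1 / 2 - ζ) := by
    have h1 : 0 < min (S.γ₂ - 1 / 2) (1 - S.γ₂) :=
      lt_min (by linarith [hγ.1]) (by linarith [hγ.2])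
    rcases eq_or_ne ζ (S.γ₂ - 1 / 2) with h | h
    · obtain ⟨s, h2, h3⟩ := exists_between h1
      exact ⟨s, h2, h3.trans_le (min_le_left _ _), h3.trans_le (min_le_right _ _),
        fun h' => absurd h h'⟩
    · obtain ⟨s, h2, h3⟩ := exists_between (lt_min h1 (sub_pos.2 (lt_of_le_of_ne hζ₁ h)))
      have h4 := h3.trans_le (min_le_left _ _)
      exact ⟨s, h2, h4.trans_le (min_le_left _ _), h4.trans_le (min_le_right _ _),
        fun _ => h3.trans_le (min_le_right _ _)⟩
  have hreg := hS.regular hN₁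
  have hW : Measurable fun ω j => W1 j ω := measurable_pi_lambda _ hS.measurableW1
  have hU : Measurable fun ω i => initUnit C W2 i ω :=
    measurable_pi_lambda _ hS.measurable_initUnit
  refine SkorokhodSpace.tendstoInDistribution_of_uniformly_close hW
    (fun N => (hreg.continuous_gaussianSum N).measurable.comp (hW.prodMk hU)) measurable_fst
    measurable_snd (hS.tendsto_joint hN₁) _ (hS.measurable_fluctuationPath hN₁ T ζ) ?_
  filter_upwards [hS.ae_typical hN₁ hs] with ω ty η hη
  have hM : (0 : ℝ) < Fintype.card (Fin M) + 1 := by positivity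
  filter_upwards [ty.fluctuation_sub hreg hN₁ hT hγ.2 hs hsγ hsγ' hζ₁ hζ₂ hsζ
    (div_pos hη hM)] with N hN t
  refine (EuclideanSpace.dist_le_of_forall (div_pos hη hM).le fun k => ?_).trans
    (mul_div_cancel₀ η hM.ne').le
  rw [abs_sub_comm, Regular.fluctuationPath_apply]
  exact hN t t.2 k

end Assumptions

end TwoLayerNet

/-! ### The main theorem -/

theorem mainTheorem5 {d N₁ M : ℕ} (hN₁ : 0 < N₁) (hM : 0 < M) (S : TwoLayerNet d N₁ M)
    (hγ₁ : S.γ₁ ∈ Set.Ico (1 / 2 : ℝ) 1) (hγ₂ : S.γ₂ ∈ Set.Ioo (3 / 4 : ℝ) 1)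
    {T : ℝ} (hT : 0 < T)
    {Ω : Type*} [MeasurableSpace Ω] (P : Measure Ω) [IsProbabilityMeasure P]
    (C : ℕ → Ω → ℝ) (W2 : Fin N₁ → ℕ → Ω → ℝ) (W1 : Fin N₁ → Ω → EuclideanSpace ℝ (Fin d))
    (p : ℕ → Ω → EuclideanSpace ℝ (Fin d) × ℝ)
    (hS : S.Assumptions P C W2 W1 p)
    (ζ : ℝ)
    (hζ : (S.γ₂ < 5 / 6 ∧ ζ ≤ S.γ₂ - 1 / 2) ∨ (5 / 6 ≤ S.γ₂ ∧ ζ ≤ 2 - 2 * S.γ₂)) :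
    -- the deterministic limits `h` and `K`, given the initial first layer weights `w`
    ∃ h K : (Fin N₁ → EuclideanSpace ℝ (Fin d)) → ℝ → Fin M → ℝ,
      (∀ w, S.IsLimitOutput T w (h w)) ∧
      (∀ w, S.IsLimitFluctuation₁ T w (h w) (K w)) ∧
      -- the second order fluctuations, as random elements of the Skorokhod space
      ∃ Ψ : ℕ → Ω → SkorokhodSpace T (EuclideanSpace ℝ (Fin M)),
        (∀ (N₂ : ℕ) (ω : Ω) (t : Set.Icc (0 : ℝ) T) (k : Fin M),
          (Ψ N₂ ω).path t k =
            S.fluctuation₂ ζ N₂ (fun i => C i ω) (fun j i => W2 j i ω) (fun j => W1 j ω)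
              (fun n => p n ω) (h fun j => W1 j ω) (K fun j => W1 j ω) t k) ∧
        -- the limit: first layer weights `w`, Gaussian vector `G`, limit process `Ψlim`
        ∃ (Ω' : Type) (_ : MeasurableSpace Ω') (P' : Measure Ω') (_ : IsProbabilityMeasure P')
          (w : Ω' → Fin N₁ → EuclideanSpace ℝ (Fin d)) (G : Ω' → EuclideanSpace ℝ (Fin M))
          (κ : Kernel (Fin N₁ → EuclideanSpace ℝ (Fin d)) (EuclideanSpace ℝ (Fin M)))
          (ψ : Ω' → ℝ → Fin M → ℝ)
          (Ψlim : Ω' → SkorokhodSpace T (EuclideanSpace ℝ (Fin M))),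
          HasLaw w (Measure.pi fun _ : Fin N₁ => S.lawW1) P' ∧
          (∀ v, κ v = multivariateGaussian 0 (S.cov v)) ∧
          HasCondDistrib G w κ P' ∧
          (∀ (ω : Ω') (t : Set.Icc (0 : ℝ) T) (k : Fin M), (Ψlim ω).path t k = ψ ω t k) ∧
          TendstoInDistribution (fun (N₂ : ℕ) (ω : Ω) => ((fun j => W1 j ω), Ψ N₂ ω)) atTop
            (fun ω => (w ω, Ψlim ω)) (fun _ => P) P' ∧
          ((S.γ₂ < 5 / 6 ∨ ζ < 2 - 2 * S.γ₂) → ∀ ω,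
            S.SolvesHomogeneous T (w ω)
              (fun k => if ζ = S.γ₂ - 1 / 2 then G ω k else 0) (ψ ω)) ∧
          ((5 / 6 ≤ S.γ₂ ∧ ζ = 2 - 2 * S.γ₂) → ∀ ω,
            S.SolvesForced T (w ω) (h (w ω)) (K (w ω))
              (fun k => if S.γ₂ = 5 / 6 then G ω k else 0) (ψ ω)) := by
  have hreg := hS.regular hN₁
  have hlaw : IsProbabilityMeasure S.lawW1 := (hS.hasLawW1 ⟨0, hN₁⟩).isProbabilityMeasure_iff.1 inferInstance
  -- The two regimes together say that ζ is at most the minimum of `γ₂ - 1/2` and `2 - 2γ₂`; the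
  -- minimum switches at `γ₂ = 5/6`.
  have hζ₁ : ζ ≤ S.γ₂ - 1 / 2 := by rcases hζ with h | h <;> linarith [h.1, h.2]
  have hζ₂ : ζ ≤ 2 - 2 * S.γ₂ := by rcases hζ with h | h <;> linarith [h.1, h.2]
  -- The limit lives on the canonical space of pairs (w, G), where the conditional law of G given w
  -- is the kernel by construction.
  set P' := (Measure.pi fun _ : Fin N₁ => S.lawW1) ⊗ₘ TwoLayerNet.gaussianKernel hreg with hP'
  have hfst : P'.map Prod.fst = Measure.pi fun _ : Fin N₁ => S.lawW1 :=
    Measure.fst_compProd _ _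
  refine ⟨S.limitOutput, S.limitFluctuation, hreg.isLimitOutput hN₁ T,
    hreg.isLimitFluctuation hN₁ T, fun N ω => hreg.fluctuationPath T ζ N (fun i => C i ω)
      (fun j i => W2 j i ω) (fun j => W1 j ω) fun n => p n ω,
    fun N ω t k => hreg.fluctuationPath_apply _ _ _ _ _ _ t k,
    (Fin N₁ → EuclideanSpace ℝ (Fin d)) × EuclideanSpace ℝ (Fin M), inferInstance, P',
    inferInstance, Prod.fst, Prod.snd, TwoLayerNet.gaussianKernel hreg,
    fun q => S.limitSecond (S.sourceFactor ζ) q.1 (S.initFactor ζ • q.2.ofLp),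
    fun q => SkorokhodSpace.ofContinuous T
      (hreg.limitPath (S.initFactor ζ) (S.sourceFactor ζ) (q.1, q.2)),
    ⟨measurable_fst.aemeasurable, hfst⟩, fun _ => rfl, ?_, fun q t k => ?_,
    hS.tendsto_fluctuationPath hN₁ hT ⟨by linarith [hγ₂.1], hγ₂.2⟩ hζ₁ hζ₂, fun hcase q => ?_,
    fun hcase q => ?_⟩
  · refine ⟨by fun_prop, ?_⟩
    rw [hfst]
    exact Measure.map_id
  · rw [SkorokhodSpace.ofContinuous_path, TwoLayerNet.Regular.limitPath_apply]
  -- For `γ₂ < 5/6` one has `ζ ≤ γ₂ - 1/2 < 2 - 2γ₂`, so the source is always subcritical.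
  · have hb : S.sourceFactor ζ = 0 := if_neg (by rcases hcase with h | h <;> intro h' <;> linarith)
    have ha : (fun k => if ζ = S.γ₂ - 1 / 2 then q.2 k else 0) = S.initFactor ζ • q.2.ofLp := by
      ext k
      rw [TwoLayerNet.initFactor]
      split_ifs <;> simp
    rw [hb, ha]
    exact hreg.solvesHomogeneous hN₁ T _ _
  · have hb : S.sourceFactor ζ = 1 := if_pos hcase.2
    have ha : (fun k => if S.γ₂ = 5 / 6 then q.2 k else 0) = S.initFactor ζ • q.2.ofLp := by
      -- With `ζ = 2 - 2γ₂`, the two critical exponents agree exactly at `γ₂ = 5/6`.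
      have hiff : S.γ₂ = 5 / 6 ↔ ζ = S.γ₂ - 1 / 2 :=
        ⟨fun h => by linarith [hcase.2], fun h => by linarith [hcase.2]⟩
      ext k
      simp only [hiff]
      rw [TwoLayerNet.initFactor]
      split_ifs <;> simp
    rw [hb, ha]
    exact hreg.solvesForced hN₁ T _ _
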